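/- Notation. Fix $\omega$ with $\operatorname{Im}\omega>0$ and let $[z]=\vartheta_{11}(z\,|\,\omega)$ be the odd theta function. For parameters $\varepsilon=(\varepsilon_0,\dots,\varepsilon_9)\in\mathbb C^{10}$ put $[ij]=[\varepsilon_i-\varepsilon_j]$, $[ijk]=[\varepsilon_0-\varepsilon_i-\varepsilon_j-\varepsilon_k]$, $\delta=3\varepsilon_0-\varepsilon_1-\dots-\varepsilon_9$, and write $\overline7$, $\underline6$ for indices with $\varepsilon_{\overline7}=\varepsilon_7+\delta$, $\varepsilon_{\underline6}=\varepsilon_6+\delta$. The affine Weyl group of type $E_8^{(1)}$, generated by $s_0,\dots,s_8$, acts birationally on $\varepsilon$, $f=(f_1,f_2,f_3)$ and $\tau=(\tau_1,\dots,\tau_9)$, by ring automorphisms. For $k\ge1$, $s_k$ exchanges the indices $k,k+1$ of $\varepsilon$ and of $\tau$. It exchanges $f_k,f_{k+1}$ for $k=1,2$, fixes $f$ for $k\ge4$, and $s_3(f_3)=\frac{\tau_3}{\tau_4}f_3$, $s_3(f_i)=\frac{\tau_3}{\tau_4}(c_{i3}f_i+c_{3i}f_3)$ $(i=1,2)$,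 where $c_{ij}=\frac{[\varepsilon_i-\varepsilon_4][\alpha_0+\varepsilon_j-\varepsilon_4]}{[\varepsilon_i-\varepsilon_j][\alpha_0]}$ and $\alpha_0=\varepsilon_0-\varepsilon_1-\varepsilon_2-\varepsilon_3$. The generator $s_0$ adds $\alpha_0$ to $\varepsilon_0,\dots,\varepsilon_3$, maps $f_i\mapsto 1/f_i$, $\tau_i\mapsto f_i\tau_i$ for $i\le 3$, and fixes the rest. Let $s_{ij}$, $s_{ijk}$ be the reflections in $\varepsilon_i-\varepsilon_j$ and $\varepsilon_0-\varepsilon_i-\varepsilon_j-\varepsilon_k$, and put $\mu=s_{126}s_{346}s_{568}s_{15}s_{28}s_{79}s_{67}$, $T=\mu^2$, $g_i=\mu(f_i)$. The elliptic Painlevé equation (for $T=T_{\alpha_6}$) is the action of $T$ on $f$. Put $\overline X=T(X)$, $\underline X=T^{-1}(X)$. Theorem. (1) On the parameters $T$ is the translation along $\alpha_6=\varepsilon_6-\varepsilon_7$: $\overline{\varepsilon_0}=\varepsilon_0+3(\delta-\alpha_6)$, $\overline{\varepsilon_6}=\varepsilon_6-\alpha_6$, $\overline{\varepsilon_7}=\varepsilon_7+2\delta-\alpha_6$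 and $\overline{\varepsilon_i}=\varepsilon_i+\delta-\alpha_6$ otherwise. Generically $g_i=Q_i(f)/P_i(f)$ and $\overline{f_i}=S_i(g)/R_i(g)$ $(i=1,2,3)$, $\mu(\tau_i)\tau_6\tau_j=P_i(f)\tau_1\tau_2\tau_3$ and $T(\tau_i)\mu(\tau_6)\mu(\tau_j)=R_i(g)\mu(\tau_1)\mu(\tau_2)\mu(\tau_3)$, where, with $j=8,5,4$ and $(a,b)=(2,3),(1,3),(1,2)$ for $i=1,2,3$, $$P_i=\tfrac{[1j][16][1j6]}{[12][13][123]}f_1-\tfrac{[2j][26][2j6]}{[12][23][123]}f_2+\tfrac{[3j][36][3j6]}{[13][23][123]}f_3,$$ $$Q_i=-\tfrac{[23j][236][1j6]}{[12][13][123]}f_2f_3+\tfrac{[13j][136][2j6]}{[12][23][123]}f_1f_3-\tfrac{[12j][126][3j6]}{[13][23][123]}f_1f_2,$$ $$R_i=-\tfrac{[i8][689][i\overline78]}{[48][58][123]}g_1+\tfrac{[i5][569][i5\overline7]}{[45][58][123]}g_2-\tfrac{[i4][469][i4\overline7]}{[45][48][123]}g_3,$$ $$S_i=-\tfrac{[ab8][45\overline7][i\overline78]}{[48][58][123]}g_2g_3+\tfrac{[ab5][4\overline78][i5\overline7]}{[45][58][123]}g_1g_3-\tfrac{[ab4][5\overline78][i4\overline7]}{[45][48][123]}g_1g_2.$$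 (2) If $[\varepsilon_3-\varepsilon_4]=0$ (and no other $[ij]$, $[ijk]$ with distinct indices in $\{1,\dots,9\}$ vanishes at $\varepsilon$ and at $\overline\varepsilon$), the system can consistently be specialised to $\tau_3=0$, $f_3=g_3=\infty$: as $f_3\to\infty$ with $f_1,f_2$ and $f_3\tau_3$ fixed, $g_1,g_2$ have finite limits and $\mu(\tau_3)\to0$; as $g_3\to\infty$ with $g_1,g_2$ and $g_3\mu(\tau_3)$ fixed, $\overline{f_1},\overline{f_2}$ have finite limits and $T(\tau_3)\to0$. Moreover $g_3\to\infty$ unless $[23][234][236][146]f_2=[13][134][136][246]f_1$, and $\overline{f_3}\to\infty$ unless $[45][128][45\overline7][3\overline78]g_2=[48][125][4\overline78][3\overline75]g_1$. The resulting map $(f_1,f_2)\mapsto(\overline{f_1},\overline{f_2})$ is the specialised elliptic Painlevé equation. (3) The transformation $w=s_{289}s_{48}s_{39}$ commutes with $T$ on the parameters, $w(\varepsilon_3-\varepsilon_4)=\varepsilon_9-\varepsilon_8$, and $F:=w(f_1)=\tau_8/\tau_1$. Let $\varepsilon_8=\varepsilon_9$ and consider an orbit $(\varepsilon^{(k)})_{k\in\mathbb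 Z}$ of $T$ and a set $I\subset\mathbb Z$ of times $k$ at which no $[ij]$ with $i<j$ and $(i,j)\ne(8,9)$, no $[ijk]$ with distinct indices, and not $[\overline76]$, vanishes. Then the gauge equation $\overline g=\frac{[169][\overline799]}{[1\overline79][699]}g$ has a nowhere vanishing solution along $I$. For each such $g$, a sequence $F=g\Phi$ is the first component of a solution, at the steps $k\to k+1$ with $k,k+1\in I$, of the specialised elliptic Painlevé equation with parameters $w(\varepsilon^{(k)})$ if and only if, whenever $k-1,k,k+1\in I$, $$\frac{[79][\overline799][799]\prod_{i=1}^5[i69]}{[76][\overline76]}(\overline\Phi-\Phi)=\frac{[69][\underline699][699]\prod_{i=1}^5[i79]}{[76][7\underline6]}(\Phi-\underline\Phi)-[679]\prod_{i=1}^5[i9]\;\Phi .$$ (4) Put $u_0=\varepsilon_0-3\varepsilon_9-\delta$, $u_i=\varepsilon_i-\varepsilon_9$ $(1\le i\le7)$. If $\varepsilon_8=\varepsilon_9$, then $2\delta+3u_0-\sum_{i=1}^7u_i=0$, $T$ fixes $\delta$ and acts on $u$ by $u_6\mapsto u_6-\delta$, $u_7\mapsto u_7+\delta$, and for $\Phi$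 a function of $u$ the equation in (3) is the elliptic hypergeometric equation $$\frac{[u_7][u_0-u_7][\delta+u_0-u_7]\prod_{i=1}^5[\delta+u_0-u_i-u_6]}{[u_7-u_6][u_7-u_6+\delta]}\bigl(\Phi(6^-7^+)-\Phi\bigr)=\frac{[u_6][u_0-u_6][\delta+u_0-u_6]\prod_{i=1}^5[\delta+u_0-u_i-u_7]}{[u_7-u_6][u_7-u_6-\delta]}\bigl(\Phi-\Phi(7^-6^+)\bigr)+\prod_{i=1}^5[u_i]\,[u_7+u_6-u_0-\delta]\,\Phi,$$ where $\Phi(i^-j^+)=\Phi|_{u_i\mapsto u_i-\delta,\,u_j\mapsto u_j+\delta}$. (5) Let $2\delta+3u_0=\sum_{i=1}^7u_i$ and let one of $u_1,\dots,u_7$ be $0,-\delta,-2\delta,\dots$. Then the terminating very-well-poised balanced series $${}_{10}E_9(u_0,\dots,u_7)=\sum_{n\ge0}\frac{[u_0+2n\delta]}{[u_0]}\prod_{r=0}^7\frac{[u_r]_n}{[u_0-u_r+\delta]_n},\qquad [z]_n=[z][z+\delta]\cdots[z+(n-1)\delta],$$ solves the elliptic hypergeometric equation at $u$, provided that the denominators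 of the equation, and those of all terms of the series at $u$ and at the two shifted points, are nonzero. (6) Hence, for an orbit and a set $I$ as in (3) such that, at all times in $I$, moreover one of $u_1,\dots,u_7$ is $0,-\delta,-2\delta,\dots$ and the denominators of the terms of ${}_{10}E_9(u)$ are nonzero, $F=g\cdot{}_{10}E_9(u_0,\dots,u_7)$ is the first component of a particular solution of the specialised elliptic Painlevé equation at the steps $k\to k+1$ with $k,k+1\in I$. -/

import Mathlib

open Filter Topology

noncomputable section

namespace EllipticPainleve

/-- The odd theta function `[z] = ϑ₁₁(z | ω) = ∑ₙ exp(πi(n+1/2)²ω + 2πi(n+1/2)(z+1/2))`. -/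
def br (ω z : ℂ) : ℂ :=
  Complex.exp (Real.pi * Complex.I * ω / 4 + Real.pi * Complex.I * (z + 1 / 2)) *
    jacobiTheta₂ (z + 1 / 2 + ω / 2) ω

/-- Parameters `(ε₀, ε₁, …, ε₉)`. -/
abbrev Param := Fin 10 → ℂ

/-- `[ij] = [εᵢ - εⱼ]`. -/
def br2 (ω : ℂ) (e : Param) (i j : Fin 10) : ℂ := br ω (e i - e j)

/-- `[ijk] = [ε₀ - εᵢ - εⱼ - εₖ]`. -/
def br3 (ω : ℂ) (e : Param) (i j k : Fin 10) : ℂ := br ω (e 0 - e i - e j - e k)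

/-- `δ = 3 ε₀ - ε₁ - ⋯ - ε₉`. -/
def del (e : Param) : ℂ := 3 * e 0 - ∑ i : Fin 9, e i.succ

/-! ### The birational action of the affine Weyl group of type `E₈⁽¹⁾` -/

/-- A point at which the elements of the ring `K(f₁,f₂,f₃)[τ₁^±,…,τ₉^±]` are evaluated. The
coordinates carry their usual indices: only `f 1, f 2, f 3` and `tau 1, …, tau 9` are used. -/
@[ext] structure TauPoint where
  eps : Param
  f : Fin 10 → ℂ
  tau : Fin 10 → ℂ

/-- The values of `sₖ(ε₀), …, sₖ(ε₉)` at the parameter `e`. -/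
def sParam (k : Fin 9) (e : Param) : Param :=
  if k = 0 then fun i => if i ≤ 3 then e i + (e 0 - e 1 - e 2 - e 3) else e i
  else fun i => e (Equiv.swap k.castSucc k.succ i)

/-- `c_{i,j} = [εᵢ-ε₄][α₀+εⱼ-ε₄] / ([εᵢ-εⱼ][α₀])`, where `α₀ = ε₀-ε₁-ε₂-ε₃`. -/
def cCoef (ω : ℂ) (e : Param) (i j : Fin 10) : ℂ :=
  br2 ω e i 4 * br ω (e 0 - e 1 - e 2 - e 3 + e j - e 4) / (br2 ω e i j * br3 ω e 1 2 3)

/-- The values of `sₖ(ε)`, `sₖ(f)`, `sₖ(τ)` at the point `x`. -/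
def sPoint (ω : ℂ) (k : Fin 9) (x : TauPoint) : TauPoint where
  eps := sParam k x.eps
  tau :=
    if k = 0 then fun i => if i = 1 ∨ i = 2 ∨ i = 3 then x.f i * x.tau i else x.tau i
    else fun i => x.tau (Equiv.swap k.castSucc k.succ i)
  f :=
    if k = 0 then fun i => (x.f i)⁻¹
    else if k = 1 ∨ k = 2 then fun i => x.f (Equiv.swap k.castSucc k.succ i)
    else if k = 3 then fun i =>
      if i = 1 ∨ i = 2 then
        x.tau 3 / x.tau 4 * (cCoef ω x.eps i 3 * x.f i + cCoef ω x.eps 3 i * x.f 3)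
      else x.tau 3 / x.tau 4 * x.f i
    else x.f

/-- The values at `e` of the images of `ε₀, …, ε₉` under `s_{k₁} s_{k₂} ⋯ s_{kᵣ}`, where
`w = [k₁, …, kᵣ]`. As the `sₖ` act on functions, `s_{k₁}` is the first substitution made. -/
def actParam (w : List (Fin 9)) (e : Param) : Param := w.foldl (fun y k => sParam k y) e

/-- The values at `x` of the images of the coordinates `ε`, `f`, `τ` under
`s_{k₁} s_{k₂} ⋯ s_{kᵣ}`, where `w = [k₁, …, kᵣ]`. -/
def actPoint (ω : ℂ) (w : List (Fin 9)) (x : TauPoint) : TauPoint :=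
  w.foldl (fun y k => sPoint ω k y) x

/-- None of the numbers `[ij]` (`1 ≤ i < j ≤ 9`) with `(i,j) ∉ S` and `[ijk]`
(`1 ≤ i < j < k ≤ 9`) vanishes. -/
def GenericOff (ω : ℂ) (S : Set (Fin 10 × Fin 10)) (e : Param) : Prop :=
  (∀ i j : Fin 10, 0 < i → i < j → (i, j) ∉ S → br2 ω e i j ≠ 0) ∧
  (∀ i j k : Fin 10, 0 < i → i < j → j < k → br3 ω e i j k ≠ 0)

/-- The point has generic parameters and nonvanishing coordinates. -/
def Nondegenerate (ω : ℂ) (x : TauPoint) : Prop :=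
  GenericOff ω ∅ x.eps ∧ x.f 1 ≠ 0 ∧ x.f 2 ≠ 0 ∧ x.f 3 ≠ 0 ∧ ∀ i : Fin 10, 0 < i → x.tau i ≠ 0

/-- The substitutions that make up the action of `w` can be carried out at `x` without ever
meeting a vanishing denominator. -/
def Regular (ω : ℂ) (w : List (Fin 9)) (x : TauPoint) : Prop :=
  ∀ v : List (Fin 9), v <+: w → Nondegenerate ω (actPoint ω v x)

/-- The word `s_{a-1} s_{a-2} ⋯ s_b`. It maps `e_b` to `e_a` and `e_m` to `e_{m-1}` for
`b < m ≤ a`. -/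
def descend (a b : ℕ) : List (Fin 9) :=
  (List.range (a - b)).map fun m => Fin.ofNat 9 (a - 1 - m)

/-- The reflection `s_{ij}` in `eᵢ - eⱼ` (`1 ≤ i < j ≤ 9`), as a conjugate of `sᵢ`. -/
def refl2 (i j : ℕ) : List (Fin 9) :=
  descend j (i + 1) ++ [Fin.ofNat 9 i] ++ (descend j (i + 1)).reverse

/-- The reflection `s_{ijk}` in `e₀ - eᵢ - eⱼ - eₖ` (`1 ≤ i < j < k ≤ 9`), as a conjugate
of `s₀`. -/
def refl3 (i j k : ℕ) : List (Fin 9) :=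
  (descend i 1 ++ descend j 2 ++ descend k 3) ++ [0] ++
    (descend i 1 ++ descend j 2 ++ descend k 3).reverse

/-- `μ = s₁₂₆ s₃₄₆ s₅₆₈ s₁₅ s₂₈ s₇₉ s₆₇`. -/
def muWord : List (Fin 9) :=
  refl3 1 2 6 ++ refl3 3 4 6 ++ refl3 5 6 8 ++ refl2 1 5 ++ refl2 2 8 ++ refl2 7 9 ++ refl2 6 7

/-- The translation `T_{α₆} = μ²` along `α₆ = e₆ - e₇`. -/
def tWord : List (Fin 9) := muWord ++ muWord

/-- `s₂₈₉ s₄₈ s₃₉`. -/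
def wWord : List (Fin 9) := refl3 2 8 9 ++ refl2 4 8 ++ refl2 3 9

/-! ### The explicit form of the elliptic Painlevé equation -/

/-- The parameters with `ε₇` replaced by `ε₇ + δ`. -/
def bar7 (e : Param) : Param := Function.update e 7 (e 7 + del e)

/-- The parameters with `ε₆` replaced by `ε₆ + δ`. -/
def under6 (e : Param) : Param := Function.update e 6 (e 6 + del e)

/-- `j = 8, 5, 4` for `i = 1, 2, 3`. -/
def jIdx (i : Fin 10) : Fin 10 := if i = 1 then 8 else if i = 2 then 5 else 4

/-- `a = 2, 1, 1` for `i = 1, 2, 3`. -/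
def aIdx (i : Fin 10) : Fin 10 := if i = 1 then 2 else 1

/-- `b = 3, 3, 2` for `i = 1, 2, 3`. -/
def bIdx (i : Fin 10) : Fin 10 := if i = 3 then 2 else 3

/-- The polynomial `Pᵢ(f₁,f₂,f₃)`. -/
def polyP (ω : ℂ) (e : Param) (i : Fin 10) (f₁ f₂ f₃ : ℂ) : ℂ :=
  let j := jIdx i;
  br2 ω e 1 j * br2 ω e 1 6 * br3 ω e 1 j 6 / (br2 ω e 1 2 * br2 ω e 1 3 * br3 ω e 1 2 3) * f₁
  - br2 ω e 2 j * br2 ω e 2 6 * br3 ω e 2 j 6 / (br2 ω e 1 2 * br2 ω e 2 3 * br3 ω e 1 2 3) * f₂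
  + br2 ω e 3 j * br2 ω e 3 6 * br3 ω e 3 j 6 / (br2 ω e 1 3 * br2 ω e 2 3 * br3 ω e 1 2 3) * f₃

/-- The polynomial `Qᵢ(f₁,f₂,f₃)`. -/
def polyQ (ω : ℂ) (e : Param) (i : Fin 10) (f₁ f₂ f₃ : ℂ) : ℂ :=
  let j := jIdx i;
  - (br3 ω e 2 3 j * br3 ω e 2 3 6 * br3 ω e 1 j 6 /
      (br2 ω e 1 2 * br2 ω e 1 3 * br3 ω e 1 2 3)) * (f₂ * f₃)
  + br3 ω e 1 3 j * br3 ω e 1 3 6 * br3 ω e 2 j 6 /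
      (br2 ω e 1 2 * br2 ω e 2 3 * br3 ω e 1 2 3) * (f₁ * f₃)
  - br3 ω e 1 2 j * br3 ω e 1 2 6 * br3 ω e 3 j 6 /
      (br2 ω e 1 3 * br2 ω e 2 3 * br3 ω e 1 2 3) * (f₁ * f₂)

/-- The polynomial `Rᵢ(g₁,g₂,g₃)`; in it the index `7` always occurs barred. -/
def polyR (ω : ℂ) (e : Param) (i : Fin 10) (g₁ g₂ g₃ : ℂ) : ℂ :=
  let d := bar7 e;
  - (br2 ω e i 8 * br3 ω e 6 8 9 * br3 ω d i 7 8 /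
      (br2 ω e 4 8 * br2 ω e 5 8 * br3 ω e 1 2 3)) * g₁
  + br2 ω e i 5 * br3 ω e 5 6 9 * br3 ω d i 5 7 /
      (br2 ω e 4 5 * br2 ω e 5 8 * br3 ω e 1 2 3) * g₂
  - br2 ω e i 4 * br3 ω e 4 6 9 * br3 ω d i 4 7 /
      (br2 ω e 4 5 * br2 ω e 4 8 * br3 ω e 1 2 3) * g₃

/-- The polynomial `Sᵢ(g₁,g₂,g₃)`; in it the index `7` always occurs barred. -/
def polyS (ω : ℂ) (e : Param) (i : Fin 10) (g₁ g₂ g₃ : ℂ) : ℂ :=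
  let d := bar7 e;
  let a := aIdx i;
  let b := bIdx i;
  - (br3 ω e a b 8 * br3 ω d 4 5 7 * br3 ω d i 7 8 /
      (br2 ω e 4 8 * br2 ω e 5 8 * br3 ω e 1 2 3)) * (g₂ * g₃)
  + br3 ω e a b 5 * br3 ω d 4 7 8 * br3 ω d i 5 7 /
      (br2 ω e 4 5 * br2 ω e 5 8 * br3 ω e 1 2 3) * (g₁ * g₃)
  - br3 ω e a b 4 * br3 ω d 5 7 8 * br3 ω d i 4 7 /
      (br2 ω e 4 5 * br2 ω e 4 8 * br3 ω e 1 2 3) * (g₁ * g₂)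

/-- `g` is the value of `gᵢ = Qᵢ(f)/Pᵢ(f)` at `f₃ = ∞`. -/
def SpecG (ω : ℂ) (e : Param) (i : Fin 10) (f₁ f₂ g : ℂ) : Prop :=
  Tendsto (fun z : ℂ => polyQ ω e i f₁ f₂ z / polyP ω e i f₁ f₂ z) (Bornology.cobounded ℂ) (𝓝 g)

/-- `h` is the value of `T_{α₆}(fᵢ) = Sᵢ(g)/Rᵢ(g)` at `g₃ = ∞`. -/
def SpecF (ω : ℂ) (e : Param) (i : Fin 10) (g₁ g₂ h : ℂ) : Prop :=
  Tendsto (fun z : ℂ => polyS ω e i g₁ g₂ z / polyR ω e i g₁ g₂ z) (Bornology.cobounded ℂ) (𝓝 h)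

/-- The elliptic Painlevé equation for `T_{α₆}` with parameter `e`, specialised to
`f₃ = g₃ = ∞`: it takes `(f₁, f₂)` to `(h₁, h₂) = (T(f₁), T(f₂))`. -/
def SpecStep (ω : ℂ) (e : Param) (f₁ f₂ h₁ h₂ : ℂ) : Prop :=
  ∃ g₁ g₂ : ℂ, SpecG ω e 1 f₁ f₂ g₁ ∧ SpecG ω e 2 f₁ f₂ g₂ ∧
    SpecF ω e 1 g₁ g₂ h₁ ∧ SpecF ω e 2 g₁ g₂ h₂

/-! ### The linear equations -/

/-- The factor `[169][7̄99] / ([17̄9][699])` of the gauge equation. -/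
def gaugeFactor (ω : ℂ) (e : Param) : ℂ :=
  br3 ω e 1 6 9 * br3 ω (bar7 e) 7 9 9 / (br3 ω (bar7 e) 1 7 9 * br3 ω e 6 9 9)

/-- `g` solves the gauge equation along the orbit `e`, at the times in `I`. -/
def IsGauge (ω : ℂ) (e : ℤ → Param) (I : Set ℤ) (g : ℤ → ℂ) : Prop :=
  (∀ k ∈ I, g k ≠ 0) ∧ ∀ k ∈ I, k + 1 ∈ I → g (k + 1) = gaugeFactor ω (e k) * g k

/-- The linear difference equation for `Φ` at the parameter `e`; the three numbers are the values
of `Φ` at `T⁻¹(e)`, `e` and `T(e)`, where `T = T_{α₆}`. -/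
def EqPhi (ω : ℂ) (e : Param) (φm φ φp : ℂ) : Prop :=
  br2 ω e 7 9 * br3 ω (bar7 e) 7 9 9 * br3 ω e 7 9 9 *
      (∏ k ∈ ({1, 2, 3, 4, 5} : Finset (Fin 10)), br3 ω e k 6 9) /
      (br2 ω e 7 6 * br2 ω (bar7 e) 7 6) * (φp - φ)
  = br2 ω e 6 9 * br3 ω (under6 e) 6 9 9 * br3 ω e 6 9 9 *
      (∏ k ∈ ({1, 2, 3, 4, 5} : Finset (Fin 10)), br3 ω e k 7 9) /
      (br2 ω e 7 6 * br2 ω (under6 e) 7 6) * (φ - φm)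
    - br3 ω e 6 7 9 * (∏ k ∈ ({1, 2, 3, 4, 5} : Finset (Fin 10)), br2 ω e k 9) * φ

/-- `u₀ = ε₀ - 3ε₉ - δ` and `uᵢ = εᵢ - ε₉` for `i = 1, …, 7`. -/
def uOf (e : Param) : Fin 8 → ℂ := fun i =>
  if i = 0 then e 0 - 3 * e 9 - del e else e (Fin.castLE (by omega) i) - e 9

/-- `uᵢ ↦ uᵢ - δ`, `uⱼ ↦ uⱼ + δ`. -/
def shiftU (δ : ℂ) (i j : Fin 8) (u : Fin 8 → ℂ) : Fin 8 → ℂ := fun m =>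
  if m = i then u m - δ else if m = j then u m + δ else u m

/-- The balancing condition `2δ + 3u₀ - (u₁ + ⋯ + u₇) = 0`. -/
def Balanced (δ : ℂ) (u : Fin 8 → ℂ) : Prop := 2 * δ + 3 * u 0 - ∑ i : Fin 7, u i.succ = 0

/-- The elliptic hypergeometric equation for the function `Φ`, at the point `u`. -/
def EHE (ω δ : ℂ) (Φ : (Fin 8 → ℂ) → ℂ) (u : Fin 8 → ℂ) : Prop :=
  br ω (u 7) * br ω (u 0 - u 7) * br ω (δ + u 0 - u 7) *
      (∏ i ∈ ({1, 2, 3, 4, 5} : Finset (Fin 8)), br ω (δ + u 0 - u i - u 6)) /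
      (br ω (u 7 - u 6) * br ω (u 7 - u 6 + δ)) * (Φ (shiftU δ 6 7 u) - Φ u)
  = br ω (u 6) * br ω (u 0 - u 6) * br ω (δ + u 0 - u 6) *
      (∏ i ∈ ({1, 2, 3, 4, 5} : Finset (Fin 8)), br ω (δ + u 0 - u i - u 7)) /
      (br ω (u 7 - u 6) * br ω (u 7 - u 6 - δ)) * (Φ u - Φ (shiftU δ 7 6 u))
    + (∏ i ∈ ({1, 2, 3, 4, 5} : Finset (Fin 8)), br ω (u i)) *
      br ω (u 7 + u 6 - u 0 - δ) * Φ u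

/-- `[z]ₙ = [z][z+δ]⋯[z+(n-1)δ]`. -/
def poch (ω δ z : ℂ) (n : ℕ) : ℂ := ∏ j ∈ Finset.range n, br ω (z + j * δ)

/-- The very-well-poised elliptic hypergeometric series `₁₀E₉(u₀,…,u₇)`. It is only used when it
terminates, and then the sum has finitely many nonzero terms. -/
def E109 (ω δ : ℂ) (u : Fin 8 → ℂ) : ℂ :=
  ∑' n : ℕ, br ω (u 0 + 2 * n * δ) / br ω (u 0) *
    ∏ r : Fin 8, poch ω δ (u r) n / poch ω δ (u 0 - u r + δ) n

/-- One of `u₁, …, u₇` is `0, -δ, -2δ, …`. -/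
def Terminates (δ : ℂ) (u : Fin 8 → ℂ) : Prop :=
  ∃ i : Fin 8, i ≠ 0 ∧ ∃ N : ℕ, u i = -(N * δ)

/-- The denominators of all terms of the series `₁₀E₉(u₀,…,u₇)` are nonzero. -/
def WellDefined (ω δ : ℂ) (u : Fin 8 → ℂ) : Prop :=
  br ω (u 0) ≠ 0 ∧ ∀ (r : Fin 8) (n : ℕ), poch ω δ (u 0 - u r + δ) n ≠ 0

end EllipticPainleve

end

open EllipticPainleve

noncomputable section

namespace EllipticPainleve

/-! ### The odd theta function -/

/-! Geometry. The parameters ε₁, …, ε₉ stand for nine points on a plane cubic on which a, b, c are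
collinear when a + b + c = ε₀. The line through a and b is the linear form `lineForm`. For k ≥ 1 the
generator sₖ only relabels points and leaves these forms alone (`lineForm_sPoint`). The generator s₀
is the standard quadratic transformation: it turns a line into a conic, and the conic splits when
the line passes through a new base point. So the long words of rational substitutions need not be
composed. It is enough to follow a few classes τ(ε₀ - εᵢ - εⱼ) through the three reflections in μ
(`isReflected_word`, `muWord_lineTau`): μ(τᵢ) is given by a line, which is Pᵢ, and μ(fᵢτᵢ) by a
conic, which is Qᵢ. Since T = μμ, the second half is the same formula at the parameters μ(ε), which
gives Rᵢ and Sᵢ.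

Specialisation. The coefficient of f₃ in P₃ and that of g₃ in R₃ contain [34]. If it vanishes, f₃ =
g₃ = ∞ is preserved, and what remains of the other components are quotients of leading coefficients,
linear in (f₁, f₂) and in (g₁, g₂).

Linearisation. At the parameters w(ε) with ε₈ = ε₉ the specialised step is the map `MuRel` followed
by the inverse of the same map with z = ε₆ and z' = ε₇ + δ exchanged. Eliminating g gives `StepRel`,
which expresses T(f₁) by f₁ and f₂. By the symmetry z ↔ z' the backward step satisfies the same
relation, and the two relations together are equivalent to the step (`exists_muRel_iff`). The gauge
equation turns the left side into a multiple of Φ' - Φ. At each time the second component occurs in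
a forward and in a backward relation; eliminating it leaves the three-term equation for Φ
(`phiRel_iff`, `specStep_iff_eqPhi`).

Series. Inserting the n-th terms of ₁₀E₉ and its two neighbours into the hypergeometric equation
gives a difference of consecutive values of `vwpTail` (`vwp_ehe_succ`). The sum telescopes, and
termination kills the boundary term.

Every theta identity comes from the three-term relation, through partial fraction identities with
three, four and five points. The four-point one makes lines invariant under s₃, and the five-point
one makes the series telescope. -/

lemma br_neg (ω z : ℂ) : br ω (-z) = -br ω z := by
  unfold br
  have h1 : -z + 1 / 2 + ω / 2 = -((z + 1 / 2 + ω / 2) - 1 - ω) := by ring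
  have h2 : jacobiTheta₂ (z + 1 / 2 + ω / 2) ω =
      Complex.exp (-Real.pi * Complex.I * (ω + 2 * ((z + 1 / 2 + ω / 2) - 1 - ω))) *
        jacobiTheta₂ ((z + 1 / 2 + ω / 2) - 1 - ω) ω := by
    rw [← jacobiTheta₂_add_left', ← jacobiTheta₂_add_left (_ - 1 - ω + ω)]
    congr 1; ring
  rw [h1, jacobiTheta₂_neg_left, h2, ← mul_assoc, ← Complex.exp_add, ← neg_mul]
  congr 1
  rw [← neg_one_mul (Complex.exp _), ← Complex.exp_pi_mul_I, ← Complex.exp_add,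
    Complex.exp_eq_exp_iff_exists_int]
  exact ⟨-1, by push_cast; ring⟩

lemma br_zero (ω : ℂ) : br ω 0 = 0 := by
  have h := br_neg ω 0
  rw [neg_zero] at h
  linear_combination h / 2

lemma br_sub_comm (ω x y : ℂ) : br ω (x - y) = -br ω (y - x) := by
  rw [← br_neg, neg_sub]

lemma br_ne_zero_comm {ω x y : ℂ} (h : br ω (x - y) ≠ 0) : br ω (y - x) ≠ 0 := by
  rw [br_sub_comm]; exact neg_ne_zero.mpr h

lemma hasSum_of_eq {ι : Type*} {f g : ι → ℂ} {s : ℂ} (h : HasSum f s) (hfg : ∀ n, g n = f n) :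
    HasSum g s := by
  rwa [show g = f from funext hfg]

lemma br_term (ω z : ℂ) (hω : 0 < ω.im) :
    HasSum (fun n : ℤ => Complex.exp (Real.pi * Complex.I * (n + 1 / 2) ^ 2 * ω +
      2 * Real.pi * Complex.I * (n + 1 / 2) * (z + 1 / 2))) (br ω z) := by
  refine hasSum_of_eq ((hasSum_jacobiTheta₂_term (z + 1 / 2 + ω / 2) hω).mul_left
    (Complex.exp (Real.pi * Complex.I * ω / 4 + Real.pi * Complex.I * (z + 1 / 2)))) fun n => ?_
  rw [jacobiTheta₂_term, ← Complex.exp_add]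
  congr 1; ring

/-! ### Addition formula from theta series of doubled modulus. -/

/-- The even half of the theta series of doubled modulus. -/
def thetaA (ω x : ℂ) : ℂ := jacobiTheta₂ (2 * x) (2 * ω)

/-- The odd half of the theta series of doubled modulus. -/
def thetaB (ω x : ℂ) : ℂ :=
  Complex.exp (Real.pi * Complex.I * ω / 2 + 2 * Real.pi * Complex.I * x) *
    jacobiTheta₂ (2 * x + ω) (2 * ω)

lemma two_mul_im_pos {ω : ℂ} (hω : 0 < ω.im) : 0 < (2 * ω).im := by simpa using hω

lemma thetaA_hasSum (ω x : ℂ) (hω : 0 < ω.im) :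
    HasSum (fun a : ℤ => Complex.exp (2 * Real.pi * Complex.I * ω * a ^ 2 +
      4 * Real.pi * Complex.I * a * x)) (thetaA ω x) := by
  refine hasSum_of_eq (hasSum_jacobiTheta₂_term (2 * x) (two_mul_im_pos hω)) fun n => ?_
  rw [jacobiTheta₂_term]
  congr 1; ring

lemma thetaB_hasSum (ω x : ℂ) (hω : 0 < ω.im) :
    HasSum (fun a : ℤ => Complex.exp (Real.pi * Complex.I * ω * (2 * a + 1) ^ 2 / 2 +
      2 * Real.pi * Complex.I * (2 * a + 1) * x)) (thetaB ω x) := by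
  refine hasSum_of_eq ((hasSum_jacobiTheta₂_term (2 * x + ω) (two_mul_im_pos hω)).mul_left
    (Complex.exp (Real.pi * Complex.I * ω / 2 + 2 * Real.pi * Complex.I * x))) fun n => ?_
  rw [jacobiTheta₂_term, ← Complex.exp_add]
  congr 1; ring

lemma hasSum_mul_complex {ι κ : Type*} {f : ι → ℂ} {g : κ → ℂ} {s t : ℂ} (hf : HasSum f s)
    (hg : HasSum g t) : HasSum (fun x : ι × κ => f x.1 * g x.2) (s * t) :=
  hf.mul hg (summable_mul_of_summable_norm hf.summable.norm hg.summable.norm)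

/-- Pairs of integers, split by the parity of their sum. -/
def paritySplit : (ℤ × ℤ) ⊕ (ℤ × ℤ) ≃ ℤ × ℤ where
  toFun := Sum.elim (fun x => (x.1 + x.2, x.1 - x.2 - 1)) (fun x => (x.1 + x.2, x.1 - x.2))
  invFun x := if (x.1 + x.2) % 2 = 0 then .inr ((x.1 + x.2) / 2, (x.1 - x.2) / 2)
    else .inl ((x.1 + x.2 + 1) / 2, (x.1 - x.2 - 1) / 2)
  left_inv x := by
    rcases x with ⟨a, b⟩ | ⟨a, b⟩
    · have h : ¬ (a + b + (a - b - 1)) % 2 = 0 := by omega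
      simp only [Sum.elim_inl, h, if_false]
      congr 2 <;> omega
    · have h : (a + b + (a - b)) % 2 = 0 := by omega
      simp only [Sum.elim_inr, h, if_true]
      congr 2 <;> omega
  right_inv x := by
    obtain ⟨m, n⟩ := x
    simp only
    split_ifs with h
    · simp only [Sum.elim_inr, Prod.mk.injEq]; omega
    · simp only [Sum.elim_inl, Prod.mk.injEq]; omega

/-- In the double series over (m, n), x is multiplied by m + n + 1 and y by m - n, which have
opposite parity. The terms with m + n odd form the first product. Those with m + n even form the
second one, with the sign exp(πi(m + n + 1)) = -1. -/
lemma br_mul_br (ω : ℂ) (hω : 0 < ω.im) (x y : ℂ) :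
    br ω (x + y) * br ω (x - y) = thetaA ω x * thetaB ω y - thetaB ω x * thetaA ω y := by
  have h := hasSum_mul_complex (br_term ω (x + y) hω) (br_term ω (x - y) hω)
  rw [← paritySplit.hasSum_iff] at h
  have h1 := hasSum_mul_complex (thetaA_hasSum ω x hω) (thetaB_hasSum ω y hω)
  have h2 := (hasSum_mul_complex (thetaB_hasSum ω x hω) (thetaA_hasSum ω y hω)).neg
  refine h.unique ?_
  rw [sub_eq_add_neg (thetaA ω x * _)]
  refine HasSum.sum (M := ℂ) ?_ ?_
  · refine hasSum_of_eq h1 fun p => ?_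
    obtain ⟨a, b⟩ := p
    simp only [paritySplit, Function.comp_apply, Equiv.coe_fn_mk, Sum.elim_inl]
    rw [← Complex.exp_add, ← Complex.exp_add, Complex.exp_eq_exp_iff_exists_int]
    exact ⟨a, by push_cast; ring⟩
  · refine hasSum_of_eq h2 fun p => ?_
    obtain ⟨a, b⟩ := p
    simp only [paritySplit, Function.comp_apply, Equiv.coe_fn_mk, Sum.elim_inr]
    rw [← neg_one_mul, ← Complex.exp_pi_mul_I, ← Complex.exp_add, ← Complex.exp_add, ← Complex.exp_add,
      Complex.exp_eq_exp_iff_exists_int]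
    exact ⟨a, by push_cast; ring⟩

/-- The three-term relation. -/
lemma br_three_term (ω : ℂ) (hω : 0 < ω.im) (a b c d : ℂ) :
    br ω (a + b) * br ω (a - b) * (br ω (c + d) * br ω (c - d)) +
      br ω (b + c) * br ω (b - c) * (br ω (a + d) * br ω (a - d)) +
      br ω (c + a) * br ω (c - a) * (br ω (b + d) * br ω (b - d)) = 0 := by
  -- Each product is now a 2 × 2 minor of the vectors (`thetaA`, `thetaB`) at a, b, c, d, and the
  -- claim is the Plücker relation.
  simp only [br_mul_br ω hω]
  ring

lemma br_differentiable (ω : ℂ) (hω : 0 < ω.im) : Differentiable ℂ (br ω) := by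
  intro z
  unfold br
  have h : DifferentiableAt ℂ (fun x : ℂ => jacobiTheta₂ x ω) (z + 1 / 2 + ω / 2) :=
    differentiableAt_jacobiTheta₂_fst _ hω
  have h' : DifferentiableAt ℂ (fun x : ℂ => jacobiTheta₂ (x + 1 / 2 + ω / 2) ω) z :=
    DifferentiableAt.comp (f := fun x : ℂ => x + 1 / 2 + ω / 2) z h (by fun_prop)
  exact DifferentiableAt.mul (by fun_prop) h'

lemma differentiable_cancel {g f : ℂ → ℂ} (hg : Differentiable ℂ g) (hf : Differentiable ℂ f)
    (h : ∀ t, g t * f t = 0) {t₀ : ℂ} (ht : g t₀ ≠ 0) (t : ℂ) : f t = 0 := by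
  rcases AnalyticOnNhd.eq_zero_or_eq_zero_of_mul_eq_zero (U := Set.univ)
    (fun z _ => hg.analyticAt z) (fun z _ => hf.analyticAt z) (fun z _ => h z)
    isPreconnected_univ with h | h
  · exact absurd (h t₀ trivial) ht
  · exact h t trivial

/-! ### Partial fraction identities. -/

/-- The partial fraction identity for three points. -/
lemma br_pf_three {ω : ℂ} (hω : 0 < ω.im) (y₁ y₂ y₃ w₁ w₂ w₃ : ℂ)
    (h : y₁ + y₂ + y₃ = w₁ + w₂ + w₃) :
    br ω (y₁ - w₁) * br ω (y₁ - w₂) * br ω (y₁ - w₃) * br ω (y₂ - y₃) +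
      br ω (y₂ - w₁) * br ω (y₂ - w₂) * br ω (y₂ - w₃) * br ω (y₃ - y₁) +
      br ω (y₃ - w₁) * br ω (y₃ - w₂) * br ω (y₃ - w₃) * br ω (y₁ - y₂) = 0 := by
  have h3 : w₃ = y₁ + y₂ + y₃ - w₁ - w₂ := by linear_combination -h
  subst h3
  -- With the origin at the midpoint of w₁ and w₂ these two points become opposite, so that a ± d
  -- are y₁ - w₂ and y₁ - w₁. By the balance of the sums, b + c is w₃ - y₁.
  have key := br_three_term ω hω (y₁ - (w₁ + w₂) / 2) (y₂ - (w₁ + w₂) / 2)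
    (y₃ - (w₁ + w₂) / 2) ((w₁ - w₂) / 2)
  have e1 := br_neg ω (y₁ + y₂ - w₁ - w₂)
  have e2 := br_neg ω (y₂ + y₃ - w₁ - w₂)
  have e3 := br_neg ω (y₃ + y₁ - w₁ - w₂)
  ring_nf at key e1 e2 e3 ⊢
  rw [e1, e2, e3]
  linear_combination -key

/-- For a given sum a + b, the products [z-a][z-b] lie in a two-dimensional space of functions of z.
Here one of them is expanded in the two that vanish at p and at q. -/
lemma br_exchange {ω : ℂ} (hω : 0 < ω.im) (z p q a b : ℂ) :
    br ω (a + b - p - q) * br ω (p - q) * (br ω (z - a) * br ω (z - b)) =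
      br ω (q - a) * br ω (q - b) * (br ω (z - p) * br ω (z - (a + b - p))) -
      br ω (p - a) * br ω (p - b) * (br ω (z - q) * br ω (z - (a + b - q))) := by
  have h := br_pf_three hω z p q a b (z + p + q - a - b) (by ring)
  rw [show z - (z + p + q - a - b) = a + b - p - q by ring,
    show p - (z + p + q - a - b) = -(z - (a + b - q)) by ring,
    show q - (z + p + q - a - b) = -(z - (a + b - p)) by ring, br_neg, br_neg,
    br_sub_comm ω q z] at h
  linear_combination h

/-- The left hand side of the partial fraction identity for four points. -/
def pfFour (b : ℂ → ℂ) (y₁ y₂ y₃ y₄ w₁ w₂ w₃ w₄ : ℂ) : ℂ :=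
  b (y₁ - w₁) * b (y₁ - w₂) * b (y₁ - w₃) * b (y₁ - w₄) *
    (b (y₂ - y₃) * b (y₂ - y₄) * b (y₃ - y₄)) -
  b (y₂ - w₁) * b (y₂ - w₂) * b (y₂ - w₃) * b (y₂ - w₄) *
    (b (y₁ - y₃) * b (y₁ - y₄) * b (y₃ - y₄)) +
  b (y₃ - w₁) * b (y₃ - w₂) * b (y₃ - w₃) * b (y₃ - w₄) *
    (b (y₁ - y₂) * b (y₁ - y₄) * b (y₂ - y₄)) -
  b (y₄ - w₁) * b (y₄ - w₂) * b (y₄ - w₃) * b (y₄ - w₄) *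
    (b (y₁ - y₂) * b (y₁ - y₃) * b (y₂ - y₃))

/-- The left hand side of the partial fraction identity for five points. -/
def pfFive (b : ℂ → ℂ) (y₁ y₂ y₃ y₄ y₅ w₁ w₂ w₃ w₄ w₅ : ℂ) : ℂ :=
  b (y₁ - w₁) * b (y₁ - w₂) * b (y₁ - w₃) * b (y₁ - w₄) * b (y₁ - w₅) *
    (b (y₂ - y₃) * b (y₂ - y₄) * b (y₂ - y₅) * b (y₃ - y₄) * b (y₃ - y₅) * b (y₄ - y₅)) -
  b (y₂ - w₁) * b (y₂ - w₂) * b (y₂ - w₃) * b (y₂ - w₄) * b (y₂ - w₅) *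
    (b (y₁ - y₃) * b (y₁ - y₄) * b (y₁ - y₅) * b (y₃ - y₄) * b (y₃ - y₅) * b (y₄ - y₅)) +
  b (y₃ - w₁) * b (y₃ - w₂) * b (y₃ - w₃) * b (y₃ - w₄) * b (y₃ - w₅) *
    (b (y₁ - y₂) * b (y₁ - y₄) * b (y₁ - y₅) * b (y₂ - y₄) * b (y₂ - y₅) * b (y₄ - y₅)) -
  b (y₄ - w₁) * b (y₄ - w₂) * b (y₄ - w₃) * b (y₄ - w₄) * b (y₄ - w₅) *
    (b (y₁ - y₂) * b (y₁ - y₃) * b (y₁ - y₅) * b (y₂ - y₃) * b (y₂ - y₅) * b (y₃ - y₅)) +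
  b (y₅ - w₁) * b (y₅ - w₂) * b (y₅ - w₃) * b (y₅ - w₄) * b (y₅ - w₅) *
    (b (y₁ - y₂) * b (y₁ - y₃) * b (y₁ - y₄) * b (y₂ - y₃) * b (y₂ - y₄) * b (y₃ - y₄))

lemma br_cancel {ω : ℂ} (hω : 0 < ω.im) {z₀ : ℂ} (hz : br ω z₀ ≠ 0) (c : ℂ) {f : ℂ → ℂ}
    (hf : Differentiable ℂ f) (h : ∀ t, br ω (c + t) * f t = 0) : f 0 = 0 := by
  have hb := br_differentiable ω hω
  refine differentiable_cancel (g := fun t => br ω (c + t)) (t₀ := z₀ - c)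
    (hb.comp (by fun_prop)) hf h ?_ 0
  simpa using hz

/-- Expanding [z-w₃][z-w₄] in products that vanish at y₃ or at y₄ splits the sum in two. Each part
has lost one of its points and is an instance of the three-point identity. The price is the factor
in front, which is removed afterwards by analytic continuation. -/
lemma pfFour_aux {ω : ℂ} (hω : 0 < ω.im) (y₁ y₂ y₃ y₄ w₁ w₂ w₃ w₄ : ℂ)
    (h : y₁ + y₂ + y₃ + y₄ = w₁ + w₂ + w₃ + w₄) :
    br ω (w₃ + w₄ - y₃ - y₄) * (br ω (y₃ - y₄) * pfFour (br ω) y₁ y₂ y₃ y₄ w₁ w₂ w₃ w₄) = 0 := by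
  have e1 := br_exchange hω y₁ y₃ y₄ w₃ w₄
  have e2 := br_exchange hω y₂ y₃ y₄ w₃ w₄
  have e3 := br_exchange hω y₃ y₃ y₄ w₃ w₄
  have e4 := br_exchange hω y₄ y₃ y₄ w₃ w₄
  have p3 := br_pf_three hω y₁ y₂ y₃ w₁ w₂ (w₃ + w₄ - y₄) (by linear_combination h)
  have p4 := br_pf_three hω y₁ y₂ y₄ w₁ w₂ (w₃ + w₄ - y₃) (by linear_combination h)
  rw [br_sub_comm ω y₃ y₁] at p3
  rw [br_sub_comm ω y₄ y₁] at p4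
  rw [sub_self, br_zero] at e3 e4
  rw [br_sub_comm ω y₄ y₃] at e4
  unfold pfFour
  linear_combination
    (br ω (y₁ - w₁) * br ω (y₁ - w₂)) * (br ω (y₂ - y₃) * br ω (y₂ - y₄) * br ω (y₃ - y₄)) * e1 -
    (br ω (y₂ - w₁) * br ω (y₂ - w₂)) * (br ω (y₁ - y₃) * br ω (y₁ - y₄) * br ω (y₃ - y₄)) * e2 +
    (br ω (y₃ - w₁) * br ω (y₃ - w₂)) * (br ω (y₁ - y₂) * br ω (y₁ - y₄) * br ω (y₂ - y₄)) * e3 -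
    (br ω (y₄ - w₁) * br ω (y₄ - w₂)) * (br ω (y₁ - y₂) * br ω (y₁ - y₃) * br ω (y₂ - y₃)) * e4 -
    br ω (y₃ - w₃) * br ω (y₃ - w₄) * (br ω (y₁ - y₄) * br ω (y₂ - y₄) * br ω (y₃ - y₄)) * p3 +
    br ω (y₄ - w₃) * br ω (y₄ - w₄) * (br ω (y₁ - y₃) * br ω (y₂ - y₃) * br ω (y₃ - y₄)) * p4

/-- The same induction step, from four points to five. -/
lemma pfFive_aux {ω : ℂ} (hω : 0 < ω.im)
    (H : ∀ y₁ y₂ y₃ y₄ w₁ w₂ w₃ w₄ : ℂ, y₁ + y₂ + y₃ + y₄ = w₁ + w₂ + w₃ + w₄ →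
      pfFour (br ω) y₁ y₂ y₃ y₄ w₁ w₂ w₃ w₄ = 0)
    (y₁ y₂ y₃ y₄ y₅ w₁ w₂ w₃ w₄ w₅ : ℂ)
    (h : y₁ + y₂ + y₃ + y₄ + y₅ = w₁ + w₂ + w₃ + w₄ + w₅) :
    br ω (w₄ + w₅ - y₄ - y₅) *
      (br ω (y₄ - y₅) * pfFive (br ω) y₁ y₂ y₃ y₄ y₅ w₁ w₂ w₃ w₄ w₅) = 0 := by
  have e1 := br_exchange hω y₁ y₄ y₅ w₄ w₅
  have e2 := br_exchange hω y₂ y₄ y₅ w₄ w₅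
  have e3 := br_exchange hω y₃ y₄ y₅ w₄ w₅
  have e4 := br_exchange hω y₄ y₄ y₅ w₄ w₅
  have e5 := br_exchange hω y₅ y₄ y₅ w₄ w₅
  have p4 := H y₁ y₂ y₃ y₄ w₁ w₂ w₃ (w₄ + w₅ - y₅) (by linear_combination h)
  have p5 := H y₁ y₂ y₃ y₅ w₁ w₂ w₃ (w₄ + w₅ - y₄) (by linear_combination h)
  rw [sub_self, br_zero] at e4 e5
  rw [br_sub_comm ω y₅ y₄] at e5
  unfold pfFour at p4 p5
  unfold pfFive
  linear_combination
    (br ω (y₁ - w₁) * br ω (y₁ - w₂) * br ω (y₁ - w₃)) * (br ω (y₂ - y₃) * br ω (y₂ - y₄) *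
      br ω (y₂ - y₅) * br ω (y₃ - y₄) * br ω (y₃ - y₅) * br ω (y₄ - y₅)) * e1 -
    (br ω (y₂ - w₁) * br ω (y₂ - w₂) * br ω (y₂ - w₃)) * (br ω (y₁ - y₃) * br ω (y₁ - y₄) *
      br ω (y₁ - y₅) * br ω (y₃ - y₄) * br ω (y₃ - y₅) * br ω (y₄ - y₅)) * e2 +
    (br ω (y₃ - w₁) * br ω (y₃ - w₂) * br ω (y₃ - w₃)) * (br ω (y₁ - y₂) * br ω (y₁ - y₄) *
      br ω (y₁ - y₅) * br ω (y₂ - y₄) * br ω (y₂ - y₅) * br ω (y₄ - y₅)) * e3 -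
    (br ω (y₄ - w₁) * br ω (y₄ - w₂) * br ω (y₄ - w₃)) * (br ω (y₁ - y₂) * br ω (y₁ - y₃) *
      br ω (y₁ - y₅) * br ω (y₂ - y₃) * br ω (y₂ - y₅) * br ω (y₃ - y₅)) * e4 +
    (br ω (y₅ - w₁) * br ω (y₅ - w₂) * br ω (y₅ - w₃)) * (br ω (y₁ - y₂) * br ω (y₁ - y₃) *
      br ω (y₁ - y₄) * br ω (y₂ - y₃) * br ω (y₂ - y₄) * br ω (y₃ - y₄)) * e5 -
    br ω (y₄ - w₄) * br ω (y₄ - w₅) *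
      (br ω (y₁ - y₅) * br ω (y₂ - y₅) * br ω (y₃ - y₅) * br ω (y₄ - y₅)) * p4 +
    br ω (y₅ - w₄) * br ω (y₅ - w₅) *
      (br ω (y₁ - y₄) * br ω (y₂ - y₄) * br ω (y₃ - y₄) * br ω (y₄ - y₅)) * p5

/-- The partial fraction identity for four points. -/
lemma br_pf_four {ω : ℂ} (hω : 0 < ω.im) (y₁ y₂ y₃ y₄ w₁ w₂ w₃ w₄ : ℂ)
    (h : y₁ + y₂ + y₃ + y₄ = w₁ + w₂ + w₃ + w₄) :
    pfFour (br ω) y₁ y₂ y₃ y₄ w₁ w₂ w₃ w₄ = 0 := by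
  -- Cancelling the extra factors needs a theta function that is not identically zero; in the other
  -- case every term of the identity vanishes.
  by_cases hz : ∃ z₀, br ω z₀ ≠ 0
  · obtain ⟨z₀, hz⟩ := hz
    have hb := br_differentiable ω hω
    have haux := @pfFour_aux ω hω
    have hcan := @br_cancel ω hω z₀ hz
    generalize br ω = b at *
    have h1 : ∀ y₁ y₂ y₃ y₄ w₁ w₂ w₃ w₄ : ℂ, y₁ + y₂ + y₃ + y₄ = w₁ + w₂ + w₃ + w₄ →
        b (y₃ - y₄) * pfFour b y₁ y₂ y₃ y₄ w₁ w₂ w₃ w₄ = 0 := by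
      intro y₁ y₂ y₃ y₄ w₁ w₂ w₃ w₄ h
      -- Moving w₁ by -t and w₄ by t keeps the sums equal, while the unwanted bracket becomes a
      -- translate of the theta function in t. Its zeros can then be ignored, and t = 0 is the
      -- claim.
      have := hcan (w₃ + w₄ - y₃ - y₄)
        (f := fun t => b (y₃ - y₄) * pfFour b y₁ y₂ y₃ y₄ (w₁ - t) w₂ w₃ (w₄ + t))
        (by unfold pfFour; fun_prop) (fun t => by
          have := haux y₁ y₂ y₃ y₄ (w₁ - t) w₂ w₃ (w₄ + t) (by linear_combination h)
          rwa [show w₃ + (w₄ + t) - y₃ - y₄ = w₃ + w₄ - y₃ - y₄ + t by ring] at this)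
      simpa using this
    have := hcan (y₃ - y₄)
        (f := fun t => pfFour b y₁ y₂ (y₃ + t) y₄ (w₁ + t) w₂ w₃ w₄)
        (by unfold pfFour; fun_prop) (fun t => by
          have := h1 y₁ y₂ (y₃ + t) y₄ (w₁ + t) w₂ w₃ w₄ (by linear_combination h)
          rwa [show y₃ + t - y₄ = y₃ - y₄ + t by ring] at this)
    simpa using this
  · push Not at hz
    simp [pfFour, hz]

/-- The partial fraction identity for five points. -/
lemma br_pf_five {ω : ℂ} (hω : 0 < ω.im) (y₁ y₂ y₃ y₄ y₅ w₁ w₂ w₃ w₄ w₅ : ℂ)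
    (h : y₁ + y₂ + y₃ + y₄ + y₅ = w₁ + w₂ + w₃ + w₄ + w₅) :
    pfFive (br ω) y₁ y₂ y₃ y₄ y₅ w₁ w₂ w₃ w₄ w₅ = 0 := by
  by_cases hz : ∃ z₀, br ω z₀ ≠ 0
  · obtain ⟨z₀, hz⟩ := hz
    have hb := br_differentiable ω hω
    have haux := @pfFive_aux ω hω (br_pf_four hω)
    have hcan := @br_cancel ω hω z₀ hz
    generalize br ω = b at *
    have h1 : ∀ y₁ y₂ y₃ y₄ y₅ w₁ w₂ w₃ w₄ w₅ : ℂ,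
        y₁ + y₂ + y₃ + y₄ + y₅ = w₁ + w₂ + w₃ + w₄ + w₅ →
        b (y₄ - y₅) * pfFive b y₁ y₂ y₃ y₄ y₅ w₁ w₂ w₃ w₄ w₅ = 0 := by
      intro y₁ y₂ y₃ y₄ y₅ w₁ w₂ w₃ w₄ w₅ h
      have := hcan (w₄ + w₅ - y₄ - y₅)
        (f := fun t => b (y₄ - y₅) * pfFive b y₁ y₂ y₃ y₄ y₅ (w₁ - t) w₂ w₃ w₄ (w₅ + t))
        (by unfold pfFive; fun_prop) (fun t => by
          have := haux y₁ y₂ y₃ y₄ y₅ (w₁ - t) w₂ w₃ w₄ (w₅ + t) (by linear_combination h)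
          rwa [show w₄ + (w₅ + t) - y₄ - y₅ = w₄ + w₅ - y₄ - y₅ + t by ring] at this)
      simpa using this
    have := hcan (y₄ - y₅)
        (f := fun t => pfFive b y₁ y₂ y₃ (y₄ + t) y₅ (w₁ + t) w₂ w₃ w₄ w₅)
        (by unfold pfFive; fun_prop) (fun t => by
          have := h1 y₁ y₂ y₃ (y₄ + t) y₅ (w₁ + t) w₂ w₃ w₄ w₅ (by linear_combination h)
          rwa [show y₄ + t - y₅ = y₄ - y₅ + t by ring] at this)
    simpa using this
  · push Not at hz
    simp [pfFive, hz]

/-! ### Nonvanishing brackets -/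

lemma GenericOff.two {ω : ℂ} {S : Set (Fin 10 × Fin 10)} {e : Param} (h : GenericOff ω S e)
    (i j : Fin 10) (hi : 0 < i) (hj : 0 < j) (hij : i ≠ j) (h₁ : (i, j) ∉ S) (h₂ : (j, i) ∉ S) :
    br ω (e i - e j) ≠ 0 := by
  rcases lt_or_gt_of_ne hij with hlt | hlt
  · exact h.1 i j hi hlt h₁
  · exact br_ne_zero_comm (h.1 j i hj hlt h₂)

lemma GenericOff.three {ω : ℂ} {S : Set (Fin 10 × Fin 10)} {e : Param} (h : GenericOff ω S e)
    (i j k : Fin 10) (hi : 0 < i) (hj : 0 < j) (hk : 0 < k) (hij : i ≠ j) (hik : i ≠ k)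
    (hjk : j ≠ k) : br ω (e 0 - e i - e j - e k) ≠ 0 := by
  have key : ∀ a b c : Fin 10, 0 < a → a < b → b < c →
      e 0 - e i - e j - e k = e 0 - e a - e b - e c → br ω (e 0 - e i - e j - e k) ≠ 0 := by
    intro a b c ha hab hbc he
    rw [he]
    exact h.2 a b c ha hab hbc
  rcases lt_or_gt_of_ne hij with h1 | h1 <;> rcases lt_or_gt_of_ne hik with h2 | h2 <;>
    rcases lt_or_gt_of_ne hjk with h3 | h3
  · exact key i j k hi h1 h3 rfl
  · exact key i k j hi h2 h3 (by ring)
  · exact absurd (h1.trans h3) (not_lt.mpr h2.le)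
  · exact key k i j hk h2 h1 (by ring)
  · exact key j i k hj h1 h2 (by ring)
  · exact absurd (h2.trans h3) (not_lt.mpr h1.le)
  · exact key j k i hj h3 h2 (by ring)
  · exact key k j i hk h3 h1 (by ring)

/-! ### Lines through two points, and the permutation part of the action -/

/-- The product `[z-a][z-b][ε₀-a-b-z]`. -/
def cubicTheta (ω e₀ a b z : ℂ) : ℂ := br ω (z - a) * br ω (z - b) * br ω (e₀ - a - b - z)

/-- The value at `x` of the linear form in `f₁τ₁τ₂τ₃, f₂τ₁τ₂τ₃, f₃τ₁τ₂τ₃` that interpolates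
`[z-a][z-b][ε₀-a-b-z]` at `z = ε₁, ε₂, ε₃`. -/
def lineForm (ω : ℂ) (x : TauPoint) (a b : ℂ) : ℂ :=
  x.tau 1 * x.tau 2 * x.tau 3 *
    (cubicTheta ω (x.eps 0) a b (x.eps 1) /
        (br ω (x.eps 1 - x.eps 2) * br ω (x.eps 1 - x.eps 3) *
          br ω (x.eps 0 - x.eps 1 - x.eps 2 - x.eps 3)) * x.f 1 -
      cubicTheta ω (x.eps 0) a b (x.eps 2) /
        (br ω (x.eps 1 - x.eps 2) * br ω (x.eps 2 - x.eps 3) *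
          br ω (x.eps 0 - x.eps 1 - x.eps 2 - x.eps 3)) * x.f 2 +
      cubicTheta ω (x.eps 0) a b (x.eps 3) /
        (br ω (x.eps 1 - x.eps 3) * br ω (x.eps 2 - x.eps 3) *
          br ω (x.eps 0 - x.eps 1 - x.eps 2 - x.eps 3)) * x.f 3)

/-- The line through a and b meets the cubic again at ε₀ - a - b, so any two of the three points
determine it. -/
lemma lineForm_third (ω : ℂ) (x : TauPoint) (a b : ℂ) :
    lineForm ω x a (x.eps 0 - a - b) = lineForm ω x a b := by
  have h : ∀ z, cubicTheta ω (x.eps 0) a (x.eps 0 - a - b) z = cubicTheta ω (x.eps 0) a b z := by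
    intro z
    unfold cubicTheta
    rw [show z - (x.eps 0 - a - b) = -(x.eps 0 - a - b - z) by ring,
      show x.eps 0 - a - (x.eps 0 - a - b) - z = -(z - b) by ring, br_neg, br_neg]
    ring
  simp only [lineForm, h]

lemma lineForm_comm (ω : ℂ) (x : TauPoint) (a b : ℂ) : lineForm ω x a b = lineForm ω x b a := by
  have h : ∀ z, cubicTheta ω (x.eps 0) a b z = cubicTheta ω (x.eps 0) b a z := by
    intro z
    unfold cubicTheta
    rw [show x.eps 0 - a - b - z = x.eps 0 - b - a - z by ring]
    ring
  simp only [lineForm, h]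

lemma Nondegenerate.two {ω : ℂ} {x : TauPoint} (h : Nondegenerate ω x) (i j : Fin 10)
    (hi : 0 < i := by decide) (hj : 0 < j := by decide) (hij : i ≠ j := by decide) :
    br ω (x.eps i - x.eps j) ≠ 0 :=
  h.1.two i j hi hj hij (Set.notMem_empty _) (Set.notMem_empty _)

lemma Nondegenerate.three {ω : ℂ} {x : TauPoint} (h : Nondegenerate ω x) (i j k : Fin 10)
    (hi : 0 < i := by decide) (hj : 0 < j := by decide) (hk : 0 < k := by decide)
    (hij : i ≠ j := by decide) (hik : i ≠ k := by decide) (hjk : j ≠ k := by decide) :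
    br ω (x.eps 0 - x.eps i - x.eps j - x.eps k) ≠ 0 :=
  h.1.three i j k hi hj hk hij hik hjk

lemma lineForm_one_two {ω : ℂ} {x : TauPoint} (h : Nondegenerate ω x) :
    lineForm ω x (x.eps 1) (x.eps 2) = x.tau 1 * x.tau 2 * x.tau 3 * x.f 3 := by
  have h1 := h.two 1 3
  have h2 := h.two 2 3
  have h3 := h.three 1 2 3
  simp only [lineForm, cubicTheta, sub_self, br_zero]
  rw [br_sub_comm ω (x.eps 3) (x.eps 1), br_sub_comm ω (x.eps 3) (x.eps 2)]
  field_simp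
  ring

lemma lineForm_one_three {ω : ℂ} {x : TauPoint} (h : Nondegenerate ω x) :
    lineForm ω x (x.eps 1) (x.eps 3) = x.tau 1 * x.tau 2 * x.tau 3 * x.f 2 := by
  have h1 := h.two 1 2
  have h2 := h.two 2 3
  have h3 := h.three 1 2 3
  simp only [lineForm, cubicTheta, sub_self, br_zero]
  rw [br_sub_comm ω (x.eps 2) (x.eps 1),
    show x.eps 0 - x.eps 1 - x.eps 3 - x.eps 2 = x.eps 0 - x.eps 1 - x.eps 2 - x.eps 3 by ring]
  field_simp
  ring

lemma lineForm_two_three {ω : ℂ} {x : TauPoint} (h : Nondegenerate ω x) :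
    lineForm ω x (x.eps 2) (x.eps 3) = x.tau 1 * x.tau 2 * x.tau 3 * x.f 1 := by
  have h1 := h.two 1 2
  have h2 := h.two 1 3
  have h3 := h.three 1 2 3
  simp only [lineForm, cubicTheta, sub_self, br_zero]
  rw [show x.eps 0 - x.eps 2 - x.eps 3 - x.eps 1 = x.eps 0 - x.eps 1 - x.eps 2 - x.eps 3 by ring]
  field_simp
  ring

lemma sPoint_eps {ω : ℂ} {k : Fin 9} (hk : k ≠ 0) (x : TauPoint) (i : Fin 10) :
    (sPoint ω k x).eps i = x.eps (Equiv.swap k.castSucc k.succ i) := by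
  simp [sPoint, sParam, hk]

lemma sPoint_tau {ω : ℂ} {k : Fin 9} (hk : k ≠ 0) (x : TauPoint) (i : Fin 10) :
    (sPoint ω k x).tau i = x.tau (Equiv.swap k.castSucc k.succ i) := by
  simp [sPoint, hk]

/-- The line does not change when the reference point ε₃ is replaced by ε₄. The coefficients of f₁
and f₂ agree at once; that of f₃ collects three contributions and is the four-point identity at ε₁,
…, ε₄. -/
lemma lineForm_sPoint_three {ω : ℂ} (hω : 0 < ω.im) {x : TauPoint}
    (h : Nondegenerate ω x) (a b : ℂ) :
    lineForm ω (sPoint ω 3 x) a b = lineForm ω x a b := by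
  have e : ∀ i, (sPoint ω 3 x).eps i = x.eps (Equiv.swap 3 4 i) := sPoint_eps (by decide) x
  have t : ∀ i, (sPoint ω 3 x).tau i = x.tau (Equiv.swap 3 4 i) := sPoint_tau (by decide) x
  have f1 : (sPoint ω 3 x).f 1 = x.tau 3 / x.tau 4 *
    (cCoef ω x.eps 1 3 * x.f 1 + cCoef ω x.eps 3 1 * x.f 3) := rfl
  have f2 : (sPoint ω 3 x).f 2 = x.tau 3 / x.tau 4 *
    (cCoef ω x.eps 2 3 * x.f 2 + cCoef ω x.eps 3 2 * x.f 3) := rfl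
  have f3 : (sPoint ω 3 x).f 3 = x.tau 3 / x.tau 4 * x.f 3 := rfl
  have e0 : Equiv.swap (3 : Fin 10) 4 0 = 0 := by decide
  have e1 : Equiv.swap (3 : Fin 10) 4 1 = 1 := by decide
  have e2 : Equiv.swap (3 : Fin 10) 4 2 = 2 := by decide
  have e3 : Equiv.swap (3 : Fin 10) 4 3 = 4 := by decide
  have h12 := h.two 1 2
  have h13 := h.two 1 3
  have h23 := h.two 2 3
  have h14 := h.two 1 4
  have h24 := h.two 2 4
  have h123 := h.three 1 2 3
  have h124 := h.three 1 2 4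
  have t4 := h.2.2.2.2 4 (by decide)
  have pf := br_pf_four hω (x.eps 1) (x.eps 2) (x.eps 3) (x.eps 4) a b (x.eps 0 - a - b)
    (x.eps 1 + x.eps 2 + x.eps 3 + x.eps 4 - x.eps 0) (by ring)
  unfold pfFour at pf
  simp only [lineForm, e, t, f1, f2, f3, e0, e1, e2, e3, cCoef, br2, br3, cubicTheta]
  rw [br_sub_comm ω (x.eps 3) (x.eps 1), br_sub_comm ω (x.eps 3) (x.eps 2)]
  have s : ∀ i, br ω (x.eps i - (x.eps 0 - a - b)) = -br ω (x.eps 0 - a - b - x.eps i) :=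
    fun i => br_sub_comm ω _ _
  rw [s, s, s, s,
    show x.eps 1 - (x.eps 1 + x.eps 2 + x.eps 3 + x.eps 4 - x.eps 0) =
      x.eps 0 - x.eps 1 - x.eps 2 - x.eps 3 + x.eps 1 - x.eps 4 by ring,
    show x.eps 2 - (x.eps 1 + x.eps 2 + x.eps 3 + x.eps 4 - x.eps 0) =
      x.eps 0 - x.eps 1 - x.eps 2 - x.eps 3 + x.eps 2 - x.eps 4 by ring,
    show x.eps 3 - (x.eps 1 + x.eps 2 + x.eps 3 + x.eps 4 - x.eps 0) =
      x.eps 0 - x.eps 1 - x.eps 2 - x.eps 4 by ring,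
    show x.eps 4 - (x.eps 1 + x.eps 2 + x.eps 3 + x.eps 4 - x.eps 0) =
      x.eps 0 - x.eps 1 - x.eps 2 - x.eps 3 by ring] at pf
  rw [show x.eps 0 - x.eps 1 - x.eps 2 - x.eps 3 + x.eps 3 - x.eps 4 =
      x.eps 0 - x.eps 1 - x.eps 2 - x.eps 4 by ring]
  field_simp
  linear_combination x.tau 1 * x.tau 2 * x.tau 3 * x.f 3 * pf

lemma swap_lt_four : ∀ k : Fin 9, k ≠ 0 → k ≠ 1 → k ≠ 2 → k ≠ 3 → ∀ i : Fin 10, i < 4 →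
    Equiv.swap k.castSucc k.succ i = i := by decide

lemma lineForm_sPoint {ω : ℂ} (hω : 0 < ω.im) {k : Fin 9} (hk : k ≠ 0) {x : TauPoint}
    (h : Nondegenerate ω x) (a b : ℂ) : lineForm ω (sPoint ω k x) a b = lineForm ω x a b := by
  have e := sPoint_eps (ω := ω) hk x
  have t := sPoint_tau (ω := ω) hk x
  by_cases h3 : k = 3
  · subst h3; exact lineForm_sPoint_three hω h a b
  by_cases h1 : k = 1
  · subst h1
    have e0 : Equiv.swap (Fin.castSucc 1) (Fin.succ 1) (0 : Fin 10) = 0 := by decide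
    have e1 : Equiv.swap (Fin.castSucc 1) (Fin.succ 1) (1 : Fin 10) = 2 := by decide
    have e2 : Equiv.swap (Fin.castSucc 1) (Fin.succ 1) (2 : Fin 10) = 1 := by decide
    have e3 : Equiv.swap (Fin.castSucc 1) (Fin.succ 1) (3 : Fin 10) = 3 := by decide
    have f : ∀ i, (sPoint ω 1 x).f i = x.f (Equiv.swap (Fin.castSucc 1) (Fin.succ 1) i) :=
      fun _ => rfl
    simp only [lineForm, e, t, f, e0, e1, e2, e3]
    rw [br_sub_comm ω (x.eps 2) (x.eps 1), show x.eps 0 - x.eps 2 - x.eps 1 - x.eps 3 =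
      x.eps 0 - x.eps 1 - x.eps 2 - x.eps 3 by ring]
    simp only [neg_mul, div_neg]
    ring
  by_cases h2 : k = 2
  · subst h2
    have e0 : Equiv.swap (Fin.castSucc 2) (Fin.succ 2) (0 : Fin 10) = 0 := by decide
    have e1 : Equiv.swap (Fin.castSucc 2) (Fin.succ 2) (1 : Fin 10) = 1 := by decide
    have e2 : Equiv.swap (Fin.castSucc 2) (Fin.succ 2) (2 : Fin 10) = 3 := by decide
    have e3 : Equiv.swap (Fin.castSucc 2) (Fin.succ 2) (3 : Fin 10) = 2 := by decide
    have f : ∀ i, (sPoint ω 2 x).f i = x.f (Equiv.swap (Fin.castSucc 2) (Fin.succ 2) i) :=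
      fun _ => rfl
    simp only [lineForm, e, t, f, e0, e1, e2, e3]
    rw [br_sub_comm ω (x.eps 3) (x.eps 2), show x.eps 0 - x.eps 1 - x.eps 3 - x.eps 2 =
      x.eps 0 - x.eps 1 - x.eps 2 - x.eps 3 by ring]
    simp only [mul_neg, neg_mul, div_neg]
    ring
  have f : (sPoint ω k x).f = x.f := by simp [sPoint, hk, h1, h2, h3]
  have hlt := swap_lt_four k hk h1 h2 h3
  simp only [lineForm, e, t, f, hlt 0 (by decide), hlt 1 (by decide), hlt 2 (by decide),
    hlt 3 (by decide)]

lemma actPoint_append (ω : ℂ) (v w : List (Fin 9)) (x : TauPoint) :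
    actPoint ω (v ++ w) x = actPoint ω w (actPoint ω v x) := List.foldl_append ..

lemma Regular.left {ω : ℂ} {v w : List (Fin 9)} {x : TauPoint} (h : Regular ω (v ++ w) x) :
    Regular ω v x := fun u hu => h u (hu.trans (List.prefix_append v w))

lemma Regular.right {ω : ℂ} {v w : List (Fin 9)} {x : TauPoint} (h : Regular ω (v ++ w) x) :
    Regular ω w (actPoint ω v x) := fun u hu => by
  rw [← actPoint_append]
  exact h _ ((List.prefix_append_right_inj v).mpr hu)

lemma Regular.start {ω : ℂ} {v : List (Fin 9)} {x : TauPoint} (h : Regular ω v x) :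
    Nondegenerate ω x := h [] List.nil_prefix

lemma Regular.finish {ω : ℂ} {v : List (Fin 9)} {x : TauPoint} (h : Regular ω v x) :
    Nondegenerate ω (actPoint ω v x) := h v List.prefix_rfl

/-- The permutation of the indices effected by a word without `s₀`. -/
def wordPerm : List (Fin 9) → Fin 10 → Fin 10
  | [], i => i
  | k :: v, i => Equiv.swap k.castSucc k.succ (wordPerm v i)

/-- A word without s₀ may act on f in a complicated way, but ε and τ are merely permuted and all
lines are preserved. Since f₁, f₂, f₃ are themselves lines, this is all one needs to know. -/
lemma actPoint_permWord {ω : ℂ} (hω : 0 < ω.im) (v : List (Fin 9)) (hv : ∀ k ∈ v, k ≠ 0) :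
    ∀ x : TauPoint, Regular ω v x →
      (∀ i, (actPoint ω v x).eps i = x.eps (wordPerm v i)) ∧
      (∀ i, (actPoint ω v x).tau i = x.tau (wordPerm v i)) ∧
      ∀ a b, lineForm ω (actPoint ω v x) a b = lineForm ω x a b := by
  induction v with
  | nil => intro x _; exact ⟨fun _ => rfl, fun _ => rfl, fun _ _ => rfl⟩
  | cons k v ih =>
    intro x hx
    have hk : k ≠ 0 := hv k (by simp)
    obtain ⟨h1, h2, h3⟩ := ih (fun m hm => hv m (by simp [hm])) (sPoint ω k x)
      (Regular.right (v := [k]) hx)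
    refine ⟨fun i => (h1 i).trans (sPoint_eps hk _ _), fun i => (h2 i).trans (sPoint_tau hk _ _),
      fun a b => (h3 a b).trans (lineForm_sPoint hω hk hx.start a b)⟩

/-! ### The action on the parameters -/

lemma actParam_append (v w : List (Fin 9)) (e : Param) :
    actParam (v ++ w) e = actParam w (actParam v e) := List.foldl_append ..

lemma actPoint_eps (ω : ℂ) (v : List (Fin 9)) (x : TauPoint) :
    (actPoint ω v x).eps = actParam v x.eps := by
  induction v generalizing x with
  | nil => rfl
  | cons k v ih => exact ih (sPoint ω k x)

lemma wordPerm_append (u v : List (Fin 9)) (i : Fin 10) :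
    wordPerm (u ++ v) i = wordPerm u (wordPerm v i) := by
  induction u with
  | nil => rfl
  | cons k u ih => simp [wordPerm, ih]

lemma wordPerm_reverse (v : List (Fin 9)) (i : Fin 10) :
    wordPerm v (wordPerm v.reverse i) = i := by
  induction v generalizing i with
  | nil => rfl
  | cons k v ih => simp [wordPerm, wordPerm_append, ih]

lemma wordPerm_reverse_left (v : List (Fin 9)) (i : Fin 10) :
    wordPerm v.reverse (wordPerm v i) = i := by
  simpa using wordPerm_reverse v.reverse i

lemma actParam_permWord (v : List (Fin 9)) (hv : ∀ k ∈ v, k ≠ 0) (e : Param) (i : Fin 10) :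
    actParam v e i = e (wordPerm v i) := by
  induction v generalizing e with
  | nil => rfl
  | cons k v ih =>
    have hk : k ≠ 0 := hv k (by simp)
    refine (ih (fun m hm => hv m (by simp [hm])) (sParam k e)).trans ?_
    simp [sParam, hk, wordPerm]

/-- The word is a conjugate of s₀, hence the reflection in the image of the root ε₀ - ε₁ - ε₂ - ε₃
under the permutation given by D. -/
lemma actParam_reflWord (D : List (Fin 9)) (hD : ∀ k ∈ D, k ≠ 0) (e : Param) (i j k : Fin 10)
    (h0 : wordPerm D 0 = 0) (hi : wordPerm D 1 = i) (hj : wordPerm D 2 = j)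
    (hk : wordPerm D 3 = k) (m : Fin 10) :
    actParam (D ++ [0] ++ D.reverse) e m =
      e m + if m = 0 ∨ m = i ∨ m = j ∨ m = k then e 0 - e i - e j - e k else 0 := by
  have rr := wordPerm_reverse D
  have hm : m = 0 ∨ m = i ∨ m = j ∨ m = k ↔ wordPerm D.reverse m ≤ 3 := by
    constructor
    · have r : ∀ n l : Fin 10, wordPerm D l = n → wordPerm D.reverse n = l := by
        rintro n l rfl
        exact wordPerm_reverse_left D l
      rintro (h | h | h | h) <;> rw [h]
      · rw [r 0 0 h0]; decide
      · rw [r i 1 hi]; decide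
      · rw [r j 2 hj]; decide
      · rw [r k 3 hk]
    · intro h
      have h4 : ∀ n : Fin 10, n ≤ 3 → n = 0 ∨ n = 1 ∨ n = 2 ∨ n = 3 := by decide
      rcases h4 _ h with h | h | h | h
      · left; rw [← rr m, h, h0]
      · right; left; rw [← rr m, h, hi]
      · right; right; left; rw [← rr m, h, hj]
      · right; right; right; rw [← rr m, h, hk]
  rw [actParam_append, actParam_permWord _ (by simpa using hD), actParam_append]
  change (if wordPerm D.reverse m ≤ 3 then actParam D e _ + (actParam D e 0 - actParam D e 1 -
    actParam D e 2 - actParam D e 3) else actParam D e _) = _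
  simp only [actParam_permWord D hD, rr, h0, hi, hj, hk, hm]
  split_ifs <;> simp

/-! ### The quadratic transformations -/

lemma sPoint_zero_eps (ω : ℂ) (x : TauPoint) (i : Fin 10) :
    (sPoint ω 0 x).eps i =
      if i ≤ 3 then x.eps i + (x.eps 0 - x.eps 1 - x.eps 2 - x.eps 3) else x.eps i := rfl

lemma sPoint_zero_tau (ω : ℂ) (x : TauPoint) (i : Fin 10) :
    (sPoint ω 0 x).tau i = if i = 1 ∨ i = 2 ∨ i = 3 then x.f i * x.tau i else x.tau i := rfl

/-- The factors f₁f₂f₃ gained by τ₁τ₂τ₃ clear the inverses of the coordinates, so the transform of a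
line is a conic through the three coordinate points. -/
lemma lineForm_sPoint_zero {ω : ℂ} {x : TauPoint} (h : Nondegenerate ω x) (a b : ℂ) :
    lineForm ω (sPoint ω 0 x) a b =
      -(x.tau 1 * x.tau 2 * x.tau 3) / br ω (x.eps 0 - x.eps 1 - x.eps 2 - x.eps 3) *
      (cubicTheta ω (2 * x.eps 0 - x.eps 1 - x.eps 2 - x.eps 3) a b
            (x.eps 0 - x.eps 2 - x.eps 3) /
          (br ω (x.eps 1 - x.eps 2) * br ω (x.eps 1 - x.eps 3)) * (x.f 2 * x.f 3) -
        cubicTheta ω (2 * x.eps 0 - x.eps 1 - x.eps 2 - x.eps 3) a b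
            (x.eps 0 - x.eps 1 - x.eps 3) /
          (br ω (x.eps 1 - x.eps 2) * br ω (x.eps 2 - x.eps 3)) * (x.f 1 * x.f 3) +
        cubicTheta ω (2 * x.eps 0 - x.eps 1 - x.eps 2 - x.eps 3) a b
            (x.eps 0 - x.eps 1 - x.eps 2) /
          (br ω (x.eps 1 - x.eps 3) * br ω (x.eps 2 - x.eps 3)) * (x.f 1 * x.f 2)) := by
  obtain ⟨hg, f1, f2, f3, -⟩ := h
  have e0 : (sPoint ω 0 x).eps 0 = 2 * x.eps 0 - x.eps 1 - x.eps 2 - x.eps 3 := by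
    rw [sPoint_zero_eps, if_pos (by decide)]; ring
  have e1 : (sPoint ω 0 x).eps 1 = x.eps 0 - x.eps 2 - x.eps 3 := by
    rw [sPoint_zero_eps, if_pos (by decide)]; ring
  have e2 : (sPoint ω 0 x).eps 2 = x.eps 0 - x.eps 1 - x.eps 3 := by
    rw [sPoint_zero_eps, if_pos (by decide)]; ring
  have e3 : (sPoint ω 0 x).eps 3 = x.eps 0 - x.eps 1 - x.eps 2 := by
    rw [sPoint_zero_eps, if_pos (by decide)]; ring
  have t1 : (sPoint ω 0 x).tau 1 = x.f 1 * x.tau 1 := rfl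
  have t2 : (sPoint ω 0 x).tau 2 = x.f 2 * x.tau 2 := rfl
  have t3 : (sPoint ω 0 x).tau 3 = x.f 3 * x.tau 3 := rfl
  have g1 : (sPoint ω 0 x).f 1 = (x.f 1)⁻¹ := rfl
  have g2 : (sPoint ω 0 x).f 2 = (x.f 2)⁻¹ := rfl
  have g3 : (sPoint ω 0 x).f 3 = (x.f 3)⁻¹ := rfl
  simp only [lineForm, e0, e1, e2, e3, t1, t2, t3, g1, g2, g3]
  rw [show x.eps 0 - x.eps 2 - x.eps 3 - (x.eps 0 - x.eps 1 - x.eps 3) = x.eps 1 - x.eps 2 by ring,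
    show x.eps 0 - x.eps 2 - x.eps 3 - (x.eps 0 - x.eps 1 - x.eps 2) = x.eps 1 - x.eps 3 by ring,
    show x.eps 0 - x.eps 1 - x.eps 3 - (x.eps 0 - x.eps 1 - x.eps 2) = x.eps 2 - x.eps 3 by ring,
    show 2 * x.eps 0 - x.eps 1 - x.eps 2 - x.eps 3 - (x.eps 0 - x.eps 2 - x.eps 3) -
      (x.eps 0 - x.eps 1 - x.eps 3) - (x.eps 0 - x.eps 1 - x.eps 2) =
      -(x.eps 0 - x.eps 1 - x.eps 2 - x.eps 3) by ring, br_neg]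
  simp only [mul_neg, div_neg]
  field_simp
  ring

/-- The point ε₀ - ε₂ - ε₃ is the image of ε₁. A line through it has no term in f₂f₃, so its
transform splits into the line f₁ = 0 through the second and third points and a line through the
first one. -/
lemma lineForm_sPoint_zero_first {ω : ℂ} {x : TauPoint} (h : Nondegenerate ω x) (b : ℂ) :
    lineForm ω (sPoint ω 0 x) (x.eps 0 - x.eps 2 - x.eps 3) b * (x.tau 1 * x.tau 2 * x.tau 3) =
      lineForm ω x (x.eps 2) (x.eps 3) * lineForm ω x (x.eps 1) b := by
  rw [lineForm_sPoint_zero h, lineForm_two_three h, lineForm]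
  simp only [cubicTheta, sub_self, br_zero, zero_mul]
  have h1 := h.two 1 2
  have h2 := h.two 1 3
  have h3 := h.two 2 3
  have h4 := h.three 1 2 3
  rw [br_sub_comm ω (x.eps 2) (x.eps 1), br_sub_comm ω (x.eps 3) (x.eps 1),
    show x.eps 0 - x.eps 1 - x.eps 3 - (x.eps 0 - x.eps 2 - x.eps 3) =
      -(x.eps 1 - x.eps 2) by ring,
    show x.eps 0 - x.eps 1 - x.eps 2 - (x.eps 0 - x.eps 2 - x.eps 3) =
      -(x.eps 1 - x.eps 3) by ring, br_neg, br_neg,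
    show x.eps 0 - x.eps 1 - x.eps 3 - b = x.eps 0 - x.eps 1 - b - x.eps 3 by ring,
    show x.eps 0 - x.eps 1 - x.eps 2 - b = x.eps 0 - x.eps 1 - b - x.eps 2 by ring,
    show 2 * x.eps 0 - x.eps 1 - x.eps 2 - x.eps 3 - (x.eps 0 - x.eps 2 - x.eps 3) - b -
      (x.eps 0 - x.eps 1 - x.eps 3) = x.eps 3 - b by ring,
    show 2 * x.eps 0 - x.eps 1 - x.eps 2 - x.eps 3 - (x.eps 0 - x.eps 2 - x.eps 3) - b -
      (x.eps 0 - x.eps 1 - x.eps 2) = x.eps 2 - b by ring]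
  field_simp
  ring

lemma lineForm_sPoint_zero_third {ω : ℂ} {x : TauPoint} (h : Nondegenerate ω x) (b : ℂ) :
    lineForm ω (sPoint ω 0 x) (x.eps 0 - x.eps 1 - x.eps 2) b * (x.tau 1 * x.tau 2 * x.tau 3) =
      lineForm ω x (x.eps 1) (x.eps 2) * lineForm ω x (x.eps 3) b := by
  rw [lineForm_sPoint_zero h, lineForm_one_two h, lineForm]
  simp only [cubicTheta, sub_self, br_zero, zero_mul]
  have h1 := h.two 1 2
  have h2 := h.two 1 3
  have h3 := h.two 2 3
  have h4 := h.three 1 2 3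
  rw [show x.eps 0 - x.eps 2 - x.eps 3 - (x.eps 0 - x.eps 1 - x.eps 2) =
      x.eps 1 - x.eps 3 by ring,
    show x.eps 0 - x.eps 1 - x.eps 3 - (x.eps 0 - x.eps 1 - x.eps 2) =
      x.eps 2 - x.eps 3 by ring,
    show x.eps 0 - x.eps 2 - x.eps 3 - b = x.eps 0 - x.eps 3 - b - x.eps 2 by ring,
    show x.eps 0 - x.eps 1 - x.eps 3 - b = x.eps 0 - x.eps 3 - b - x.eps 1 by ring,
    show 2 * x.eps 0 - x.eps 1 - x.eps 2 - x.eps 3 - (x.eps 0 - x.eps 1 - x.eps 2) - b -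
      (x.eps 0 - x.eps 2 - x.eps 3) = x.eps 2 - b by ring,
    show 2 * x.eps 0 - x.eps 1 - x.eps 2 - x.eps 3 - (x.eps 0 - x.eps 1 - x.eps 2) - b -
      (x.eps 0 - x.eps 1 - x.eps 3) = x.eps 1 - b by ring]
  field_simp
  ring

/-! ### Reflections described by their effect on lines. -/

/-- The point `y` is the image of `x` under the reflection in `ε₀ - εᵢ - εⱼ - εₖ`. -/
structure IsReflected (ω : ℂ) (i j k : Fin 10) (x y : TauPoint) : Prop where
  eps : ∀ m, y.eps m = x.eps m +
    if m = 0 ∨ m = i ∨ m = j ∨ m = k then x.eps 0 - x.eps i - x.eps j - x.eps k else 0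
  tau_i : y.tau i * (x.tau j * x.tau k) = lineForm ω x (x.eps j) (x.eps k)
  tau_j : y.tau j * (x.tau i * x.tau k) = lineForm ω x (x.eps i) (x.eps k)
  tau_k : y.tau k * (x.tau i * x.tau j) = lineForm ω x (x.eps i) (x.eps j)
  tau : ∀ m, m ≠ i → m ≠ j → m ≠ k → y.tau m = x.tau m
  line_i : ∀ b, lineForm ω y (x.eps 0 - x.eps j - x.eps k) b *
      (x.tau i * x.tau j * x.tau k) =
    lineForm ω x (x.eps j) (x.eps k) * lineForm ω x (x.eps i) b
  line_k : ∀ b, lineForm ω y (x.eps 0 - x.eps i - x.eps j) b *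
      (x.tau i * x.tau j * x.tau k) =
    lineForm ω x (x.eps i) (x.eps j) * lineForm ω x (x.eps k) b
  conic : ∀ a b, lineForm ω y a b * (x.tau i * x.tau j * x.tau k) =
    -1 / br ω (x.eps 0 - x.eps i - x.eps j - x.eps k) *
      (cubicTheta ω (2 * x.eps 0 - x.eps i - x.eps j - x.eps k) a b
            (x.eps 0 - x.eps j - x.eps k) /
          (br ω (x.eps i - x.eps j) * br ω (x.eps i - x.eps k)) *
          (lineForm ω x (x.eps i) (x.eps k) * lineForm ω x (x.eps i) (x.eps j)) -
        cubicTheta ω (2 * x.eps 0 - x.eps i - x.eps j - x.eps k) a b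
            (x.eps 0 - x.eps i - x.eps k) /
          (br ω (x.eps i - x.eps j) * br ω (x.eps j - x.eps k)) *
          (lineForm ω x (x.eps j) (x.eps k) * lineForm ω x (x.eps i) (x.eps j)) +
        cubicTheta ω (2 * x.eps 0 - x.eps i - x.eps j - x.eps k) a b
            (x.eps 0 - x.eps i - x.eps j) /
          (br ω (x.eps i - x.eps k) * br ω (x.eps j - x.eps k)) *
          (lineForm ω x (x.eps j) (x.eps k) * lineForm ω x (x.eps i) (x.eps k)))

/-- After D the points i, j, k carry the labels 1, 2, 3, so the formulas for s₀ apply. Both D and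
its reverse preserve lines, which brings the formulas back to the original labels. -/
lemma isReflected_word {ω : ℂ} (hω : 0 < ω.im) (D : List (Fin 9)) (hD : ∀ k ∈ D, k ≠ 0)
    {x : TauPoint} (hx : Regular ω (D ++ [0] ++ D.reverse) x) (i j k : Fin 10)
    (h0 : wordPerm D 0 = 0) (hi : wordPerm D 1 = i) (hj : wordPerm D 2 = j)
    (hk : wordPerm D 3 = k) :
    IsReflected ω i j k x (actPoint ω (D ++ [0] ++ D.reverse) x) := by
  obtain ⟨e1, t1, l1⟩ := actPoint_permWord hω D hD x hx.left.left
  have hn : Nondegenerate ω (actPoint ω D x) := hx.left.left.finish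
  obtain ⟨e2, t2, l2⟩ := actPoint_permWord hω D.reverse (by simpa using hD) _ hx.right
  rw [actPoint_append ω D [0] x] at e2 t2 l2
  have hy : actPoint ω (D ++ [0] ++ D.reverse) x =
    actPoint ω D.reverse (sPoint ω 0 (actPoint ω D x)) := by
      rw [actPoint_append, actPoint_append]; rfl
  change ∀ i, (actPoint ω D.reverse (sPoint ω 0 (actPoint ω D x))).eps i =
    (sPoint ω 0 (actPoint ω D x)).eps _ at e2
  change ∀ i, (actPoint ω D.reverse (sPoint ω 0 (actPoint ω D x))).tau i =
    (sPoint ω 0 (actPoint ω D x)).tau _ at t2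
  change ∀ a b, lineForm ω (actPoint ω D.reverse (sPoint ω 0 (actPoint ω D x))) a b =
    lineForm ω (sPoint ω 0 (actPoint ω D x)) a b at l2
  rw [hy]
  have heps : (actPoint ω D.reverse (sPoint ω 0 (actPoint ω D x))).eps =
      actParam (D ++ [0] ++ D.reverse) x.eps := by rw [← hy, actPoint_eps]
  generalize actPoint ω D.reverse (sPoint ω 0 (actPoint ω D x)) = y at *
  have r1 : wordPerm D.reverse i = 1 := by rw [← hi, wordPerm_reverse_left]
  have r2 : wordPerm D.reverse j = 2 := by rw [← hj, wordPerm_reverse_left]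
  have r3 : wordPerm D.reverse k = 3 := by rw [← hk, wordPerm_reverse_left]
  have rr := wordPerm_reverse D
  have E0 := e1 0
  have E1 := e1 1
  have E2 := e1 2
  have E3 := e1 3
  have T1 := t1 1
  have T2 := t1 2
  have T3 := t1 3
  rw [h0] at E0
  rw [hi] at E1 T1
  rw [hj] at E2 T2
  rw [hk] at E3 T3
  have L12 := lineForm_one_two hn
  have L13 := lineForm_one_three hn
  have L23 := lineForm_two_three hn
  rw [l1, E1, E2, T1, T2, T3] at L12
  rw [l1, E1, E3, T1, T2, T3] at L13
  rw [l1, E2, E3, T1, T2, T3] at L23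
  refine ⟨fun m => ?_, ?_, ?_, ?_, fun m mi mj mk => ?_, fun b => ?_, fun b => ?_, fun a b => ?_⟩
  · rw [heps, actParam_reflWord D hD _ i j k h0 hi hj hk]
  · rw [t2, r1, sPoint_zero_tau, if_pos (by decide), T1, L23]; ring
  · rw [t2, r2, sPoint_zero_tau, if_pos (by decide), T2, L13]; ring
  · rw [t2, r3, sPoint_zero_tau, if_pos (by decide), T3, L12]; ring
  · rw [t2, sPoint_zero_tau, if_neg, t1, rr]
    rintro (h | h | h)
    · exact mi (by rw [← rr m, h, hi])
    · exact mj (by rw [← rr m, h, hj])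
    · exact mk (by rw [← rr m, h, hk])
  · have h := lineForm_sPoint_zero_first hn b
    rwa [l1, l1, ← l2, E0, E1, E2, E3, T1, T2, T3] at h
  · have h := lineForm_sPoint_zero_third hn b
    rwa [l1, l1, ← l2, E0, E1, E2, E3, T1, T2, T3] at h
  · rw [L12, L13, L23, l2, lineForm_sPoint_zero hn, E0, E1, E2, E3, T1, T2, T3]
    ring

lemma isReflected_refl3 {ω : ℂ} (hω : 0 < ω.im) {a b c : ℕ} {x : TauPoint}
    (hx : Regular ω (refl3 a b c) x) (i j k : Fin 10)
    (hD : ∀ k ∈ descend a 1 ++ descend b 2 ++ descend c 3, k ≠ 0)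
    (h0 : wordPerm (descend a 1 ++ descend b 2 ++ descend c 3) 0 = 0)
    (hi : wordPerm (descend a 1 ++ descend b 2 ++ descend c 3) 1 = i)
    (hj : wordPerm (descend a 1 ++ descend b 2 ++ descend c 3) 2 = j)
    (hk : wordPerm (descend a 1 ++ descend b 2 ++ descend c 3) 3 = k) :
    IsReflected ω i j k x (actPoint ω (refl3 a b c) x) :=
  isReflected_word hω _ hD hx i j k h0 hi hj hk

lemma isReflected_126 {ω : ℂ} (hω : 0 < ω.im) {x : TauPoint} (hx : Regular ω (refl3 1 2 6) x) :
    IsReflected ω 1 2 6 x (actPoint ω (refl3 1 2 6) x) :=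
  isReflected_refl3 hω hx 1 2 6 (by decide) (by decide) (by decide) (by decide) (by decide)

lemma isReflected_346 {ω : ℂ} (hω : 0 < ω.im) {x : TauPoint} (hx : Regular ω (refl3 3 4 6) x) :
    IsReflected ω 3 4 6 x (actPoint ω (refl3 3 4 6) x) :=
  isReflected_refl3 hω hx 3 4 6 (by decide) (by decide) (by decide) (by decide) (by decide)

lemma isReflected_568 {ω : ℂ} (hω : 0 < ω.im) {x : TauPoint} (hx : Regular ω (refl3 5 6 8) x) :
    IsReflected ω 5 6 8 x (actPoint ω (refl3 5 6 8) x) :=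
  isReflected_refl3 hω hx 5 6 8 (by decide) (by decide) (by decide) (by decide) (by decide)

lemma isReflected_289 {ω : ℂ} (hω : 0 < ω.im) {x : TauPoint} (hx : Regular ω (refl3 2 8 9) x) :
    IsReflected ω 2 8 9 x (actPoint ω (refl3 2 8 9) x) :=
  isReflected_refl3 hω hx 2 8 9 (by decide) (by decide) (by decide) (by decide) (by decide)

lemma actParam_refl3 (a b c : ℕ) (e : Param) (i j k : Fin 10)
    (hD : ∀ k ∈ descend a 1 ++ descend b 2 ++ descend c 3, k ≠ 0)
    (h0 : wordPerm (descend a 1 ++ descend b 2 ++ descend c 3) 0 = 0)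
    (hi : wordPerm (descend a 1 ++ descend b 2 ++ descend c 3) 1 = i)
    (hj : wordPerm (descend a 1 ++ descend b 2 ++ descend c 3) 2 = j)
    (hk : wordPerm (descend a 1 ++ descend b 2 ++ descend c 3) 3 = k) (m : Fin 10) :
    actParam (refl3 a b c) e m =
      e m + if m = 0 ∨ m = i ∨ m = j ∨ m = k then e 0 - e i - e j - e k else 0 :=
  actParam_reflWord _ hD e i j k h0 hi hj hk m

/-- The word `s₁₅ s₂₈ s₇₉ s₆₇`, the permutation part of `μ`. -/
def muPerm : List (Fin 9) := refl2 1 5 ++ refl2 2 8 ++ refl2 7 9 ++ refl2 6 7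

/-- The word `s₄₈ s₃₉`, the permutation part of `s₂₈₉ s₄₈ s₃₉`. -/
def wPerm : List (Fin 9) := refl2 4 8 ++ refl2 3 9

lemma muWord_eq : muWord = refl3 1 2 6 ++ refl3 3 4 6 ++ refl3 5 6 8 ++ muPerm := by
  simp [muWord, muPerm]

lemma wWord_eq : wWord = refl3 2 8 9 ++ wPerm := by simp [wWord, wPerm]

lemma muPerm_ne_zero : ∀ k ∈ muPerm, k ≠ 0 := by decide

lemma wPerm_ne_zero : ∀ k ∈ wPerm, k ≠ 0 := by decide

lemma wordPerm_muPerm (i : Fin 10) : wordPerm muPerm i = ![0, 5, 8, 3, 4, 1, 9, 6, 2, 7] i := by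
  revert i; decide

lemma wordPerm_wPerm (i : Fin 10) : wordPerm wPerm i = ![0, 1, 2, 9, 8, 5, 6, 7, 4, 3] i := by
  revert i; decide

/-- The values of `μ(ε₀), …, μ(ε₉)`. -/
lemma actParam_muWord (e : Param) : actParam muWord e =
    ![4 * e 0 - e 1 - e 2 - e 3 - e 4 - e 5 - 3 * e 6 - e 8, e 0 - e 6 - e 8, e 0 - e 5 - e 6,
      e 0 - e 4 - e 6, e 0 - e 3 - e 6, e 0 - e 2 - e 6, e 9,
      3 * e 0 - e 1 - e 2 - e 3 - e 4 - e 5 - 2 * e 6 - e 8, e 0 - e 1 - e 6, e 7] := by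
  funext i
  rw [muWord_eq, actParam_append, actParam_permWord _ muPerm_ne_zero, wordPerm_muPerm,
    actParam_append, actParam_append]
  simp only [actParam_refl3 1 2 6 _ 1 2 6 (by decide) (by decide) (by decide) (by decide)
      (by decide), actParam_refl3 3 4 6 _ 3 4 6 (by decide) (by decide) (by decide) (by decide)
      (by decide), actParam_refl3 5 6 8 _ 5 6 8 (by decide) (by decide) (by decide) (by decide)
      (by decide)]
  fin_cases i <;> simp <;> ring

/-- The values of `w(ε₀), …, w(ε₉)` for `w = s₂₈₉ s₄₈ s₃₉`. -/
lemma actParam_wWord (e : Param) : actParam wWord e =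
    ![2 * e 0 - e 2 - e 8 - e 9, e 1, e 0 - e 8 - e 9, e 0 - e 2 - e 8, e 0 - e 2 - e 9, e 5,
      e 6, e 7, e 4, e 3] := by
  funext i
  rw [wWord_eq, actParam_append, actParam_permWord _ wPerm_ne_zero, wordPerm_wPerm]
  simp only [actParam_refl3 2 8 9 _ 2 8 9 (by decide) (by decide) (by decide) (by decide)
      (by decide)]
  fin_cases i <;> simp <;> ring

lemma del_eq (e : Param) : del e =
    3 * e 0 - e 1 - e 2 - e 3 - e 4 - e 5 - e 6 - e 7 - e 8 - e 9 := by
  simp only [del, Fin.sum_univ_succ, Finset.univ_eq_empty, Finset.sum_empty]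
  simp only [Fin.succ_zero_eq_one]
  simp
  ring

/-- The values of `T(ε₀), …, T(ε₉)`. -/
lemma actParam_tWord (e : Param) : actParam tWord e =
    ![e 0 + 3 * (del e - (e 6 - e 7)), e 1 + (del e - (e 6 - e 7)), e 2 + (del e - (e 6 - e 7)),
      e 3 + (del e - (e 6 - e 7)), e 4 + (del e - (e 6 - e 7)), e 5 + (del e - (e 6 - e 7)),
      e 7, e 7 + (2 * del e - (e 6 - e 7)), e 8 + (del e - (e 6 - e 7)),
      e 9 + (del e - (e 6 - e 7))] := by
  rw [tWord, actParam_append, actParam_muWord, actParam_muWord]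
  simp only [del_eq]
  funext i
  fin_cases i <;> simp <;> ring

lemma del_tWord (e : Param) : del (actParam tWord e) = del e := by
  rw [del_eq (actParam tWord e), actParam_tWord]
  simp
  rw [del_eq]
  ring

lemma actParam_tWord_apply (e : Param) (i : Fin 10) : actParam tWord e i =
    e i + (if i = 0 then 3 else 1) * (del e - (e 6 - e 7))
      + (if i = 7 then del e else if i = 6 then -del e else 0) := by
  rw [actParam_tWord]
  fin_cases i <;> simp
  · ring
  · ring

lemma actParam_wWord_tWord (e : Param) :
    actParam wWord (actParam tWord e) = actParam tWord (actParam wWord e) := by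
  rw [actParam_wWord, actParam_tWord, actParam_wWord, actParam_tWord]
  simp only [del_eq]
  funext i
  fin_cases i <;> simp <;> ring

/-! ### The classes of lines under reflections. -/

/-- The class `τ(ε₀ - εᵢ - εⱼ)`. -/
def lineTau (ω : ℂ) (x : TauPoint) (i j : Fin 10) : ℂ :=
  lineForm ω x (x.eps i) (x.eps j) / (x.tau i * x.tau j)

lemma br_mul_three_congr {ω x y z x' y' z' : ℂ} (hx : x = x') (hy : y = y') (hz : z = z') :
    br ω x * br ω y * br ω z = br ω x' * br ω y' * br ω z' := by rw [hx, hy, hz]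

lemma lineTau_comm (ω : ℂ) (x : TauPoint) (i j : Fin 10) :
    lineTau ω x i j = lineTau ω x j i := by
  rw [lineTau, lineForm_comm, mul_comm, lineTau]

lemma Nondegenerate.tau {ω : ℂ} {x : TauPoint} (h : Nondegenerate ω x) (i : Fin 10)
    (hi : 0 < i := by decide) : x.tau i ≠ 0 := h.2.2.2.2 i hi

lemma lineTau_two_three {ω : ℂ} {x : TauPoint} (h : Nondegenerate ω x) :
    lineTau ω x 2 3 = x.f 1 * x.tau 1 := by
  have h2 := h.tau 2
  have h3 := h.tau 3
  rw [lineTau, lineForm_two_three h]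
  field_simp

lemma lineTau_one_three {ω : ℂ} {x : TauPoint} (h : Nondegenerate ω x) :
    lineTau ω x 1 3 = x.f 2 * x.tau 2 := by
  have h2 := h.tau 1
  have h3 := h.tau 3
  rw [lineTau, lineForm_one_three h]
  field_simp

lemma lineTau_one_two {ω : ℂ} {x : TauPoint} (h : Nondegenerate ω x) :
    lineTau ω x 1 2 = x.f 3 * x.tau 3 := by
  have h2 := h.tau 1
  have h3 := h.tau 2
  rw [lineTau, lineForm_one_two h]
  field_simp

section

variable {ω : ℂ} {i j k : Fin 10} {x y : TauPoint}

lemma IsReflected.tau_i_eq (h : IsReflected ω i j k x y) (hx : Nondegenerate ω x)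
    (hj : 0 < j := by decide) (hk : 0 < k := by decide) :
    y.tau i = lineTau ω x j k := by
  have h1 := hx.tau j hj
  have h2 := hx.tau k hk
  rw [lineTau, ← h.tau_i]
  field_simp

lemma IsReflected.tau_k_eq (h : IsReflected ω i j k x y) (hx : Nondegenerate ω x)
    (hi : 0 < i := by decide) (hj : 0 < j := by decide) :
    y.tau k = lineTau ω x i j := by
  have h1 := hx.tau i hi
  have h2 := hx.tau j hj
  rw [lineTau, ← h.tau_k]
  field_simp

/-- With the intersection form e₀² = 1, eᵢ² = -1, the class e₀ - eᵢ - eₘ is orthogonal to the root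
e₀ - eᵢ - eⱼ - eₖ, hence fixed by the reflection. -/
lemma IsReflected.lineTau_i (h : IsReflected ω i j k x y) (hx : Nondegenerate ω x)
    (hy : Nondegenerate ω y) (m : Fin 10) (hi : 0 < i := by decide) (hj : 0 < j := by decide)
    (hk : 0 < k := by decide) (hm : 0 < m := by decide) (mi : m ≠ i := by decide)
    (mj : m ≠ j := by decide) (mk : m ≠ k := by decide) :
    lineTau ω y i m = lineTau ω x i m := by
  have e1 : y.eps i = x.eps 0 - x.eps j - x.eps k := by rw [h.eps]; simp; ring
  have e2 : y.eps m = x.eps m := by rw [h.eps]; simp [hm.ne', mi, mj, mk]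
  have l := h.line_i (x.eps m)
  rw [← h.tau_i] at l
  have ti := hx.tau i hi
  have tj := hx.tau j hj
  have tk := hx.tau k hk
  have tm := hx.tau m hm
  have yi := hy.tau i hi
  rw [lineTau, lineTau, e1, e2, h.tau m mi mj mk, div_eq_div_iff (by positivity) (by positivity)]
  have := mul_ne_zero tj tk
  apply mul_right_cancel₀ this
  linear_combination x.tau m * l

lemma IsReflected.lineTau_k (h : IsReflected ω i j k x y) (hx : Nondegenerate ω x)
    (hy : Nondegenerate ω y) (m : Fin 10) (hi : 0 < i := by decide) (hj : 0 < j := by decide)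
    (hk : 0 < k := by decide) (hm : 0 < m := by decide) (mi : m ≠ i := by decide)
    (mj : m ≠ j := by decide) (mk : m ≠ k := by decide) :
    lineTau ω y k m = lineTau ω x k m := by
  have e1 : y.eps k = x.eps 0 - x.eps i - x.eps j := by rw [h.eps]; simp
  have e2 : y.eps m = x.eps m := by rw [h.eps]; simp [hm.ne', mi, mj, mk]
  have l := h.line_k (x.eps m)
  rw [← h.tau_k] at l
  have ti := hx.tau i hi
  have tj := hx.tau j hj
  have tk := hx.tau k hk
  have tm := hx.tau m hm
  have yk := hy.tau k hk
  rw [lineTau, lineTau, e1, e2, h.tau m mi mj mk, div_eq_div_iff (by positivity) (by positivity)]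
  have := mul_ne_zero ti tj
  apply mul_right_cancel₀ this
  linear_combination x.tau m * l

/-- Here the intersection number with the root is -1, and the reflection takes e₀ - eᵢ - eₖ to eⱼ.
-/
lemma IsReflected.lineTau_i_k (h : IsReflected ω i j k x y) (hx : Nondegenerate ω x)
    (hy : Nondegenerate ω y) (hi : 0 < i := by decide) (hj : 0 < j := by decide)
    (hk : 0 < k := by decide) : lineTau ω y i k = x.tau j := by
  have e1 : y.eps i = x.eps 0 - x.eps j - x.eps k := by rw [h.eps]; simp; ring
  have e2 : y.eps k = x.eps 0 - x.eps i - x.eps j := by rw [h.eps]; simp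
  have l := h.line_i (x.eps 0 - x.eps i - x.eps j)
  rw [← h.tau_i, lineForm_third, ← h.tau_k] at l
  have ti := hx.tau i hi
  have tj := hx.tau j hj
  have tk := hx.tau k hk
  have yi := hy.tau i hi
  have yk := hy.tau k hk
  rw [lineTau, e1, e2, div_eq_iff (by positivity)]
  have := mul_ne_zero (mul_ne_zero ti tj) tk
  apply mul_right_cancel₀ this
  linear_combination l

/-- The reflection in e₀ - e₁ - e₂ - e₆ takes e₀ - e₃ - eₘ to the conic 2e₀ - e₁ - e₂ - e₃ - e₆ -
eₘ. This class is symmetric in 3 and 6, so it is also the image of e₀ - e₆ - eₘ under s₀; in that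
form it is visibly a polynomial in f₂f₃, f₁f₃, f₁f₂. -/
lemma IsReflected.lineTau_conic (hω : 0 < ω.im) (h : IsReflected ω 1 2 6 x y)
    (hx : Nondegenerate ω x) (m : Fin 10) (m1 : m ≠ 1 := by decide) (m2 : m ≠ 2 := by decide)
    (m6 : m ≠ 6 := by decide) (hm : 0 < m := by decide) :
    lineTau ω y 3 m =
      lineForm ω (sPoint ω 0 x) (x.eps m) (x.eps 6) / (x.tau m * x.tau 6) := by
  have l := h.conic (x.eps 3) (x.eps m)
  have e3 : y.eps 3 = x.eps 3 := by rw [h.eps]; simp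
  have em : y.eps m = x.eps m := by rw [h.eps]; simp [hm.ne', m1, m2, m6]
  have t1 := hx.tau 1
  have t2 := hx.tau 2
  have t3 := hx.tau 3
  have t6 := hx.tau 6
  have tm := hx.tau m hm
  have h12 := hx.two 1 2
  have h13 := hx.two 1 3
  have h23 := hx.two 2 3
  have h16 := hx.two 1 6
  have h26 := hx.two 2 6
  have h123 := hx.three 1 2 3
  have h126 := hx.three 1 2 6
  have h26m := hx.three 2 6 m (hk := hm) (hik := m2.symm) (hjk := m6.symm)
  -- The conic obtained from the reflection also has a term in f₃²; this relation is the vanishing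
  -- of its coefficient.
  have T := br_pf_three hω (x.eps 2) (x.eps 3) (x.eps 6) (x.eps 1)
    (x.eps 0 - x.eps 1 - x.eps m)
    (x.eps 2 + x.eps 3 + x.eps 6 - x.eps 0 + x.eps m) (by ring)
  rw [show x.eps 2 - (x.eps 0 - x.eps 1 - x.eps m) =
      -(x.eps 0 - x.eps 1 - x.eps 2 - x.eps m) by ring,
    show x.eps 3 - (x.eps 0 - x.eps 1 - x.eps m) =
      -(x.eps 0 - x.eps 1 - x.eps 3 - x.eps m) by ring,
    show x.eps 6 - (x.eps 0 - x.eps 1 - x.eps m) =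
      -(x.eps 0 - x.eps 1 - x.eps 6 - x.eps m) by ring,
    show x.eps 2 - (x.eps 2 + x.eps 3 + x.eps 6 - x.eps 0 + x.eps m) =
      x.eps 0 - x.eps 3 - x.eps 6 - x.eps m by ring,
    show x.eps 3 - (x.eps 2 + x.eps 3 + x.eps 6 - x.eps 0 + x.eps m) =
      x.eps 0 - x.eps 2 - x.eps 6 - x.eps m by ring,
    show x.eps 6 - (x.eps 2 + x.eps 3 + x.eps 6 - x.eps 0 + x.eps m) =
      x.eps 0 - x.eps 2 - x.eps 3 - x.eps m by ring, br_neg, br_neg, br_neg,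
    br_sub_comm ω (x.eps 2) (x.eps 1), br_sub_comm ω (x.eps 3) (x.eps 1),
    br_sub_comm ω (x.eps 6) (x.eps 1), br_sub_comm ω (x.eps 6) (x.eps 2)] at T
  have c1 : cubicTheta ω (2 * x.eps 0 - x.eps 1 - x.eps 2 - x.eps 6) (x.eps 3) (x.eps m)
      (x.eps 0 - x.eps 2 - x.eps 6) = _ :=
    br_mul_three_congr (x' := x.eps 0 - x.eps 2 - x.eps 3 - x.eps 6)
      (y' := x.eps 0 - x.eps 2 - x.eps 6 - x.eps m) (z' := x.eps 0 - x.eps 1 - x.eps 3 - x.eps m)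
      (by ring) (by ring) (by ring)
  have c2 : cubicTheta ω (2 * x.eps 0 - x.eps 1 - x.eps 2 - x.eps 6) (x.eps 3) (x.eps m)
      (x.eps 0 - x.eps 1 - x.eps 6) = _ :=
    br_mul_three_congr (x' := x.eps 0 - x.eps 1 - x.eps 3 - x.eps 6)
      (y' := x.eps 0 - x.eps 1 - x.eps 6 - x.eps m) (z' := x.eps 0 - x.eps 2 - x.eps 3 - x.eps m)
      (by ring) (by ring) (by ring)
  have c3 : cubicTheta ω (2 * x.eps 0 - x.eps 1 - x.eps 2 - x.eps 6) (x.eps 3) (x.eps m)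
      (x.eps 0 - x.eps 1 - x.eps 2) = _ :=
    br_mul_three_congr (x' := x.eps 0 - x.eps 1 - x.eps 2 - x.eps 3)
      (y' := x.eps 0 - x.eps 1 - x.eps 2 - x.eps m) (z' := x.eps 0 - x.eps 3 - x.eps 6 - x.eps m)
      (by ring) (by ring) (by ring)
  have d1 : cubicTheta ω (2 * x.eps 0 - x.eps 1 - x.eps 2 - x.eps 3) (x.eps m) (x.eps 6)
      (x.eps 0 - x.eps 2 - x.eps 3) = _ :=
    br_mul_three_congr (x' := x.eps 0 - x.eps 2 - x.eps 3 - x.eps m)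
      (y' := x.eps 0 - x.eps 2 - x.eps 3 - x.eps 6) (z' := x.eps 0 - x.eps 1 - x.eps 6 - x.eps m)
      (by ring) (by ring) (by ring)
  have d2 : cubicTheta ω (2 * x.eps 0 - x.eps 1 - x.eps 2 - x.eps 3) (x.eps m) (x.eps 6)
      (x.eps 0 - x.eps 1 - x.eps 3) = _ :=
    br_mul_three_congr (x' := x.eps 0 - x.eps 1 - x.eps 3 - x.eps m)
      (y' := x.eps 0 - x.eps 1 - x.eps 3 - x.eps 6) (z' := x.eps 0 - x.eps 2 - x.eps 6 - x.eps m)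
      (by ring) (by ring) (by ring)
  have d3 : cubicTheta ω (2 * x.eps 0 - x.eps 1 - x.eps 2 - x.eps 3) (x.eps m) (x.eps 6)
      (x.eps 0 - x.eps 1 - x.eps 2) = _ :=
    br_mul_three_congr (x' := x.eps 0 - x.eps 1 - x.eps 2 - x.eps m)
      (y' := x.eps 0 - x.eps 1 - x.eps 2 - x.eps 6) (z' := x.eps 0 - x.eps 3 - x.eps 6 - x.eps m)
      (by ring) (by ring) (by ring)
  rw [lineTau, e3, em, h.tau 3 (by decide) (by decide) (by decide), h.tau m m1 m2 m6,
    div_eq_div_iff (by positivity) (by positivity)]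
  apply mul_right_cancel₀ (mul_ne_zero (mul_ne_zero t1 t2) t6)
  rw [show lineForm ω y (x.eps 3) (x.eps m) * (x.tau m * x.tau 6) *
    (x.tau 1 * x.tau 2 * x.tau 6) = lineForm ω y (x.eps 3) (x.eps m) *
    (x.tau 1 * x.tau 2 * x.tau 6) * (x.tau m * x.tau 6) by ring, l, lineForm_one_two hx,
    lineForm_sPoint_zero hx, c1, c2, c3, d1, d2, d3]
  simp only [lineForm, cubicTheta, sub_self, br_zero]
  rw [br_sub_comm ω (x.eps 2) (x.eps 1), br_sub_comm ω (x.eps 3) (x.eps 1),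
    br_sub_comm ω (x.eps 3) (x.eps 2),
    show x.eps 0 - x.eps 1 - x.eps 6 - x.eps 2 = x.eps 0 - x.eps 1 - x.eps 2 - x.eps 6 by ring,
    show x.eps 0 - x.eps 2 - x.eps 6 - x.eps 1 = x.eps 0 - x.eps 1 - x.eps 2 - x.eps 6 by ring,
    show x.eps 0 - x.eps 1 - x.eps 6 - x.eps 3 = x.eps 0 - x.eps 1 - x.eps 3 - x.eps 6 by ring,
    show x.eps 0 - x.eps 2 - x.eps 6 - x.eps 3 = x.eps 0 - x.eps 2 - x.eps 3 - x.eps 6 by ring]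
  have T' : br ω (x.eps 0 - x.eps 1 - x.eps 3 - x.eps m) =
      (br ω (x.eps 0 - x.eps 1 - x.eps 2 - x.eps m) * br ω (x.eps 0 - x.eps 3 - x.eps 6 - x.eps m) *
        br ω (x.eps 1 - x.eps 2) * br ω (x.eps 3 - x.eps 6) +
        br ω (x.eps 0 - x.eps 2 - x.eps 3 - x.eps m) *
        br ω (x.eps 0 - x.eps 1 - x.eps 6 - x.eps m) * br ω (x.eps 2 - x.eps 3) *
        br ω (x.eps 1 - x.eps 6)) /
      (br ω (x.eps 0 - x.eps 2 - x.eps 6 - x.eps m) * br ω (x.eps 1 - x.eps 3) *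
        br ω (x.eps 2 - x.eps 6)) := by
    rw [eq_div_iff (by positivity)]
    linear_combination -T
  rw [T']
  field_simp
  ring

end

/-! ### The explicit form of `μ` and `T` -/

/-- The values of `μ(τᵢ)` and `μ(fᵢτᵢ)` for `i = 1, 2, 3`. -/
lemma muWord_lineTau {ω : ℂ} (hω : 0 < ω.im) {x : TauPoint} (hx : Regular ω muWord x) :
    ((actPoint ω muWord x).tau 1 = lineTau ω x 6 8 ∧
      (actPoint ω muWord x).tau 2 = lineTau ω x 6 5 ∧
      (actPoint ω muWord x).tau 3 = lineTau ω x 6 4) ∧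
    (actPoint ω muWord x).f 1 * (actPoint ω muWord x).tau 1 =
      lineForm ω (sPoint ω 0 x) (x.eps 8) (x.eps 6) / (x.tau 8 * x.tau 6) ∧
    (actPoint ω muWord x).f 2 * (actPoint ω muWord x).tau 2 =
      lineForm ω (sPoint ω 0 x) (x.eps 5) (x.eps 6) / (x.tau 5 * x.tau 6) ∧
    (actPoint ω muWord x).f 3 * (actPoint ω muWord x).tau 3 =
      lineForm ω (sPoint ω 0 x) (x.eps 4) (x.eps 6) / (x.tau 4 * x.tau 6) := by
  have hn := hx.start
  have hy := hx.finish
  rw [muWord_eq] at hx hy ⊢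
  have r1 := isReflected_126 hω hx.left.left.left
  have r2 := isReflected_346 hω hx.left.left.right
  have r3 := isReflected_568 hω hx.left.right
  have n1 := hx.left.left.left.finish
  have n2 := hx.left.left.finish
  have n3 := hx.left.finish
  obtain ⟨pe, pt, pl⟩ := actPoint_permWord hω muPerm muPerm_ne_zero _ hx.right
  rw [actPoint_append ω (_ ++ _ ++ _) muPerm] at hy ⊢
  rw [actPoint_append ω (_ ++ _) (refl3 5 6 8)] at *
  rw [actPoint_append ω (refl3 1 2 6) (refl3 3 4 6)] at *
  generalize actPoint ω (refl3 1 2 6) x = x1 at *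
  generalize actPoint ω (refl3 3 4 6) x1 = x2 at *
  generalize actPoint ω (refl3 5 6 8) x2 = x3 at *
  generalize actPoint ω muPerm x3 = y at *
  simp only [wordPerm_muPerm] at pe pt
  have lt : ∀ i j, lineTau ω y i j = lineTau ω x3 (![0, 5, 8, 3, 4, 1, 9, 6, 2, 7] i)
      (![0, 5, 8, 3, 4, 1, 9, 6, 2, 7] j) := fun i j => by
    simp only [lineTau, pe, pt, pl]
  have q1 : lineTau ω y 2 3 = lineTau ω x3 8 3 := lt 2 3
  have q2 : lineTau ω y 1 3 = lineTau ω x3 5 3 := lt 1 3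
  have q3 : lineTau ω y 1 2 = lineTau ω x3 5 8 := lt 1 2
  refine ⟨⟨(pt 1).trans ?_, (pt 2).trans ?_, (pt 3).trans ?_⟩, ?_, ?_, ?_⟩
  -- The classes are traced from the last reflection back to the first. The class e₀ - e₆ - e₈
  -- created by s₅₆₈ is orthogonal to the roots of s₃₄₆ and s₁₂₆.
  · exact (r3.tau_i_eq n2).trans ((r2.lineTau_k n1 n2 8).trans (r1.lineTau_k hn n1 8))
  · exact (r3.tau_k_eq n2).trans ((lineTau_comm ..).trans
      ((r2.lineTau_k n1 n2 5).trans (r1.lineTau_k hn n1 5)))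
  · exact (r3.tau 3 (by decide) (by decide) (by decide)).trans ((r2.tau_i_eq n1).trans
      ((lineTau_comm ..).trans (r1.lineTau_k hn n1 4)))
  · rw [← lineTau_two_three hy, q1, r3.lineTau_k n2 n3 3, lineTau_comm, r2.lineTau_i n1 n2 8,
      r1.lineTau_conic hω hn 8]
  · rw [← lineTau_one_three hy, q2, r3.lineTau_i n2 n3 3, lineTau_comm, r2.lineTau_i n1 n2 5,
      r1.lineTau_conic hω hn 5]
  · rw [← lineTau_one_two hy, q3, r3.lineTau_i_k n2 n3, r2.tau_k_eq n1,
      r1.lineTau_conic hω hn 4]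

lemma lineForm_eq_polyP (ω : ℂ) (x : TauPoint) (i : Fin 10) :
    lineForm ω x (x.eps 6) (x.eps (jIdx i)) =
      polyP ω x.eps i (x.f 1) (x.f 2) (x.f 3) * (x.tau 1 * x.tau 2 * x.tau 3) := by
  have s : ∀ m n : Fin 10, x.eps 0 - x.eps m - x.eps n - x.eps 6 =
    x.eps 0 - x.eps 6 - x.eps n - x.eps m := fun m n => by ring
  simp only [lineForm, polyP, cubicTheta, br2, br3, s _ (jIdx i)]
  ring

lemma lineForm_eq_polyQ {ω : ℂ} {x : TauPoint} (h : Nondegenerate ω x) (i : Fin 10) :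
    lineForm ω (sPoint ω 0 x) (x.eps (jIdx i)) (x.eps 6) =
      polyQ ω x.eps i (x.f 1) (x.f 2) (x.f 3) * (x.tau 1 * x.tau 2 * x.tau 3) := by
  have h1 := h.two 1 2
  have h2 := h.two 1 3
  have h3 := h.two 2 3
  have h4 := h.three 1 2 3
  rw [lineForm_sPoint_zero h]
  simp only [cubicTheta, polyQ, br2, br3]
  generalize x.eps (jIdx i) = b
  rw [show 2 * x.eps 0 - x.eps 1 - x.eps 2 - x.eps 3 - b - x.eps 6 -
      (x.eps 0 - x.eps 2 - x.eps 3) = x.eps 0 - x.eps 1 - b - x.eps 6 by ring,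
    show 2 * x.eps 0 - x.eps 1 - x.eps 2 - x.eps 3 - b - x.eps 6 -
      (x.eps 0 - x.eps 1 - x.eps 3) = x.eps 0 - x.eps 2 - b - x.eps 6 by ring,
    show 2 * x.eps 0 - x.eps 1 - x.eps 2 - x.eps 3 - b - x.eps 6 -
      (x.eps 0 - x.eps 1 - x.eps 2) = x.eps 0 - x.eps 3 - b - x.eps 6 by ring]
  field_simp
  ring

lemma muWord_explicit {ω : ℂ} (hω : 0 < ω.im) {x : TauPoint} (hx : Regular ω muWord x)
    (i : Fin 10) (hi : i ∈ ({1, 2, 3} : Finset (Fin 10))) :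
    (actPoint ω muWord x).f i =
      polyQ ω x.eps i (x.f 1) (x.f 2) (x.f 3) / polyP ω x.eps i (x.f 1) (x.f 2) (x.f 3) ∧
    (actPoint ω muWord x).tau i * (x.tau 6 * x.tau (jIdx i)) =
      polyP ω x.eps i (x.f 1) (x.f 2) (x.f 3) * (x.tau 1 * x.tau 2 * x.tau 3) := by
  have hn := hx.start
  have hy := hx.finish
  obtain ⟨⟨a1, a2, a3⟩, b1, b2, b3⟩ := muWord_lineTau hω hx
  have t6 := hn.tau 6
  have t1 := hn.tau 1
  have t2 := hn.tau 2
  have t3 := hn.tau 3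
  have key : ∀ i : Fin 10, 0 < i → (hj : 0 < jIdx i) →
      (actPoint ω muWord x).tau i = lineTau ω x 6 (jIdx i) →
      (actPoint ω muWord x).f i * (actPoint ω muWord x).tau i =
        lineForm ω (sPoint ω 0 x) (x.eps (jIdx i)) (x.eps 6) / (x.tau (jIdx i) * x.tau 6) →
      (actPoint ω muWord x).f i =
        polyQ ω x.eps i (x.f 1) (x.f 2) (x.f 3) / polyP ω x.eps i (x.f 1) (x.f 2) (x.f 3) ∧
      (actPoint ω muWord x).tau i * (x.tau 6 * x.tau (jIdx i)) =
        polyP ω x.eps i (x.f 1) (x.f 2) (x.f 3) * (x.tau 1 * x.tau 2 * x.tau 3) := by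
    intro i hi hj h1 h2
    have tj := hn.tau _ hj
    have ty := hy.tau i hi
    have h3 : (actPoint ω muWord x).tau i * (x.tau 6 * x.tau (jIdx i)) =
        polyP ω x.eps i (x.f 1) (x.f 2) (x.f 3) * (x.tau 1 * x.tau 2 * x.tau 3) := by
      rw [h1, lineTau, ← lineForm_eq_polyP]
      field_simp
    refine ⟨?_, h3⟩
    rw [lineForm_eq_polyQ hn, eq_div_iff (mul_ne_zero tj t6)] at h2
    -- Regularity includes the end of the word, so μ(τᵢ) ≠ 0, and this is Pᵢ up to nonzero factors.
    have hP : polyP ω x.eps i (x.f 1) (x.f 2) (x.f 3) ≠ 0 := by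
      intro h0
      rw [h0, zero_mul] at h3
      exact (mul_ne_zero ty (mul_ne_zero t6 tj)) h3
    rw [eq_div_iff hP]
    apply mul_right_cancel₀ (mul_ne_zero (mul_ne_zero t1 t2) t3)
    linear_combination h2 - (actPoint ω muWord x).f i * h3
  simp only [Finset.mem_insert, Finset.mem_singleton] at hi
  have j1 : jIdx 1 = 8 := rfl
  have j2 : jIdx 2 = 5 := rfl
  have j3 : jIdx 3 = 4 := rfl
  rcases hi with rfl | rfl | rfl
  · exact key 1 (by decide) (by decide) (by rw [j1, a1]) (by rw [j1, b1])
  · exact key 2 (by decide) (by decide) (by rw [j2, a2]) (by rw [j2, b2])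
  · exact key 3 (by decide) (by decide) (by rw [j3, a3]) (by rw [j3, b3])

lemma bar7_seven (e : Param) : bar7 e 7 = e 7 + del e := by simp [bar7]

lemma bar7_apply (e : Param) {i : Fin 10} (hi : i ≠ 7) : bar7 e i = e i := by simp [bar7, hi]

/-- The brackets `[ij]` at `μ(ε)`. -/
lemma br2_muWord (ω : ℂ) (e : Param) :
    br2 ω (actParam muWord e) 1 2 = br2 ω e 5 8 ∧
    br2 ω (actParam muWord e) 1 3 = br2 ω e 4 8 ∧
    br2 ω (actParam muWord e) 1 4 = br2 ω e 3 8 ∧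
    br2 ω (actParam muWord e) 1 5 = br2 ω e 2 8 ∧
    br2 ω (actParam muWord e) 1 6 = br3 ω e 6 8 9 ∧
    br2 ω (actParam muWord e) 1 8 = br2 ω e 1 8 ∧
    br2 ω (actParam muWord e) 2 3 = br2 ω e 4 5 ∧
    br2 ω (actParam muWord e) 2 4 = br2 ω e 3 5 ∧
    br2 ω (actParam muWord e) 2 5 = br2 ω e 2 5 ∧
    br2 ω (actParam muWord e) 2 6 = br3 ω e 5 6 9 ∧
    br2 ω (actParam muWord e) 2 8 = br2 ω e 1 5 ∧
    br2 ω (actParam muWord e) 3 4 = br2 ω e 3 4 ∧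
    br2 ω (actParam muWord e) 3 5 = br2 ω e 2 4 ∧
    br2 ω (actParam muWord e) 3 6 = br3 ω e 4 6 9 ∧
    br2 ω (actParam muWord e) 3 8 = br2 ω e 1 4 := by
  rw [actParam_muWord]
  refine ⟨?_, ?_, ?_, ?_, ?_, ?_, ?_, ?_, ?_, ?_, ?_, ?_, ?_, ?_, ?_⟩ <;>
  · simp only [br2, br3]
    apply congrArg
    simp
    try ring

/-- The brackets `[ijk]` at `μ(ε)` in which the index `7` does not occur. -/
lemma br3_muWord (ω : ℂ) (e : Param) :
    br3 ω (actParam muWord e) 1 2 3 = br3 ω e 1 2 3 ∧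
    br3 ω (actParam muWord e) 1 2 4 = br3 ω e 1 2 4 ∧
    br3 ω (actParam muWord e) 1 2 5 = br3 ω e 1 3 4 ∧
    br3 ω (actParam muWord e) 1 2 8 = br3 ω e 2 3 4 ∧
    br3 ω (actParam muWord e) 1 3 4 = br3 ω e 1 2 5 ∧
    br3 ω (actParam muWord e) 1 3 5 = br3 ω e 1 3 5 ∧
    br3 ω (actParam muWord e) 1 3 8 = br3 ω e 2 3 5 ∧
    br3 ω (actParam muWord e) 2 3 4 = br3 ω e 1 2 8 ∧
    br3 ω (actParam muWord e) 2 3 5 = br3 ω e 1 3 8 ∧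
    br3 ω (actParam muWord e) 2 3 8 = br3 ω e 2 3 8 := by
  rw [actParam_muWord]
  refine ⟨?_, ?_, ?_, ?_, ?_, ?_, ?_, ?_, ?_, ?_⟩ <;>
  · simp only [br3]
    apply congrArg
    simp
    try ring

/-- The brackets `[ij6]` at `μ(ε)`. -/
lemma br3_muWord_bar (ω : ℂ) (e : Param) :
    br3 ω (actParam muWord e) 1 2 6 = -br3 ω (bar7 e) 5 7 8 ∧
    br3 ω (actParam muWord e) 1 3 6 = -br3 ω (bar7 e) 4 7 8 ∧
    br3 ω (actParam muWord e) 1 4 6 = -br3 ω (bar7 e) 3 7 8 ∧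
    br3 ω (actParam muWord e) 1 5 6 = -br3 ω (bar7 e) 2 7 8 ∧
    br3 ω (actParam muWord e) 1 8 6 = -br3 ω (bar7 e) 1 7 8 ∧
    br3 ω (actParam muWord e) 2 3 6 = -br3 ω (bar7 e) 4 5 7 ∧
    br3 ω (actParam muWord e) 2 4 6 = -br3 ω (bar7 e) 3 5 7 ∧
    br3 ω (actParam muWord e) 2 5 6 = -br3 ω (bar7 e) 2 5 7 ∧
    br3 ω (actParam muWord e) 2 8 6 = -br3 ω (bar7 e) 1 5 7 ∧
    br3 ω (actParam muWord e) 3 4 6 = -br3 ω (bar7 e) 3 4 7 ∧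
    br3 ω (actParam muWord e) 3 5 6 = -br3 ω (bar7 e) 2 4 7 ∧
    br3 ω (actParam muWord e) 3 8 6 = -br3 ω (bar7 e) 1 4 7 := by
  rw [actParam_muWord]
  have h := del_eq e
  refine ⟨?_, ?_, ?_, ?_, ?_, ?_, ?_, ?_, ?_, ?_, ?_, ?_⟩ <;>
  · unfold br3
    rw [← br_neg]
    apply congrArg
    simp only [h, bar7, Function.update]
    simp
    ring

/-- In T = μμ the second μ is evaluated at the parameters μ(ε). There the brackets [ij6] acquire δ,
which is why 7 appears barred, and change sign, which explains the signs in Rᵢ. -/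
lemma polyP_muWord (ω : ℂ) (e : Param) (i : Fin 10) (hi : i ∈ ({1, 2, 3} : Finset (Fin 10)))
    (a b c : ℂ) : polyP ω (actParam muWord e) i a b c = polyR ω e i a b c := by
  have h1 := br2_muWord ω e
  have h2 := br3_muWord ω e
  have h3 := br3_muWord_bar ω e
  fin_cases hi <;> simp [polyP, polyR, jIdx, h1, h2, h3] <;> ring

lemma polyQ_muWord (ω : ℂ) (e : Param) (i : Fin 10) (hi : i ∈ ({1, 2, 3} : Finset (Fin 10)))
    (a b c : ℂ) : polyQ ω (actParam muWord e) i a b c = polyS ω e i a b c := by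
  have h1 := br2_muWord ω e
  have h2 := br3_muWord ω e
  have h3 := br3_muWord_bar ω e
  fin_cases hi <;> simp [polyQ, polyS, jIdx, aIdx, bIdx, h1, h2, h3] <;> ring

/-- The image of `f₁` under `w = s₂₈₉ s₄₈ s₃₉`. -/
lemma wWord_f_one {ω : ℂ} (hω : 0 < ω.im) {x : TauPoint} (hx : Regular ω wWord x) :
    (actPoint ω wWord x).f 1 = x.tau 8 / x.tau 1 := by
  have hn := hx.start
  have hy := hx.finish
  rw [wWord_eq] at hx hy ⊢
  have r1 := isReflected_289 hω hx.left
  have n1 := hx.left.finish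
  obtain ⟨pe, pt, pl⟩ := actPoint_permWord hω wPerm wPerm_ne_zero _ hx.right
  rw [actPoint_append] at hy ⊢
  generalize actPoint ω (refl3 2 8 9) x = x1 at *
  generalize actPoint ω wPerm x1 = y at *
  simp only [wordPerm_wPerm] at pe pt
  have lt : lineTau ω y 2 3 = lineTau ω x1 2 9 := by
    simp only [lineTau, pe, pt, pl]; rfl
  have h := lineTau_two_three hy
  rw [lt, r1.lineTau_i_k hn n1] at h
  have t1 : y.tau 1 = x.tau 1 := (pt 1).trans (r1.tau 1 (by decide) (by decide) (by decide))
  rw [eq_div_iff (hn.tau 1), h, t1]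

/-! ### The specialisation `f₃ = g₃ = ∞` -/

lemma tendsto_mobius_cobounded (a b : ℂ) {c : ℂ} (d : ℂ) (hc : c ≠ 0) :
    Tendsto (fun z : ℂ => (a * z + b) / (c * z + d)) (Bornology.cobounded ℂ) (𝓝 (a / c)) := by
  have hi : Tendsto (fun z : ℂ => z⁻¹) (Bornology.cobounded ℂ) (𝓝 0) :=
    tendsto_inv₀_cobounded
  have h : Tendsto (fun z : ℂ => (a + b * z⁻¹) / (c + d * z⁻¹)) (Bornology.cobounded ℂ)
      (𝓝 ((a + b * 0) / (c + d * 0))) :=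
    ((hi.const_mul b).const_add a).div ((hi.const_mul d).const_add c) (by simpa using hc)
  simp only [mul_zero, add_zero] at h
  refine h.congr' ?_
  filter_upwards [Bornology.eventually_ne_cobounded (0 : ℂ)] with z hz
  rw [← mul_div_mul_right _ _ hz]
  congr 1 <;> field_simp

lemma tendsto_const_mul_div_cobounded (a σ : ℂ) :
    Tendsto (fun z : ℂ => a * (σ / z)) (Bornology.cobounded ℂ) (𝓝 0) := by
  have hi : Tendsto (fun z : ℂ => z⁻¹) (Bornology.cobounded ℂ) (𝓝 0) :=
    tendsto_inv₀_cobounded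
  simpa [div_eq_mul_inv] using (hi.const_mul σ).const_mul a

/-- The coefficient of `f₃` in `Pᵢ`. -/
def leadP (ω : ℂ) (e : Param) (i : Fin 10) : ℂ :=
  br2 ω e 3 (jIdx i) * br2 ω e 3 6 * br3 ω e 3 (jIdx i) 6 /
    (br2 ω e 1 3 * br2 ω e 2 3 * br3 ω e 1 2 3)

/-- The coefficient of `f₃` in `Qᵢ`. -/
def leadQ (ω : ℂ) (e : Param) (i : Fin 10) (f₁ f₂ : ℂ) : ℂ :=
  br3 ω e 1 3 (jIdx i) * br3 ω e 1 3 6 * br3 ω e 2 (jIdx i) 6 /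
      (br2 ω e 1 2 * br2 ω e 2 3 * br3 ω e 1 2 3) * f₁ -
    br3 ω e 2 3 (jIdx i) * br3 ω e 2 3 6 * br3 ω e 1 (jIdx i) 6 /
      (br2 ω e 1 2 * br2 ω e 1 3 * br3 ω e 1 2 3) * f₂

/-- The coefficient of `g₃` in `Rᵢ`. -/
def leadR (ω : ℂ) (e : Param) (i : Fin 10) : ℂ :=
  -(br2 ω e i 4 * br3 ω e 4 6 9 * br3 ω (bar7 e) i 4 7 /
      (br2 ω e 4 5 * br2 ω e 4 8 * br3 ω e 1 2 3))

/-- The coefficient of `g₃` in `Sᵢ`. -/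
def leadS (ω : ℂ) (e : Param) (i : Fin 10) (g₁ g₂ : ℂ) : ℂ :=
  br3 ω e (aIdx i) (bIdx i) 5 * br3 ω (bar7 e) 4 7 8 * br3 ω (bar7 e) i 5 7 /
      (br2 ω e 4 5 * br2 ω e 5 8 * br3 ω e 1 2 3) * g₁ -
    br3 ω e (aIdx i) (bIdx i) 8 * br3 ω (bar7 e) 4 5 7 * br3 ω (bar7 e) i 7 8 /
      (br2 ω e 4 8 * br2 ω e 5 8 * br3 ω e 1 2 3) * g₂

lemma polyP_eq (ω : ℂ) (e : Param) (i : Fin 10) (f₁ f₂ z : ℂ) :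
    polyP ω e i f₁ f₂ z = leadP ω e i * z + polyP ω e i f₁ f₂ 0 := by
  simp only [polyP, leadP]; ring

lemma polyQ_eq (ω : ℂ) (e : Param) (i : Fin 10) (f₁ f₂ z : ℂ) :
    polyQ ω e i f₁ f₂ z = leadQ ω e i f₁ f₂ * z + polyQ ω e i f₁ f₂ 0 := by
  simp only [polyQ, leadQ]; ring

lemma polyR_eq (ω : ℂ) (e : Param) (i : Fin 10) (g₁ g₂ z : ℂ) :
    polyR ω e i g₁ g₂ z = leadR ω e i * z + polyR ω e i g₁ g₂ 0 := by
  simp only [polyR, leadR]; ring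

lemma polyS_eq (ω : ℂ) (e : Param) (i : Fin 10) (g₁ g₂ z : ℂ) :
    polyS ω e i g₁ g₂ z = leadS ω e i g₁ g₂ * z + polyS ω e i g₁ g₂ 0 := by
  simp only [polyS, leadS]; ring

lemma specG_iff {ω : ℂ} {e : Param} {i : Fin 10} (h : leadP ω e i ≠ 0) (f₁ f₂ g : ℂ) :
    SpecG ω e i f₁ f₂ g ↔ g = leadQ ω e i f₁ f₂ / leadP ω e i := by
  have ht : SpecG ω e i f₁ f₂ (leadQ ω e i f₁ f₂ / leadP ω e i) := by
    refine (tendsto_mobius_cobounded _ (polyQ ω e i f₁ f₂ 0) (polyP ω e i f₁ f₂ 0) h).congr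
      fun z => ?_
    rw [polyQ_eq ω e i f₁ f₂ z, polyP_eq ω e i f₁ f₂ z]
  exact ⟨fun hg => tendsto_nhds_unique hg ht, fun hg => hg ▸ ht⟩

lemma specF_iff {ω : ℂ} {e : Param} {i : Fin 10} (h : leadR ω e i ≠ 0) (g₁ g₂ f : ℂ) :
    SpecF ω e i g₁ g₂ f ↔ f = leadS ω e i g₁ g₂ / leadR ω e i := by
  have ht : SpecF ω e i g₁ g₂ (leadS ω e i g₁ g₂ / leadR ω e i) := by
    refine (tendsto_mobius_cobounded _ (polyS ω e i g₁ g₂ 0) (polyR ω e i g₁ g₂ 0) h).congr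
      fun z => ?_
    rw [polyS_eq ω e i g₁ g₂ z, polyR_eq ω e i g₁ g₂ z]
  exact ⟨fun hg => tendsto_nhds_unique hg ht, fun hg => hg ▸ ht⟩

lemma specStep_iff {ω : ℂ} {e : Param} (hP₁ : leadP ω e 1 ≠ 0) (hP₂ : leadP ω e 2 ≠ 0)
    (hR₁ : leadR ω e 1 ≠ 0) (hR₂ : leadR ω e 2 ≠ 0) (f₁ f₂ h₁ h₂ : ℂ) :
    SpecStep ω e f₁ f₂ h₁ h₂ ↔
      h₁ = leadS ω e 1 (leadQ ω e 1 f₁ f₂ / leadP ω e 1) (leadQ ω e 2 f₁ f₂ / leadP ω e 2) /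
        leadR ω e 1 ∧
      h₂ = leadS ω e 2 (leadQ ω e 1 f₁ f₂ / leadP ω e 1) (leadQ ω e 2 f₁ f₂ / leadP ω e 2) /
        leadR ω e 2 := by
  simp only [SpecStep, specG_iff hP₁, specG_iff hP₂, specF_iff hR₁, specF_iff hR₂]
  constructor
  · rintro ⟨_, _, rfl, rfl, h⟩
    exact h
  · intro h
    exact ⟨_, _, rfl, rfl, h⟩

lemma tendsto_inv_of_lead {p q : ℂ → ℂ} {a b d : ℂ} (hp : ∀ z, p z = d)
    (hq : ∀ z, q z = a * z + b) (ha : a ≠ 0) :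
    Tendsto (fun z : ℂ => (q z / p z)⁻¹) (Bornology.cobounded ℂ) (𝓝 0) := by
  have h := tendsto_mobius_cobounded 0 d b ha
  simpa [hp, hq] using h

/-- Up to a shift (3d, d, …, d), which no bracket sees, T adds δ to ε₇. Genericity at T(ε) therefore
controls the barred brackets. -/
lemma br3_bar7_tWord (ω : ℂ) (e : Param) (i j : Fin 10) (hi : i ≠ 0) (hj : j ≠ 0) (hi6 : i ≠ 6)
    (hj6 : j ≠ 6) (hi7 : i ≠ 7) (hj7 : j ≠ 7) :
    br ω (bar7 e 0 - bar7 e i - bar7 e j - bar7 e 7) =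
      br ω (actParam tWord e 0 - actParam tWord e i - actParam tWord e j -
        actParam tWord e 7) := by
  simp only [actParam_tWord_apply, bar7_seven, bar7_apply e hi7, bar7_apply e hj7, hi, hj, hi6,
    hj6, hi7, hj7, bar7_apply e (show (0 : Fin 10) ≠ 7 by decide), if_false, if_true,
    show (0 : Fin 10) ≠ 7 by decide, show (0 : Fin 10) ≠ 6 by decide,
    show (7 : Fin 10) ≠ 0 by decide]
  congr 1
  ring

lemma specialisation {ω : ℂ} {e : Param} (h34 : br2 ω e 3 4 = 0) (hg : GenericOff ω {(3, 4)} e)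
    (hT : GenericOff ω {(3, 4)} (actParam tWord e)) (f₁ f₂ : ℂ) :
    (∃! h : ℂ × ℂ, SpecStep ω e f₁ f₂ h.1 h.2) ∧
      (∀ σ : ℂ, Tendsto (fun z : ℂ => polyP ω e 3 f₁ f₂ z * (σ / z)) (Bornology.cobounded ℂ) (𝓝 0)) ∧
      (br2 ω e 2 3 * br3 ω e 2 3 4 * br3 ω e 2 3 6 * br3 ω e 1 4 6 * f₂ ≠
          br2 ω e 1 3 * br3 ω e 1 3 4 * br3 ω e 1 3 6 * br3 ω e 2 4 6 * f₁ →
        Tendsto (fun z : ℂ => (polyQ ω e 3 f₁ f₂ z / polyP ω e 3 f₁ f₂ z)⁻¹)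
          (Bornology.cobounded ℂ) (𝓝 0)) ∧
      ∀ g₁ g₂ : ℂ, SpecG ω e 1 f₁ f₂ g₁ → SpecG ω e 2 f₁ f₂ g₂ →
        (∀ σ : ℂ, Tendsto (fun z : ℂ => polyR ω e 3 g₁ g₂ z * (σ / z))
          (Bornology.cobounded ℂ) (𝓝 0)) ∧
        (br2 ω e 4 5 * br3 ω e 1 2 8 * br3 ω (bar7 e) 4 5 7 * br3 ω (bar7 e) 3 7 8 * g₂ ≠
            br2 ω e 4 8 * br3 ω e 1 2 5 * br3 ω (bar7 e) 4 7 8 * br3 ω (bar7 e) 3 5 7 * g₁ →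
          Tendsto (fun z : ℂ => (polyS ω e 3 g₁ g₂ z / polyR ω e 3 g₁ g₂ z)⁻¹)
            (Bornology.cobounded ℂ) (𝓝 0)) := by
  have two : ∀ i j : Fin 10, 0 < i → 0 < j → i ≠ j → ¬ (i = 3 ∧ j = 4) → ¬ (j = 3 ∧ i = 4) →
      br2 ω e i j ≠ 0 := fun i j hi hj hij h1 h2 =>
    hg.two i j hi hj hij (by simpa using h1) (by simpa using h2)
  have three : ∀ i j k : Fin 10, 0 < i → 0 < j → 0 < k → i ≠ j → i ≠ k → j ≠ k →
      br3 ω e i j k ≠ 0 := hg.three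
  have bar : ∀ i j : Fin 10, 0 < i → 0 < j → i ≠ 6 → j ≠ 6 → i ≠ 7 → j ≠ 7 → i ≠ j →
      br3 ω (bar7 e) i j 7 ≠ 0 := by
    intro i j hi hj hi6 hj6 hi7 hj7 hij
    unfold br3
    rw [br3_bar7_tWord ω e i j hi.ne' hj.ne' hi6 hj6 hi7 hj7]
    exact hT.three i j 7 hi hj (by decide) hij hi7 hj7
  have d12 := two 1 2 (by decide) (by decide) (by decide) (by decide) (by decide)
  have d13 := two 1 3 (by decide) (by decide) (by decide) (by decide) (by decide)
  have d23 := two 2 3 (by decide) (by decide) (by decide) (by decide) (by decide)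
  have d45 := two 4 5 (by decide) (by decide) (by decide) (by decide) (by decide)
  have d48 := two 4 8 (by decide) (by decide) (by decide) (by decide) (by decide)
  have d58 := two 5 8 (by decide) (by decide) (by decide) (by decide) (by decide)
  have d123 := three 1 2 3 (by decide) (by decide) (by decide) (by decide) (by decide) (by decide)
  have hP : ∀ i ∈ ({1, 2} : Finset (Fin 10)), leadP ω e i ≠ 0 := by
    intro i hi
    refine div_ne_zero (mul_ne_zero (mul_ne_zero (two _ _ ?_ ?_ ?_ ?_ ?_)
      (two _ _ ?_ ?_ ?_ ?_ ?_)) (three _ _ _ ?_ ?_ ?_ ?_ ?_ ?_))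
      (mul_ne_zero (mul_ne_zero d13 d23) d123) <;> (revert i; decide)
  have hR : ∀ i ∈ ({1, 2} : Finset (Fin 10)), leadR ω e i ≠ 0 := by
    intro i hi
    refine neg_ne_zero.mpr (div_ne_zero (mul_ne_zero (mul_ne_zero (two _ _ ?_ ?_ ?_ ?_ ?_)
      (three _ _ _ ?_ ?_ ?_ ?_ ?_ ?_)) (bar _ _ ?_ ?_ ?_ ?_ ?_ ?_ ?_))
      (mul_ne_zero (mul_ne_zero d45 d48) d123)) <;> (revert i; decide)
  -- As j = 4 for i = 3, the coefficient of f₃ in P₃ contains [34]; so does the coefficient of g₃ in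
  -- R₃. The third components thus become infinite while the first two keep nonzero leading
  -- denominators.
  have hP3 : leadP ω e 3 = 0 := by
    have : br2 ω e 3 (jIdx 3) = 0 := h34
    simp [leadP, this]
  have hR3 : leadR ω e 3 = 0 := by simp [leadR, h34]
  have eP : ∀ z, polyP ω e 3 f₁ f₂ z = polyP ω e 3 f₁ f₂ 0 := fun z => by
    rw [polyP_eq, hP3, zero_mul, zero_add]
  refine ⟨?_, fun σ => ?_, fun hne => ?_, fun g₁ g₂ _ _ => ⟨fun σ => ?_, fun hne => ?_⟩⟩
  · simp only [specStep_iff (hP 1 (by decide)) (hP 2 (by decide)) (hR 1 (by decide))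
      (hR 2 (by decide))]
    exact ⟨(_, _), ⟨rfl, rfl⟩, fun y hy => Prod.ext hy.1 hy.2⟩
  · simp only [eP]
    exact tendsto_const_mul_div_cobounded _ _
  · refine tendsto_inv_of_lead eP (polyQ_eq ω e 3 f₁ f₂) fun h0 => hne ?_
    have j3 : jIdx 3 = 4 := rfl
    rw [leadQ, j3] at h0
    field_simp at h0
    linear_combination -h0
  · have eR : ∀ z, polyR ω e 3 g₁ g₂ z = polyR ω e 3 g₁ g₂ 0 := fun z => by
      rw [polyR_eq, hR3, zero_mul, zero_add]
    simp only [eR]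
    exact tendsto_const_mul_div_cobounded _ _
  · have eR : ∀ z, polyR ω e 3 g₁ g₂ z = polyR ω e 3 g₁ g₂ 0 := fun z => by
      rw [polyR_eq, hR3, zero_mul, zero_add]
    refine tendsto_inv_of_lead eR (polyS_eq ω e 3 g₁ g₂) fun h0 => hne ?_
    have a3 : aIdx 3 = 1 := rfl
    have b3 : bIdx 3 = 2 := rfl
    rw [leadS, a3, b3] at h0
    field_simp at h0
    linear_combination -h0

/-! ### One step of the specialised equation in linear form -/

/-- The bracket `[s-x-y-z]`. -/
def tri (ω s x y z : ℂ) : ℂ := br ω (s - x - y - z)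

section

variable {ω s t p₁ p₂ p₃ p₄ p₅ z z' : ℂ}

/-- With z and z' exchanged, this evaluates the determinant needed to invert `MuRel` by Cramer's
rule. The balancing condition is the definition of δ for ε₈ = ε₉. -/
lemma tri_identity_points (hω : 0 < ω.im)
    (h : z + z' + p₁ + p₂ + p₃ + p₄ + p₅ + 2 * t = 3 * s) :
    br ω (p₄ - t) * tri ω s p₁ p₅ t * tri ω s p₃ p₅ z * tri ω s p₂ p₅ z' -
      br ω (p₅ - t) * tri ω s p₁ p₄ t * tri ω s p₃ p₄ z * tri ω s p₂ p₄ z' =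
    br ω (p₄ - p₅) * tri ω s p₃ z t * tri ω s p₁ t t * tri ω s p₂ z' t := by
  have T := br_pf_three hω p₄ p₅ t (s - t - p₁) (s - p₃ - z) (s - p₂ - z')
    (by linear_combination h)
  unfold tri
  rw [br_sub_comm ω t p₄,
    show p₄ - (s - t - p₁) = -(s - p₁ - p₄ - t) by ring,
    show p₄ - (s - p₃ - z) = -(s - p₃ - p₄ - z) by ring,
    show p₄ - (s - p₂ - z') = -(s - p₂ - p₄ - z') by ring,
    show p₅ - (s - t - p₁) = -(s - p₁ - p₅ - t) by ring,
    show p₅ - (s - p₃ - z) = -(s - p₃ - p₅ - z) by ring,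
    show p₅ - (s - p₂ - z') = -(s - p₂ - p₅ - z') by ring,
    show t - (s - t - p₁) = -(s - p₁ - t - t) by ring,
    show t - (s - p₃ - z) = -(s - p₃ - z - t) by ring,
    show t - (s - p₂ - z') = -(s - p₂ - z' - t) by ring] at T
  simp only [br_neg] at T
  linear_combination T

/-- Gives the coefficient of f₂ in `MuRel.step`. -/
lemma tri_identity_shift (hω : 0 < ω.im)
    (h : z + z' + p₁ + p₂ + p₃ + p₄ + p₅ + 2 * t = 3 * s) :
    tri ω s p₄ z' t * tri ω s p₃ p₄ z * tri ω s p₃ p₅ z' * tri ω s p₅ z t -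
      tri ω s p₅ z' t * tri ω s p₃ p₅ z * tri ω s p₃ p₄ z' * tri ω s p₄ z t =
    -(br ω (p₃ - t) * br ω (p₄ - p₅) * br ω (z' - z) * tri ω s p₁ p₂ t) := by
  have T := br_pf_three hω z' z (s - t - p₅) (s - p₃ - p₅) (s - t - p₄)
    (z + z' - s + p₃ + p₄) (by ring)
  unfold tri
  rw [show z' - (s - p₃ - p₅) = -(s - p₃ - p₅ - z') by ring,
    show z' - (s - t - p₄) = -(s - p₄ - z' - t) by ring,
    show z' - (z + z' - s + p₃ + p₄) = s - p₃ - p₄ - z by ring,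
    show z - (s - p₃ - p₅) = -(s - p₃ - p₅ - z) by ring,
    show z - (s - t - p₄) = -(s - p₄ - z - t) by ring,
    show z - (z + z' - s + p₃ + p₄) = s - p₃ - p₄ - z' by ring,
    show s - t - p₅ - (s - p₃ - p₅) = p₃ - t by ring,
    show s - t - p₅ - (s - t - p₄) = p₄ - p₅ by ring,
    show s - t - p₅ - (z + z' - s + p₃ + p₄) = -(s - p₁ - p₂ - t) by linear_combination -h,
    show z - (s - t - p₅) = -(s - p₅ - z - t) by ring,
    show s - t - p₅ - z' = s - p₅ - z' - t by ring] at T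
  simp only [br_neg] at T
  linear_combination -T

/-- Gives the coefficient of f₁ in `MuRel.step`; the four-point identity is needed because the
brackets of both half-steps enter. -/
lemma tri_identity_four (hω : 0 < ω.im)
    (h : z + z' + p₁ + p₂ + p₃ + p₄ + p₅ + 2 * t = 3 * s) :
    tri ω s z t t * (br ω (p₅ - t) * tri ω s p₄ z' t * tri ω s p₃ p₄ z * tri ω s p₁ p₄ t *
        tri ω s p₂ p₄ z * tri ω s p₅ z t -
      br ω (p₄ - t) * tri ω s p₅ z' t * tri ω s p₃ p₅ z * tri ω s p₁ p₅ t *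
        tri ω s p₂ p₅ z * tri ω s p₄ z t) =
    br ω (p₄ - p₅) * (br ω (z' - z) * br ω (p₁ - z) * br ω (p₂ - t) * br ω (p₃ - t) *
        br ω (p₄ - t) * br ω (p₅ - t) -
      tri ω s z' t t * tri ω s p₁ t t * tri ω s p₂ z t * tri ω s p₃ z t * tri ω s p₄ z t *
        tri ω s p₅ z t) := by
  have T := br_pf_four hω p₄ p₅ t (s - t - z) (s - z' - t) (s - p₁ - t) (s - p₃ - z)
    (s - p₂ - z) (by linear_combination h)
  unfold pfFour at T
  unfold tri
  rw [show p₄ - (s - z' - t) = -(s - p₄ - z' - t) by ring,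
    show p₄ - (s - p₁ - t) = -(s - p₁ - p₄ - t) by ring,
    show p₄ - (s - p₃ - z) = -(s - p₃ - p₄ - z) by ring,
    show p₄ - (s - p₂ - z) = -(s - p₂ - p₄ - z) by ring,
    show p₅ - (s - z' - t) = -(s - p₅ - z' - t) by ring,
    show p₅ - (s - p₁ - t) = -(s - p₁ - p₅ - t) by ring,
    show p₅ - (s - p₃ - z) = -(s - p₃ - p₅ - z) by ring,
    show p₅ - (s - p₂ - z) = -(s - p₂ - p₅ - z) by ring,
    show t - (s - z' - t) = -(s - z' - t - t) by ring,
    show t - (s - p₁ - t) = -(s - p₁ - t - t) by ring,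
    show t - (s - p₃ - z) = -(s - p₃ - z - t) by ring,
    show t - (s - p₂ - z) = -(s - p₂ - z - t) by ring,
    show s - t - z - (s - z' - t) = z' - z by ring,
    show s - t - z - (s - p₁ - t) = p₁ - z by ring,
    show s - t - z - (s - p₃ - z) = p₃ - t by ring,
    show s - t - z - (s - p₂ - z) = p₂ - t by ring,
    show p₄ - (s - t - z) = -(s - p₄ - z - t) by ring,
    show p₅ - (s - t - z) = -(s - p₅ - z - t) by ring,
    show t - (s - t - z) = -(s - z - t - t) by ring] at T
  simp only [br_neg] at T
  linear_combination T

/-- Gives the coefficient of Φ that is left when the second component is eliminated in `phiRel_iff`.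
-/
lemma tri_identity_final (hω : 0 < ω.im) (x y : ℂ) :
    br ω (y - t) * tri ω s y t t * tri ω s p₁ x t * br ω (p₁ - x) -
      br ω (x - t) * tri ω s x t t * tri ω s p₁ y t * br ω (p₁ - y) =
    br ω (y - x) * tri ω s p₁ t t * tri ω s x y t * br ω (p₁ - t) := by
  have T := br_pf_three hω x y t p₁ (s - t - p₁) (x + y + 2 * t - s) (by ring)
  unfold tri
  rw [br_sub_comm ω t x, br_sub_comm ω x y,
    br_sub_comm ω x p₁, br_sub_comm ω y p₁, br_sub_comm ω t p₁,
    show x - (s - t - p₁) = -(s - p₁ - x - t) by ring,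
    show y - (s - t - p₁) = -(s - p₁ - y - t) by ring,
    show t - (s - t - p₁) = -(s - p₁ - t - t) by ring,
    show x - (x + y + 2 * t - s) = s - y - t - t by ring,
    show y - (x + y + 2 * t - s) = s - x - t - t by ring,
    show t - (x + y + 2 * t - s) = s - x - y - t by ring] at T
  simp only [br_neg] at T
  linear_combination T

/-- The linear relation between `(f₁, f₂)` and `g = μ(f)` at `f₃ = g₃ = ∞`, for the parameters
`w(ε)`; here `z = ε₆` and `z' = ε₇ + δ`. -/
def MuRel (ω s t p₁ p₂ p₃ p₄ p₅ z z' f₁ f₂ g₁ g₂ : ℂ) : Prop :=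
  g₁ * (tri ω s p₁ t t * tri ω s p₂ p₄ t * tri ω s p₂ z t * tri ω s p₄ z t) =
    tri ω s p₁ p₄ t * tri ω s p₁ z t * tri ω s p₂ p₄ z * tri ω s p₁ p₂ t * f₁ -
      br ω (p₄ - t) * br ω (z - t) * tri ω s p₃ p₅ z' * br ω (p₂ - t) * f₂ ∧
  g₂ * (tri ω s p₁ t t * tri ω s p₂ p₅ t * tri ω s p₂ z t * tri ω s p₅ z t) =
    tri ω s p₁ p₅ t * tri ω s p₁ z t * tri ω s p₂ p₅ z * tri ω s p₁ p₂ t * f₁ -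
      br ω (p₅ - t) * br ω (z - t) * tri ω s p₃ p₄ z' * br ω (p₂ - t) * f₂

/-- The first component of the inverse of `MuRel`. -/
def MuInvFst (ω s t p₁ p₂ p₃ p₄ p₅ z z' f₁ g₁ g₂ : ℂ) : Prop :=
  f₁ * (br ω (p₄ - p₅) * tri ω s p₁ p₂ t * tri ω s p₃ z' t * tri ω s p₁ z t) =
    br ω (p₄ - t) * tri ω s p₅ z t * tri ω s p₃ p₅ z' * tri ω s p₂ p₅ t * g₂ -
      br ω (p₅ - t) * tri ω s p₄ z t * tri ω s p₃ p₄ z' * tri ω s p₂ p₄ t * g₁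

/-- The second component of the inverse of `MuRel`. -/
def MuInvSnd (ω s t p₁ p₂ p₃ p₄ p₅ z z' f₂ g₁ g₂ : ℂ) : Prop :=
  f₂ * (br ω (p₄ - p₅) * br ω (p₂ - t) * tri ω s p₃ z' t * br ω (z - t)) =
    tri ω s p₁ p₄ t * tri ω s p₅ z t * tri ω s p₂ p₄ z * tri ω s p₂ p₅ t * g₂ -
      tri ω s p₁ p₅ t * tri ω s p₄ z t * tri ω s p₂ p₅ z * tri ω s p₂ p₄ t * g₁

/-- The relation between `f₁, f₂` and `T(f₁)`. -/
def StepRel (ω s t p₁ p₂ p₃ p₄ p₅ z z' f₁ f₂ h₁ : ℂ) : Prop :=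
  (h₁ * tri ω s p₁ z' t * tri ω s z t t - tri ω s p₁ z t * tri ω s z' t t * f₁) *
      (tri ω s p₁ t t * tri ω s p₂ z t * tri ω s p₃ z t * tri ω s p₄ z t * tri ω s p₅ z t) =
    -(br ω (z' - z) * br ω (p₂ - t) * br ω (p₃ - t) * br ω (p₄ - t) * br ω (p₅ - t) *
      (tri ω s p₁ z t * br ω (p₁ - z) * f₁ + br ω (z - t) * tri ω s z t t * f₂))

variable {f₁ f₂ g₁ g₂ h₁ h₂ : ℂ}

lemma MuRel.fst (hω : 0 < ω.im) (h : z + z' + p₁ + p₂ + p₃ + p₄ + p₅ + 2 * t = 3 * s)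
    (hr : MuRel ω s t p₁ p₂ p₃ p₄ p₅ z z' f₁ f₂ g₁ g₂) (n₁ : tri ω s p₁ t t ≠ 0)
    (n₂ : tri ω s p₂ z t ≠ 0) : MuInvFst ω s t p₁ p₂ p₃ p₄ p₅ z z' f₁ g₁ g₂ := by
  have h' : z' + z + p₁ + p₂ + p₃ + p₄ + p₅ + 2 * t = 3 * s := by linear_combination h
  have T := tri_identity_points hω h'
  obtain ⟨r1, r2⟩ := hr
  unfold MuInvFst
  apply mul_right_cancel₀ (mul_ne_zero n₁ n₂)
  linear_combination br ω (p₅ - t) * tri ω s p₃ p₄ z' * r1 -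
    br ω (p₄ - t) * tri ω s p₃ p₅ z' * r2 -
    tri ω s p₁ z t * tri ω s p₁ p₂ t * f₁ * T

lemma MuRel.of_inv (hω : 0 < ω.im) (h : z + z' + p₁ + p₂ + p₃ + p₄ + p₅ + 2 * t = 3 * s)
    (h₁ : MuInvFst ω s t p₁ p₂ p₃ p₄ p₅ z z' f₁ g₁ g₂)
    (h₂ : MuInvSnd ω s t p₁ p₂ p₃ p₄ p₅ z z' f₂ g₁ g₂) (n₁ : br ω (p₄ - p₅) ≠ 0)
    (n₂ : tri ω s p₃ z' t ≠ 0) : MuRel ω s t p₁ p₂ p₃ p₄ p₅ z z' f₁ f₂ g₁ g₂ := by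
  have h' : z' + z + p₁ + p₂ + p₃ + p₄ + p₅ + 2 * t = 3 * s := by linear_combination h
  have T := tri_identity_points hω h'
  unfold MuInvFst at h₁
  unfold MuInvSnd at h₂
  constructor
  · apply mul_right_cancel₀ (mul_ne_zero n₁ n₂)
    linear_combination -tri ω s p₁ p₄ t * tri ω s p₂ p₄ z * h₁ +
      br ω (p₄ - t) * tri ω s p₃ p₅ z' * h₂ - g₁ * tri ω s p₂ p₄ t * tri ω s p₄ z t * T
  · apply mul_right_cancel₀ (mul_ne_zero n₁ n₂)
    linear_combination -tri ω s p₁ p₅ t * tri ω s p₂ p₅ z * h₁ +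
      br ω (p₅ - t) * tri ω s p₃ p₄ z' * h₂ - g₂ * tri ω s p₂ p₅ t * tri ω s p₅ z t * T

lemma MuRel.step (hω : 0 < ω.im) (h : z + z' + p₁ + p₂ + p₃ + p₄ + p₅ + 2 * t = 3 * s)
    (hr : MuRel ω s t p₁ p₂ p₃ p₄ p₅ z z' f₁ f₂ g₁ g₂)
    (hi : MuInvFst ω s t p₁ p₂ p₃ p₄ p₅ z' z h₁ g₁ g₂) (n₁ : br ω (p₄ - p₅) ≠ 0)
    (n₂ : tri ω s p₁ p₂ t ≠ 0) : StepRel ω s t p₁ p₂ p₃ p₄ p₅ z z' f₁ f₂ h₁ := by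
  have T := tri_identity_shift hω h
  have T4 := tri_identity_four hω h
  obtain ⟨r1, r2⟩ := hr
  unfold MuInvFst at hi
  unfold StepRel
  apply mul_right_cancel₀ (mul_ne_zero n₁ n₂)
  linear_combination
    (tri ω s p₁ t t * tri ω s p₂ z t * tri ω s p₄ z t * tri ω s p₅ z t * tri ω s z t t) * hi +
    (br ω (p₄ - t) * tri ω s p₅ z' t * tri ω s p₃ p₅ z * tri ω s p₄ z t * tri ω s z t t) * r2 -
    (br ω (p₅ - t) * tri ω s p₄ z' t * tri ω s p₃ p₄ z * tri ω s p₅ z t * tri ω s z t t) * r1 -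
    (tri ω s p₁ z t * tri ω s p₁ p₂ t * f₁) * T4 +
    (br ω (p₂ - t) * br ω (p₄ - t) * br ω (p₅ - t) * br ω (z - t) * tri ω s z t t * f₂) * T

end

/-- The brackets `[ij]` at `w(ε)`, for `ε₈ = ε₉`. -/
lemma br2_wWord (ω : ℂ) {e : Param} (h : e 8 = e 9) :
    br2 ω (actParam wWord e) 3 8 = tri ω (e 0) (e 2) (e 4) (e 9) ∧
    br2 ω (actParam wWord e) 3 5 = tri ω (e 0) (e 2) (e 5) (e 9) ∧
    br2 ω (actParam wWord e) 3 6 = tri ω (e 0) (e 2) (e 6) (e 9) ∧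
    br2 ω (actParam wWord e) 1 3 = -tri ω (e 0) (e 1) (e 2) (e 9) ∧
    br2 ω (actParam wWord e) 2 3 = br ω (e 2 - e 9) ∧
    br2 ω (actParam wWord e) 1 2 = -tri ω (e 0) (e 1) (e 9) (e 9) ∧
    br2 ω (actParam wWord e) 1 4 = -tri ω (e 0) (e 1) (e 2) (e 9) ∧
    br2 ω (actParam wWord e) 2 4 = br ω (e 2 - e 9) ∧
    br2 ω (actParam wWord e) 4 5 = tri ω (e 0) (e 2) (e 5) (e 9) ∧
    br2 ω (actParam wWord e) 4 8 = tri ω (e 0) (e 2) (e 4) (e 9) ∧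
    br2 ω (actParam wWord e) 5 8 = -br ω (e 4 - e 5) := by
  rw [actParam_wWord]
  refine ⟨?_, ?_, ?_, ?_, ?_, ?_, ?_, ?_, ?_, ?_, ?_⟩ <;> simp only [br2, tri]
  all_goals
    try rw [← br_neg]
    apply congrArg
    simp [h]
    try ring

/-- The brackets `[ijk]` at `w(ε)`, for `ε₈ = ε₉`. -/
lemma br3_wWord (ω : ℂ) {e : Param} (h : e 8 = e 9) :
    br3 ω (actParam wWord e) 3 8 6 = tri ω (e 0) (e 4) (e 6) (e 9) ∧
    br3 ω (actParam wWord e) 3 5 6 = tri ω (e 0) (e 5) (e 6) (e 9) ∧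
    br3 ω (actParam wWord e) 1 2 3 = -br ω (e 1 - e 9) ∧
    br3 ω (actParam wWord e) 1 3 8 = tri ω (e 0) (e 1) (e 4) (e 9) ∧
    br3 ω (actParam wWord e) 1 3 5 = tri ω (e 0) (e 1) (e 5) (e 9) ∧
    br3 ω (actParam wWord e) 1 3 6 = tri ω (e 0) (e 1) (e 6) (e 9) ∧
    br3 ω (actParam wWord e) 2 8 6 = tri ω (e 0) (e 2) (e 4) (e 6) ∧
    br3 ω (actParam wWord e) 2 5 6 = tri ω (e 0) (e 2) (e 5) (e 6) ∧
    br3 ω (actParam wWord e) 2 3 8 = -br ω (e 4 - e 9) ∧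
    br3 ω (actParam wWord e) 2 3 5 = -br ω (e 5 - e 9) ∧
    br3 ω (actParam wWord e) 2 3 6 = -br ω (e 6 - e 9) ∧
    br3 ω (actParam wWord e) 1 8 6 = -tri ω (e 0) (e 3) (e 5) (e 7 + del e) ∧
    br3 ω (actParam wWord e) 1 5 6 = -tri ω (e 0) (e 3) (e 4) (e 7 + del e) ∧
    br3 ω (actParam wWord e) 4 6 9 = tri ω (e 0) (e 3) (e 6) (e 9) := by
  have hd := del_eq e
  rw [actParam_wWord]
  refine ⟨?_, ?_, ?_, ?_, ?_, ?_, ?_, ?_, ?_, ?_, ?_, ?_, ?_, ?_⟩ <;> simp only [br3, tri]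
  all_goals
    try rw [← br_neg]
    apply congrArg
    simp [h, hd]
    ring

/-- The brackets with a barred index at `w(ε)`, for `ε₈ = ε₉`. -/
lemma br3_bar7_wWord (ω : ℂ) {e : Param} (h : e 8 = e 9) :
    br3 ω (bar7 (actParam wWord e)) 1 4 7 = tri ω (e 0) (e 1) (e 7 + del e) (e 9) ∧
    br3 ω (bar7 (actParam wWord e)) 2 4 7 = -br ω (e 7 + del e - e 9) ∧
    br3 ω (bar7 (actParam wWord e)) 4 7 8 = tri ω (e 0) (e 4) (e 7 + del e) (e 9) ∧
    br3 ω (bar7 (actParam wWord e)) 4 5 7 = tri ω (e 0) (e 5) (e 7 + del e) (e 9) ∧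
    br3 ω (bar7 (actParam wWord e)) 1 5 7 = -tri ω (e 0) (e 3) (e 4) (e 6) ∧
    br3 ω (bar7 (actParam wWord e)) 1 7 8 = -tri ω (e 0) (e 3) (e 5) (e 6) ∧
    br3 ω (bar7 (actParam wWord e)) 2 5 7 = tri ω (e 0) (e 2) (e 5) (e 7 + del e) ∧
    br3 ω (bar7 (actParam wWord e)) 2 7 8 = tri ω (e 0) (e 2) (e 4) (e 7 + del e) := by
  have hd := del_eq e
  have hw := del_eq (actParam wWord e)
  refine ⟨?_, ?_, ?_, ?_, ?_, ?_, ?_, ?_⟩ <;> simp only [br3, tri]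
  all_goals
    try rw [← br_neg]
    apply congrArg
    simp only [bar7, Function.update, hw]
    rw [actParam_wWord]
    simp [h, hd]
    try ring

/-! ### The specialised step as a pair of linear relations -/

/-- The brackets by which one divides in the step from `ε` to `T(ε)`. -/
structure StepGeneric (ω s t p₁ p₂ p₃ p₄ p₅ z z' : ℂ) : Prop where
  n₁ : br ω (p₁ - t) ≠ 0
  n₂ : br ω (p₂ - t) ≠ 0
  n₃ : br ω (p₃ - t) ≠ 0
  n₄ : br ω (p₄ - t) ≠ 0
  n₅ : br ω (p₅ - t) ≠ 0
  n' : br ω (z' - t) ≠ 0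
  m₁ : tri ω s p₁ t t ≠ 0
  m : tri ω s z t t ≠ 0
  m' : tri ω s z' t t ≠ 0
  k₁₂ : tri ω s p₁ p₂ t ≠ 0
  k₂₄ : tri ω s p₂ p₄ t ≠ 0
  k₂₅ : tri ω s p₂ p₅ t ≠ 0
  k₁ : tri ω s p₁ z t ≠ 0
  k₂ : tri ω s p₂ z t ≠ 0
  k₃ : tri ω s p₃ z t ≠ 0
  k₄ : tri ω s p₄ z t ≠ 0
  k₅ : tri ω s p₅ z t ≠ 0
  k₁' : tri ω s p₁ z' t ≠ 0
  b₄₅ : br ω (p₄ - p₅) ≠ 0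
  b : br ω (z' - z) ≠ 0

section

variable {ω s t p₁ p₂ p₃ p₄ p₅ z z' f₁ f₂ h₁ h₂ : ℂ}

/-- The second half-step inverts the first one with z and z' exchanged. Reading the whole step
backwards therefore gives a step of the same shape, and each direction supplies one `StepRel`. -/
lemma exists_muRel_iff (hω : 0 < ω.im) (h : z + z' + p₁ + p₂ + p₃ + p₄ + p₅ + 2 * t = 3 * s)
    (hs : StepGeneric ω s t p₁ p₂ p₃ p₄ p₅ z z') :
    (∃ g₁ g₂, MuRel ω s t p₁ p₂ p₃ p₄ p₅ z z' f₁ f₂ g₁ g₂ ∧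
      MuInvFst ω s t p₁ p₂ p₃ p₄ p₅ z' z h₁ g₁ g₂ ∧
      MuInvSnd ω s t p₁ p₂ p₃ p₄ p₅ z' z h₂ g₁ g₂) ↔
    StepRel ω s t p₁ p₂ p₃ p₄ p₅ z z' f₁ f₂ h₁ ∧
      StepRel ω s t p₁ p₂ p₃ p₄ p₅ z' z h₁ h₂ f₁ := by
  have h' : z' + z + p₁ + p₂ + p₃ + p₄ + p₅ + 2 * t = 3 * s := by linear_combination h
  have key : ∀ {g₁ g₂ h₁ h₂ : ℂ}, MuRel ω s t p₁ p₂ p₃ p₄ p₅ z z' f₁ f₂ g₁ g₂ →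
      MuInvFst ω s t p₁ p₂ p₃ p₄ p₅ z' z h₁ g₁ g₂ →
      MuInvSnd ω s t p₁ p₂ p₃ p₄ p₅ z' z h₂ g₁ g₂ →
      StepRel ω s t p₁ p₂ p₃ p₄ p₅ z z' f₁ f₂ h₁ ∧
        StepRel ω s t p₁ p₂ p₃ p₄ p₅ z' z h₁ h₂ f₁ := by
    intro g₁ g₂ h₁ h₂ hr hi₁ hi₂
    exact ⟨hr.step hω h hi₁ hs.b₄₅ hs.k₁₂, (MuRel.of_inv hω h' hi₁ hi₂ hs.b₄₅ hs.k₃).step hω h'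
      (hr.fst hω h hs.m₁ hs.k₂) hs.b₄₅ hs.k₁₂⟩
  constructor
  · rintro ⟨g₁, g₂, hr, hi₁, hi₂⟩
    exact key hr hi₁ hi₂
  · rintro ⟨e₁, e₂⟩
    have d₁ := mul_ne_zero (mul_ne_zero (mul_ne_zero hs.m₁ hs.k₂₄) hs.k₂) hs.k₄
    have d₂ := mul_ne_zero (mul_ne_zero (mul_ne_zero hs.m₁ hs.k₂₅) hs.k₂) hs.k₅
    have d₃ := mul_ne_zero (mul_ne_zero (mul_ne_zero hs.b₄₅ hs.k₁₂) hs.k₃) hs.k₁'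
    have d₄ := mul_ne_zero (mul_ne_zero (mul_ne_zero hs.b₄₅ hs.n₂) hs.k₃) hs.n'
    obtain ⟨g₁, g₂, hr⟩ : ∃ g₁ g₂, MuRel ω s t p₁ p₂ p₃ p₄ p₅ z z' f₁ f₂ g₁ g₂ :=
      ⟨_, _, div_mul_cancel₀ _ d₁, div_mul_cancel₀ _ d₂⟩
    obtain ⟨k₁, hi₁⟩ : ∃ k, MuInvFst ω s t p₁ p₂ p₃ p₄ p₅ z' z k g₁ g₂ :=
      ⟨_, div_mul_cancel₀ _ d₃⟩
    obtain ⟨k₂, hi₂⟩ : ∃ k, MuInvSnd ω s t p₁ p₂ p₃ p₄ p₅ z' z k g₁ g₂ :=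
      ⟨_, div_mul_cancel₀ _ d₄⟩
    -- The true image (k₁, k₂) satisfies the same two relations as (h₁, h₂). The first relation
    -- determines the first component, and the second then determines the other.
    obtain ⟨e₁', e₂'⟩ := key hr hi₁ hi₂
    unfold StepRel at e₁ e₂ e₁' e₂'
    have hk₁ : k₁ = h₁ := by
      have := mul_ne_zero (mul_ne_zero hs.k₁' hs.m)
        (mul_ne_zero (mul_ne_zero (mul_ne_zero (mul_ne_zero hs.m₁ hs.k₂) hs.k₃) hs.k₄) hs.k₅)
      apply mul_right_cancel₀ this
      linear_combination e₁' - e₁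
    subst hk₁
    have hk₂ : k₂ = h₂ := by
      have hb : br ω (z - z') ≠ 0 := br_ne_zero_comm hs.b
      have := mul_ne_zero (mul_ne_zero (mul_ne_zero (mul_ne_zero (mul_ne_zero hb hs.n₂) hs.n₃)
        hs.n₄) hs.n₅) (mul_ne_zero hs.n' hs.m')
      apply mul_right_cancel₀ this
      linear_combination e₂' - e₂
    subst hk₂
    exact ⟨g₁, g₂, hr, hi₁, hi₂⟩

end

lemma specStep_wWord_iff {ω : ℂ} (hω : 0 < ω.im) {e : Param} (h : e 8 = e 9)
    (hs : StepGeneric ω (e 0) (e 9) (e 1) (e 2) (e 3) (e 4) (e 5) (e 6) (e 7 + del e))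
    (f₁ f₂ h₁ h₂ : ℂ) :
    SpecStep ω (actParam wWord e) f₁ f₂ h₁ h₂ ↔
      StepRel ω (e 0) (e 9) (e 1) (e 2) (e 3) (e 4) (e 5) (e 6) (e 7 + del e) f₁ f₂ h₁ ∧
      StepRel ω (e 0) (e 9) (e 1) (e 2) (e 3) (e 4) (e 5) (e 7 + del e) (e 6) h₁ h₂ f₁ := by
  rw [← exists_muRel_iff hω (by rw [del_eq, h]; ring) hs]
  obtain ⟨a38, a35, a36, a13, a23, a12, a14, a24, a45, a48, a58⟩ := br2_wWord ω h
  obtain ⟨c386, c356, c123, c138, c135, c136, c286, c256, c238, c235, c236, c186, c156, c469⟩ :=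
    br3_wWord ω h
  obtain ⟨d147, d247, d478, d457, d157, d178, d257, d278⟩ := br3_bar7_wWord ω h
  have hn₁ := hs.n₁
  have hn₂ := hs.n₂
  have hn' := hs.n'
  have hm₁ := hs.m₁
  have hk₁₂ := hs.k₁₂
  have hk₂₄ := hs.k₂₄
  have hk₂₅ := hs.k₂₅
  have hk₂ := hs.k₂
  have hk₃ := hs.k₃
  have hk₄ := hs.k₄
  have hk₅ := hs.k₅
  have hk₁' := hs.k₁'
  have hb := hs.b₄₅
  have j1 : jIdx 1 = 8 := rfl
  have j2 : jIdx 2 = 5 := rfl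
  have P₁ : leadP ω (actParam wWord e) 1 ≠ 0 := by
    simp only [leadP, j1, a38, a36, c386, a13, a23, c123]
    simp [hn₁, hn₂, hk₁₂, hk₂₄, hk₂, hk₄]
  have P₂ : leadP ω (actParam wWord e) 2 ≠ 0 := by
    simp only [leadP, j2, a35, a36, c356, a13, a23, c123]
    simp [hn₁, hn₂, hk₁₂, hk₂₅, hk₂, hk₅]
  have R₁ : leadR ω (actParam wWord e) 1 ≠ 0 := by
    simp only [leadR, a14, c469, d147, a45, a48, c123]
    simp [hn₁, hk₁₂, hk₂₅, hk₂₄, hk₃, hk₁']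
  have R₂ : leadR ω (actParam wWord e) 2 ≠ 0 := by
    simp only [leadR, a24, c469, d247, a45, a48, c123]
    simp [hn₁, hn₂, hk₂₅, hk₂₄, hk₃, hn']
  have G : ∀ g₁ g₂, (SpecG ω (actParam wWord e) 1 f₁ f₂ g₁ ∧ SpecG ω (actParam wWord e) 2 f₁ f₂ g₂) ↔
      MuRel ω (e 0) (e 9) (e 1) (e 2) (e 3) (e 4) (e 5) (e 6) (e 7 + del e) f₁ f₂ g₁ g₂ := by
    intro g₁ g₂
    rw [specG_iff P₁, specG_iff P₂, eq_div_iff P₁, eq_div_iff P₂]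
    simp only [leadP, leadQ, MuRel, j1, j2, a38, a35, a36, a13, a23, a12, c386, c356, c123, c138,
      c135, c136, c286, c256, c238, c235, c236, c186, c156]
    field_simp
  have F : ∀ g₁ g₂, (SpecF ω (actParam wWord e) 1 g₁ g₂ h₁ ∧ SpecF ω (actParam wWord e) 2 g₁ g₂ h₂) ↔
      (MuInvFst ω (e 0) (e 9) (e 1) (e 2) (e 3) (e 4) (e 5) (e 7 + del e) (e 6) h₁ g₁ g₂ ∧
       MuInvSnd ω (e 0) (e 9) (e 1) (e 2) (e 3) (e 4) (e 5) (e 7 + del e) (e 6) h₂ g₁ g₂) := by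
    intro g₁ g₂
    rw [specF_iff R₁, specF_iff R₂, eq_div_iff R₁, eq_div_iff R₂]
    simp only [leadR, leadS, MuInvFst, MuInvSnd, show aIdx 1 = 2 from rfl, show bIdx 1 = 3 from rfl,
      show aIdx 2 = 1 from rfl, show bIdx 2 = 3 from rfl, a14, a24, a45, a48, a58, c123, c138,
      c135, c238, c235, c469, d147, d247, d478, d457, d157, d178, d257, d278]
    field_simp
    refine and_congr ?_ ?_ <;> constructor <;> intro H <;> linear_combination -H
  simp only [SpecStep, ← G, ← F, and_assoc]

/-! ### Reduction to the linear equation for `Φ` -/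

/-- `StepRel` after division by the gauge factor. -/
def PhiRel (ω s t p₁ p₂ p₃ p₄ p₅ z z' φ ψ φ' : ℂ) : Prop :=
  tri ω s z' t t * tri ω s p₁ t t * (tri ω s p₁ z t * tri ω s p₂ z t * tri ω s p₃ z t *
      tri ω s p₄ z t * tri ω s p₅ z t) * (φ' - φ) =
    -(br ω (z' - z) * br ω (p₂ - t) * br ω (p₃ - t) * br ω (p₄ - t) * br ω (p₅ - t) *
      (tri ω s p₁ z t * br ω (p₁ - z) * φ + br ω (z - t) * tri ω s z t t * ψ))

section

variable {ω s t p₁ p₂ p₃ p₄ p₅ z z' : ℂ}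

/-- The gauge makes the coefficients of the new and the old value of F equal, so that only their
difference remains. Its equation is symmetric under exchanging g with g' and z with z', so it also
serves the backward relation. -/
lemma stepRel_iff_phiRel {g g' : ℂ} (hg : g ≠ 0)
    (h : g' * (tri ω s p₁ z' t * tri ω s z t t) = g * (tri ω s p₁ z t * tri ω s z' t t))
    (φ ψ φ' : ℂ) :
    StepRel ω s t p₁ p₂ p₃ p₄ p₅ z z' (g * φ) (g * ψ) (g' * φ') ↔
      PhiRel ω s t p₁ p₂ p₃ p₄ p₅ z z' φ ψ φ' := by
  unfold StepRel PhiRel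
  constructor
  · intro H
    apply mul_left_cancel₀ hg
    linear_combination H - φ' * (tri ω s p₁ t t * tri ω s p₂ z t * tri ω s p₃ z t *
      tri ω s p₄ z t * tri ω s p₅ z t) * h
  · intro H
    linear_combination g * H + φ' * (tri ω s p₁ t t * tri ω s p₂ z t * tri ω s p₃ z t *
      tri ω s p₄ z t * tri ω s p₅ z t) * h

lemma exists_phiRel (hb : br ω (z' - z) ≠ 0) (h₂ : br ω (p₂ - t) ≠ 0) (h₃ : br ω (p₃ - t) ≠ 0)
    (h₄ : br ω (p₄ - t) ≠ 0) (h₅ : br ω (p₅ - t) ≠ 0) (hz : br ω (z - t) ≠ 0)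
    (hm : tri ω s z t t ≠ 0) (φ φ' : ℂ) :
    ∃ ψ, PhiRel ω s t p₁ p₂ p₃ p₄ p₅ z z' φ ψ φ' := by
  refine ⟨(-(tri ω s z' t t * tri ω s p₁ t t * (tri ω s p₁ z t * tri ω s p₂ z t * tri ω s p₃ z t *
      tri ω s p₄ z t * tri ω s p₅ z t) * (φ' - φ)) /
    (br ω (z' - z) * br ω (p₂ - t) * br ω (p₃ - t) * br ω (p₄ - t) * br ω (p₅ - t)) -
    tri ω s p₁ z t * br ω (p₁ - z) * φ) / (br ω (z - t) * tri ω s z t t), ?_⟩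
  unfold PhiRel
  field_simp
  ring

/-- Both relations are linear in ψ, with coefficients proportional to [x-t] and [y-t].
Cross-multiplication removes ψ, and `tri_identity_final` simplifies what multiplies φ. -/
lemma phiRel_iff (hω : 0 < ω.im) {x y x' y' : ℂ} (hm₁ : tri ω s p₁ t t ≠ 0)
    (hx : br ω (x - t) ≠ 0) (hmx : tri ω s x t t ≠ 0) (hxy : br ω (y - x) ≠ 0)
    (hy : br ω (y' - x) ≠ 0) (hx' : br ω (y - x') ≠ 0) {φm φ φp ψ : ℂ}
    (h : PhiRel ω s t p₁ p₂ p₃ p₄ p₅ x y' φ ψ φp) :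
    PhiRel ω s t p₁ p₂ p₃ p₄ p₅ y x' φ ψ φm ↔
      br ω (y - t) * tri ω s y' t t * tri ω s y t t * (tri ω s p₁ x t * tri ω s p₂ x t *
          tri ω s p₃ x t * tri ω s p₄ x t * tri ω s p₅ x t) /
          (br ω (y - x) * br ω (y' - x)) * (φp - φ) =
        br ω (x - t) * tri ω s x' t t * tri ω s x t t * (tri ω s p₁ y t * tri ω s p₂ y t *
          tri ω s p₃ y t * tri ω s p₄ y t * tri ω s p₅ y t) /
          (br ω (y - x) * br ω (y - x')) * (φ - φm) -
        tri ω s x y t * (br ω (p₁ - t) * br ω (p₂ - t) * br ω (p₃ - t) * br ω (p₄ - t) *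
          br ω (p₅ - t)) * φ := by
  have T := tri_identity_final (s := s) (t := t) (p₁ := p₁) hω x y
  unfold PhiRel at h ⊢
  rw [br_sub_comm ω x' y]
  constructor
  · intro H
    field_simp
    apply mul_left_cancel₀ hm₁
    linear_combination br ω (y - t) * tri ω s y t t * br ω (y - x') * h +
      br ω (x - t) * tri ω s x t t * br ω (y' - x) * H -
      br ω (y' - x) * br ω (y - x') * (br ω (p₂ - t) * br ω (p₃ - t) * br ω (p₄ - t) *
          br ω (p₅ - t)) * φ * T
  · intro H
    field_simp at H
    apply mul_left_cancel₀ (mul_ne_zero (mul_ne_zero hx hmx) hy)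
    linear_combination tri ω s p₁ t t * H -
      br ω (y - t) * tri ω s y t t * br ω (y - x') * h +
      br ω (y' - x) * br ω (y - x') * (br ω (p₂ - t) * br ω (p₃ - t) * br ω (p₄ - t) *
          br ω (p₅ - t)) * φ * T

end

lemma prod_one_five (f : Fin 10 → ℂ) :
    ∏ k ∈ ({1, 2, 3, 4, 5} : Finset (Fin 10)), f k = f 1 * f 2 * f 3 * f 4 * f 5 := by
  rw [Finset.prod_insert (by decide), Finset.prod_insert (by decide),
    Finset.prod_insert (by decide), Finset.prod_insert (by decide), Finset.prod_singleton]
  ring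

lemma stepGeneric_of_genericOff {ω : ℂ} {e : Param} (h : e 8 = e 9)
    (hg : GenericOff ω {(8, 9)} e) (hT : GenericOff ω {(8, 9)} (actParam tWord e))
    (h76 : br2 ω (bar7 e) 7 6 ≠ 0) :
    StepGeneric ω (e 0) (e 9) (e 1) (e 2) (e 3) (e 4) (e 5) (e 6) (e 7 + del e) := by
  have t9 : ∀ i : Fin 10, 0 < i → i < 8 → br ω (e i - e 9) ≠ 0 := fun i hi hi8 =>
    hg.two i 9 hi (by decide) (by omega) (by simp; omega) (by simp)
  have t99 : ∀ i : Fin 10, 0 < i → i < 8 → tri ω (e 0) (e i) (e 9) (e 9) ≠ 0 := fun i hi hi8 => by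
    have := hg.three i 8 9 hi (by decide) (by decide) (by omega) (by omega) (by decide)
    rwa [h] at this
  have t : ∀ i j : Fin 10, 0 < i → 0 < j → i ≠ j → i < 8 → j < 8 →
      tri ω (e 0) (e i) (e j) (e 9) ≠ 0 := fun i j hi hj hij hi8 hj8 =>
    hg.three i j 9 hi hj (by decide) hij (by omega) (by omega)
  have hb : ∀ i : Fin 10, 0 < i → i ≠ 6 → i ≠ 7 → i ≠ 9 →
      tri ω (e 0) (e i) (e 7 + del e) (e 9) ≠ 0 := fun i hi hi6 hi7 hi9 => by
    have h1 := hT.three i 9 7 hi (by decide) (by decide) hi9 hi7 (by decide)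
    rw [← br3_bar7_tWord ω e i 9 hi.ne' (by decide) hi6 (by decide) hi7 (by decide)] at h1
    rw [bar7_seven, bar7_apply e hi7, bar7_apply e (show (9 : Fin 10) ≠ 7 by decide),
      bar7_apply e (show (0 : Fin 10) ≠ 7 by decide)] at h1
    rw [tri, show e 0 - e i - (e 7 + del e) - e 9 = e 0 - e i - e 9 - (e 7 + del e) by ring]
    exact h1
  constructor
  case n₁ => exact t9 1 (by decide) (by decide)
  case n₂ => exact t9 2 (by decide) (by decide)
  case n₃ => exact t9 3 (by decide) (by decide)
  case n₄ => exact t9 4 (by decide) (by decide)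
  case n₅ => exact t9 5 (by decide) (by decide)
  case n' =>
    have := hT.two 7 9 (by decide) (by decide) (by decide) (by simp) (by simp)
    rw [actParam_tWord_apply, actParam_tWord_apply] at this
    simp at this
    convert this using 2
    ring
  case m₁ => exact t99 1 (by decide) (by decide)
  case m => exact t99 6 (by decide) (by decide)
  case m' =>
    have := hb 8 (by decide) (by decide) (by decide) (by decide)
    rw [h, tri] at this
    rw [tri]
    convert this using 2
    ring
  case k₁₂ => exact t 1 2 (by decide) (by decide) (by decide) (by decide) (by decide)
  case k₂₄ => exact t 2 4 (by decide) (by decide) (by decide) (by decide) (by decide)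
  case k₂₅ => exact t 2 5 (by decide) (by decide) (by decide) (by decide) (by decide)
  case k₁ => exact t 1 6 (by decide) (by decide) (by decide) (by decide) (by decide)
  case k₂ => exact t 2 6 (by decide) (by decide) (by decide) (by decide) (by decide)
  case k₃ => exact t 3 6 (by decide) (by decide) (by decide) (by decide) (by decide)
  case k₄ => exact t 4 6 (by decide) (by decide) (by decide) (by decide) (by decide)
  case k₅ => exact t 5 6 (by decide) (by decide) (by decide) (by decide) (by decide)
  case k₁' => exact hb 1 (by decide) (by decide) (by decide) (by decide)
  case b₄₅ => exact hg.two 4 5 (by decide) (by decide) (by decide) (by simp) (by simp)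
  case b =>
    rw [br2, bar7_seven, bar7_apply e (show (6 : Fin 10) ≠ 7 by decide)] at h76
    exact h76

/-- `PhiRel` between the values at `ε` and at `T(ε)`. -/
def PhiFwd (ω : ℂ) (e : Param) (φ ψ φ' : ℂ) : Prop :=
  PhiRel ω (e 0) (e 9) (e 1) (e 2) (e 3) (e 4) (e 5) (e 6) (e 7 + del e) φ ψ φ'

/-- `PhiRel` between the values at `ε` and at `T⁻¹(ε)`. -/
def PhiBwd (ω : ℂ) (e : Param) (φ ψ φ' : ℂ) : Prop :=
  PhiRel ω (e 0) (e 9) (e 1) (e 2) (e 3) (e 4) (e 5) (e 7) (e 6 + del e) φ ψ φ'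

lemma phiRel_add (ω s t p₁ p₂ p₃ p₄ p₅ z z' d φ ψ φ' : ℂ) :
    PhiRel ω (s + 3 * d) (t + d) (p₁ + d) (p₂ + d) (p₃ + d) (p₄ + d) (p₅ + d) (z + d) (z' + d)
      φ ψ φ' ↔ PhiRel ω s t p₁ p₂ p₃ p₄ p₅ z z' φ ψ φ' := by
  have h₁ : ∀ x y w, tri ω (s + 3 * d) (x + d) (y + d) (w + d) = tri ω s x y w := fun x y w => by
    rw [tri, tri]; congr 1; ring
  simp only [PhiRel, h₁, add_sub_add_right_eq_sub]

/-- Up to a common translation, T turns ε₇ into ε₇ + δ and ε₆ + δ into ε₆. The backward relation at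
T(ε) is thus the forward one at ε with z and z' exchanged. -/
lemma phiBwd_tWord (ω : ℂ) (e : Param) (φ ψ φ' : ℂ) :
    PhiBwd ω (actParam tWord e) φ ψ φ' ↔
      PhiRel ω (e 0) (e 9) (e 1) (e 2) (e 3) (e 4) (e 5) (e 7 + del e) (e 6) φ ψ φ' := by
  rw [← phiRel_add ω _ _ _ _ _ _ _ _ _ (del e - (e 6 - e 7)), PhiBwd, del_tWord]
  simp only [actParam_tWord_apply]
  simp only [Fin.isValue, Fin.reduceEq, if_true, if_false, one_mul, add_zero]
  rw [show e 6 + (del e - (e 6 - e 7)) + -del e + del e = e 6 + (del e - (e 6 - e 7)) by ring,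
    show e 7 + (del e - (e 6 - e 7)) + del e = e 7 + del e + (del e - (e 6 - e 7)) by ring]

lemma specStep_gauge {ω : ℂ} (hω : 0 < ω.im) {e : Param} (h : e 8 = e 9)
    (hs : StepGeneric ω (e 0) (e 9) (e 1) (e 2) (e 3) (e 4) (e 5) (e 6) (e 7 + del e))
    {g g' : ℂ} (hg : g ≠ 0) (hg' : g' ≠ 0) (hgg : g' = gaugeFactor ω e * g) (φ ψ φ' ψ' : ℂ) :
    SpecStep ω (actParam wWord e) (g * φ) (g * ψ) (g' * φ') (g' * ψ') ↔
      PhiFwd ω e φ ψ φ' ∧ PhiBwd ω (actParam tWord e) φ' ψ' φ := by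
  have key : g' * (tri ω (e 0) (e 1) (e 7 + del e) (e 9) * tri ω (e 0) (e 6) (e 9) (e 9)) =
      g * (tri ω (e 0) (e 1) (e 6) (e 9) * tri ω (e 0) (e 7 + del e) (e 9) (e 9)) := by
    have h₁ : gaugeFactor ω e = tri ω (e 0) (e 1) (e 6) (e 9) *
        tri ω (e 0) (e 7 + del e) (e 9) (e 9) /
        (tri ω (e 0) (e 1) (e 7 + del e) (e 9) * tri ω (e 0) (e 6) (e 9) (e 9)) := by
      simp only [gaugeFactor, br3, tri, bar7_seven, bar7_apply e (show (9 : Fin 10) ≠ 7 by decide),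
        bar7_apply e (show (0 : Fin 10) ≠ 7 by decide),
        bar7_apply e (show (1 : Fin 10) ≠ 7 by decide)]
    have := hs.k₁'
    have := hs.m
    rw [hgg, h₁]
    field_simp
  rw [specStep_wWord_iff hω h hs, stepRel_iff_phiRel hg key, stepRel_iff_phiRel hg' key.symm,
    phiBwd_tWord, PhiFwd]

lemma phiBwd_iff_eqPhi {ω : ℂ} (hω : 0 < ω.im) {e : Param} (h : e 8 = e 9)
    (hg : GenericOff ω {(8, 9)} e) (h76 : br2 ω (bar7 e) 7 6 ≠ 0)
    (h76' : br ω (e 7 - (e 6 + del e)) ≠ 0) {φm φ φp ψ : ℂ} (hf : PhiFwd ω e φ ψ φp) :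
    PhiBwd ω e φ ψ φm ↔ EqPhi ω e φm φ φp := by
  have m : ∀ i : Fin 10, 0 < i → i < 8 → tri ω (e 0) (e i) (e 9) (e 9) ≠ 0 := fun i hi hi8 => by
    have := hg.three i 8 9 hi (by decide) (by decide) (by omega) (by omega) (by decide)
    rwa [h] at this
  rw [br2, bar7_seven, bar7_apply e (show (6 : Fin 10) ≠ 7 by decide)] at h76
  rw [PhiBwd, phiRel_iff hω (m 1 (by decide) (by decide))
    (hg.two 6 9 (by decide) (by decide) (by decide) (by simp) (by simp))
    (m 6 (by decide) (by decide))
    (hg.two 7 6 (by decide) (by decide) (by decide) (by simp) (by simp)) h76 h76' hf]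
  simp only [EqPhi, prod_one_five, br2, br3, tri, bar7_seven, under6,
    bar7_apply e (show (9 : Fin 10) ≠ 7 by decide), bar7_apply e (show (0 : Fin 10) ≠ 7 by decide),
    bar7_apply e (show (6 : Fin 10) ≠ 7 by decide), Function.update_self,
    Function.update_of_ne (show (0 : Fin 10) ≠ 6 by decide),
    Function.update_of_ne (show (7 : Fin 10) ≠ 6 by decide),
    Function.update_of_ne (show (9 : Fin 10) ≠ 6 by decide)]

lemma exists_multiplicative_recurrence (c : ℤ → ℂ) (hc : ∀ k, c k ≠ 0) :
    ∃ g : ℤ → ℂ, (∀ k, g k ≠ 0) ∧ ∀ k, g (k + 1) = c k * g k := by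
  refine ⟨fun k => (∏ i ∈ Finset.range k.toNat, c i) *
    (∏ i ∈ Finset.range (-k).toNat, c (-(i + 1 : ℕ)))⁻¹, fun k => ?_, fun k => ?_⟩
  · exact mul_ne_zero (Finset.prod_ne_zero_iff.mpr fun i _ => hc _)
      (inv_ne_zero (Finset.prod_ne_zero_iff.mpr fun i _ => hc _))
  · rcases k with n | n
    · have h₁ : (Int.ofNat n + 1).toNat = n + 1 := rfl
      have h₂ : (-(Int.ofNat n + 1)).toNat = 0 := rfl
      have h₃ : (-Int.ofNat n).toNat = 0 := by simp
      have h₄ : (Int.ofNat n).toNat = n := rfl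
      simp only [h₁, h₂, h₃, h₄, Finset.prod_range_succ]
      simp [mul_comm]
    · have h₁ : (Int.negSucc n + 1).toNat = 0 := by simp
      have h₂ : (-(Int.negSucc n + 1)).toNat = n := by omega
      have h₃ : (-Int.negSucc n).toNat = n + 1 := rfl
      have h₄ : (Int.negSucc n).toNat = 0 := rfl
      have h₅ : Int.negSucc n = -((n + 1 : ℕ) : ℤ) := rfl
      simp only [h₁, h₂, h₃, h₄, Finset.prod_range_succ]
      rw [h₅, mul_inv]
      have := hc (-((n + 1 : ℕ) : ℤ))
      field_simp

section

variable {ω : ℂ} {e : ℤ → Param} {I : Set ℤ}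

lemma orbit_stepGeneric (he : ∀ k, e (k + 1) = actParam tWord (e k)) (h89 : ∀ k, e k 8 = e k 9)
    (hI : ∀ k ∈ I, GenericOff ω {(8, 9)} (e k) ∧ br2 ω (bar7 (e k)) 7 6 ≠ 0) {k : ℤ}
    (hk : k ∈ I) (hk' : k + 1 ∈ I) :
    StepGeneric ω (e k 0) (e k 9) (e k 1) (e k 2) (e k 3) (e k 4) (e k 5) (e k 6)
      (e k 7 + del (e k)) :=
  stepGeneric_of_genericOff (h89 k) (hI k hk).1 (he k ▸ (hI _ hk').1) (hI k hk).2

lemma exists_isGauge (he : ∀ k, e (k + 1) = actParam tWord (e k)) (h89 : ∀ k, e k 8 = e k 9)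
    (hI : ∀ k ∈ I, GenericOff ω {(8, 9)} (e k) ∧ br2 ω (bar7 (e k)) 7 6 ≠ 0) :
    ∃ g : ℤ → ℂ, IsGauge ω e I g := by
  classical
  obtain ⟨g, hg, hg'⟩ := exists_multiplicative_recurrence
    -- The factor may vanish at times that do not matter; replacing it there by 1 allows a solution
    -- along all integers.
    (fun k => if gaugeFactor ω (e k) = 0 then 1 else gaugeFactor ω (e k))
    (fun k => by split_ifs with h <;> simp [h])
  refine ⟨g, fun k _ => hg k, fun k hk hk' => ?_⟩
  have hs := orbit_stepGeneric he h89 hI hk hk'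
  have hne : gaugeFactor ω (e k) ≠ 0 := by
    simp only [gaugeFactor, br3, bar7_seven, bar7_apply (e k) (show (9 : Fin 10) ≠ 7 by decide),
        bar7_apply (e k) (show (0 : Fin 10) ≠ 7 by decide),
        bar7_apply (e k) (show (1 : Fin 10) ≠ 7 by decide)]
    exact div_ne_zero (mul_ne_zero hs.k₁ hs.m') (mul_ne_zero hs.k₁' hs.m)
  rw [hg', if_neg hne]

lemma specStep_iff_eqPhi (hω : 0 < ω.im) (he : ∀ k, e (k + 1) = actParam tWord (e k))
    (h89 : ∀ k, e k 8 = e k 9)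
    (hI : ∀ k ∈ I, GenericOff ω {(8, 9)} (e k) ∧ br2 ω (bar7 (e k)) 7 6 ≠ 0) {g : ℤ → ℂ}
    (hg : IsGauge ω e I g) (Φ : ℤ → ℂ) :
    (∃ F₂ : ℤ → ℂ, ∀ k ∈ I, k + 1 ∈ I → SpecStep ω (actParam wWord (e k))
        (g k * Φ k) (F₂ k) (g (k + 1) * Φ (k + 1)) (F₂ (k + 1))) ↔
      ∀ k ∈ I, k - 1 ∈ I → k + 1 ∈ I → EqPhi ω (e k) (Φ (k - 1)) (Φ k) (Φ (k + 1)) := by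
  have step : ∀ ψ : ℤ → ℂ, ∀ k ∈ I, k + 1 ∈ I → (SpecStep ω (actParam wWord (e k))
        (g k * Φ k) (g k * ψ k) (g (k + 1) * Φ (k + 1)) (g (k + 1) * ψ (k + 1)) ↔
      PhiFwd ω (e k) (Φ k) (ψ k) (Φ (k + 1)) ∧
        PhiBwd ω (e (k + 1)) (Φ (k + 1)) (ψ (k + 1)) (Φ k)) := fun ψ k hk hk' => by
    rw [he k]
    exact specStep_gauge hω (h89 k) (orbit_stepGeneric he h89 hI hk hk') (hg.1 k hk)
      (hg.1 _ hk') (hg.2 k hk hk') _ _ _ _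
  -- The bracket with the lowered index 6 at time k is the bracket with barred index 7 at time k -
  -- 1.
  have h76 : ∀ k ∈ I, k - 1 ∈ I → br ω (e k 7 - (e k 6 + del (e k))) ≠ 0 := fun k hk hk' => by
    have h₁ := (hI _ hk').2
    rw [br2, bar7_seven, bar7_apply _ (show (6 : Fin 10) ≠ 7 by decide)] at h₁
    have h₂ := he (k - 1)
    rw [sub_add_cancel] at h₂
    rw [h₂, del_tWord, actParam_tWord_apply, actParam_tWord_apply]
    simp only [Fin.isValue, Fin.reduceEq, if_true, if_false, one_mul]
    convert h₁ using 2
    ring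
  constructor
  · rintro ⟨F₂, hF⟩ k hk hk₁ hk₂
    have hF' : ∀ k ∈ I, g k * (F₂ k / g k) = F₂ k := fun k hk => mul_div_cancel₀ _ (hg.1 k hk)
    have s₁ := hF (k - 1) hk₁ (by rwa [sub_add_cancel])
    have s₂ := hF k hk hk₂
    rw [sub_add_cancel] at s₁
    have t₁ := step (fun k => F₂ k / g k) (k - 1) hk₁ (by rwa [sub_add_cancel])
    have t₂ := step (fun k => F₂ k / g k) k hk hk₂
    rw [sub_add_cancel] at t₁
    simp only [hF' k hk, hF' _ hk₁, hF' _ hk₂] at t₁ t₂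
    exact (phiBwd_iff_eqPhi hω (h89 k) (hI k hk).1 (hI k hk).2 (h76 k hk hk₁) (t₂.1 s₂).1).1
      (t₁.1 s₁).2
  · intro hE
    -- The second component is chosen at each time separately: from the forward relation if there is
    -- a next time, otherwise from the backward one. When both apply, the equation for Φ says
    -- exactly that they agree.
    have ex : ∀ k, ∃ ψ, k ∈ I → (k + 1 ∈ I → PhiFwd ω (e k) (Φ k) ψ (Φ (k + 1))) ∧
        (k - 1 ∈ I → PhiBwd ω (e k) (Φ k) ψ (Φ (k - 1))) := fun k => by
      by_cases hk : k ∈ I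
      · by_cases hk' : k + 1 ∈ I
        · have hs := orbit_stepGeneric he h89 hI hk hk'
          obtain ⟨ψ, hψ⟩ := exists_phiRel (p₁ := e k 1) hs.b hs.n₂ hs.n₃ hs.n₄ hs.n₅
            ((hI k hk).1.two 6 9 (by decide) (by decide) (by decide) (by simp) (by simp)) hs.m
            (Φ k) (Φ (k + 1))
          exact ⟨ψ, fun _ => ⟨fun _ => hψ, fun hk₁ => (phiBwd_iff_eqPhi hω (h89 k) (hI k hk).1
            (hI k hk).2 (h76 k hk hk₁) hψ).2 (hE k hk hk₁ hk')⟩⟩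
        · by_cases hk₁ : k - 1 ∈ I
          · have hs := orbit_stepGeneric he h89 hI hk₁ (by rwa [sub_add_cancel])
            have h₂ := he (k - 1)
            rw [sub_add_cancel] at h₂
            obtain ⟨ψ, hψ⟩ := exists_phiRel (p₁ := e (k - 1) 1) (br_ne_zero_comm hs.b) hs.n₂ hs.n₃
              hs.n₄ hs.n₅ hs.n' hs.m' (Φ k) (Φ (k - 1))
            rw [← phiBwd_tWord, ← h₂] at hψ
            exact ⟨ψ, fun _ => ⟨fun h => absurd h hk', fun _ => hψ⟩⟩
          · exact ⟨0, fun _ => ⟨fun h => absurd h hk', fun h => absurd h hk₁⟩⟩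
      · exact ⟨0, fun h => absurd h hk⟩
    choose ψ hψ using ex
    refine ⟨fun k => g k * ψ k, fun k hk hk' => (step ψ k hk hk').2 ⟨(hψ k hk).1 hk', ?_⟩⟩
    have := (hψ (k + 1) hk').2 (by rwa [add_sub_cancel_right])
    rwa [add_sub_cancel_right] at this

end

/-! ### The parameters `u` -/

lemma uOf_zero (e : Param) : uOf e 0 = e 0 - 3 * e 9 - del e := rfl
lemma uOf_one (e : Param) : uOf e 1 = e 1 - e 9 := rfl
lemma uOf_two (e : Param) : uOf e 2 = e 2 - e 9 := rfl
lemma uOf_three (e : Param) : uOf e 3 = e 3 - e 9 := rfl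
lemma uOf_four (e : Param) : uOf e 4 = e 4 - e 9 := rfl
lemma uOf_five (e : Param) : uOf e 5 = e 5 - e 9 := rfl
lemma uOf_six (e : Param) : uOf e 6 = e 6 - e 9 := rfl
lemma uOf_seven (e : Param) : uOf e 7 = e 7 - e 9 := rfl

lemma balanced_iff (δ : ℂ) (u : Fin 8 → ℂ) : Balanced δ u ↔
    2 * δ + 3 * u 0 = u 1 + u 2 + u 3 + u 4 + u 5 + u 6 + u 7 := by
  rw [Balanced, sub_eq_zero, Fin.sum_univ_seven]
  rfl

lemma balanced_uOf {e : Param} (h : e 8 = e 9) : Balanced (del e) (uOf e) := by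
  rw [balanced_iff, uOf_zero, uOf_one, uOf_two, uOf_three, uOf_four, uOf_five, uOf_six, uOf_seven]
  linear_combination -del_eq e + h

lemma shiftU_shiftU (δ : ℂ) (u : Fin 8 → ℂ) : shiftU δ 7 6 (shiftU δ 6 7 u) = u := by
  funext m
  by_cases h6 : m = 6
  · subst h6; simp [shiftU]
  · by_cases h7 : m = 7
    · subst h7; simp [shiftU]
    · simp [shiftU, h6, h7]

lemma uOf_tWord (e : Param) : uOf (actParam tWord e) = shiftU (del e) 6 7 (uOf e) := by
  funext m
  simp only [uOf, shiftU, del_tWord, actParam_tWord_apply]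
  fin_cases m <;> simp <;> ring

lemma prod_one_five' (f : Fin 8 → ℂ) :
    ∏ k ∈ ({1, 2, 3, 4, 5} : Finset (Fin 8)), f k = f 1 * f 2 * f 3 * f 4 * f 5 := by
  rw [Finset.prod_insert (by decide), Finset.prod_insert (by decide),
    Finset.prod_insert (by decide), Finset.prod_insert (by decide), Finset.prod_singleton]
  ring

lemma eqPhi_iff_ehe (ω : ℂ) (e : Param) (Φ : (Fin 8 → ℂ) → ℂ) :
    EqPhi ω e (Φ (shiftU (del e) 7 6 (uOf e))) (Φ (uOf e)) (Φ (shiftU (del e) 6 7 (uOf e))) ↔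
      EHE ω (del e) Φ (uOf e) := by
  have b7 : br3 ω (bar7 e) 7 9 9 = br ω (uOf e 0 - uOf e 7) := by
    rw [br3, bar7_seven, bar7_apply e (show (9 : Fin 10) ≠ 7 by decide),
      bar7_apply e (show (0 : Fin 10) ≠ 7 by decide), uOf_zero, uOf_seven]
    congr 1; ring
  have u6 : br3 ω (under6 e) 6 9 9 = br ω (uOf e 0 - uOf e 6) := by
    rw [br3, under6, Function.update_self, Function.update_of_ne (by decide),
      Function.update_of_ne (by decide), uOf_zero, uOf_six]
    congr 1; ring
  have b76 : br2 ω (bar7 e) 7 6 = br ω (uOf e 7 - uOf e 6 + del e) := by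
    rw [br2, bar7_seven, bar7_apply e (show (6 : Fin 10) ≠ 7 by decide), uOf_six, uOf_seven]
    congr 1; ring
  have u76 : br2 ω (under6 e) 7 6 = br ω (uOf e 7 - uOf e 6 - del e) := by
    rw [br2, under6, Function.update_self, Function.update_of_ne (by decide), uOf_six, uOf_seven]
    congr 1; ring
  have c76 : br2 ω e 7 6 = br ω (uOf e 7 - uOf e 6) := by
    rw [br2, uOf_six, uOf_seven]; congr 1; ring
  have t7 : br3 ω e 7 9 9 = br ω (del e + uOf e 0 - uOf e 7) := by
    rw [br3, uOf_zero, uOf_seven]; congr 1; ring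
  have t6 : br3 ω e 6 9 9 = br ω (del e + uOf e 0 - uOf e 6) := by
    rw [br3, uOf_zero, uOf_six]; congr 1; ring
  have k6 : ∀ x, br ω (e 0 - x - e 6 - e 9) = br ω (del e + uOf e 0 - (x - e 9) - uOf e 6) :=
    fun x => by rw [uOf_zero, uOf_six]; congr 1; ring
  have k7 : ∀ x, br ω (e 0 - x - e 7 - e 9) = br ω (del e + uOf e 0 - (x - e 9) - uOf e 7) :=
    fun x => by rw [uOf_zero, uOf_seven]; congr 1; ring
  have t67 : br3 ω e 6 7 9 = -br ω (uOf e 7 + uOf e 6 - uOf e 0 - del e) := by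
    rw [br3, uOf_zero, uOf_six, uOf_seven, ← br_neg]; congr 1; ring
  unfold EqPhi EHE
  rw [b7, u6, b76, u76, c76, t7, t6, t67, prod_one_five, prod_one_five, prod_one_five,
    prod_one_five', prod_one_five', prod_one_five']
  simp only [br3, k6, k7, br2, ← uOf_one, ← uOf_two, ← uOf_three, ← uOf_four, ← uOf_five,
    ← uOf_six, ← uOf_seven]
  rw [neg_mul, neg_mul, sub_neg_eq_add, mul_comm (br ω (uOf e 7 + uOf e 6 - uOf e 0 - del e))]

/-! ### The very-well-poised series -/

lemma poch_zero (ω δ z : ℂ) : poch ω δ z 0 = 1 := by simp [poch]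

lemma poch_succ (ω δ z : ℂ) (n : ℕ) : poch ω δ z (n + 1) = poch ω δ z n * br ω (z + n * δ) :=
  Finset.prod_range_succ _ _

lemma poch_succ' (ω δ z : ℂ) (n : ℕ) : poch ω δ z (n + 1) = br ω z * poch ω δ (z + δ) n := by
  rw [poch, Finset.prod_range_succ', mul_comm]
  congr 1
  · simp
  · exact Finset.prod_congr rfl fun j _ => by congr 1; push_cast; ring

lemma poch_eq_zero (ω δ : ℂ) {z : ℂ} {n N : ℕ} (h : z = -(N * δ)) (hn : N < n) :
    poch ω δ z n = 0 :=
  Finset.prod_eq_zero (Finset.mem_range.mpr hn) (by rw [h, neg_add_cancel, br_zero])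

/-- The factor of the `n`-th term that does not involve `u₆` and `u₇`. -/
def vwpCoeff (ω δ c : ℂ) (p : Fin 5 → ℂ) (n : ℕ) : ℂ :=
  br ω (c + 2 * n * δ) / br ω c * (poch ω δ c n / poch ω δ δ n) *
    ((∏ i, poch ω δ (p i) n) / ∏ i, poch ω δ (c - p i + δ) n)

/-- The `n`-th term of the series, with `u₀ = c`, `uᵢ = pᵢ`, `u₆ = x`, `u₇ = y`. -/
def vwpTerm (ω δ c : ℂ) (p : Fin 5 → ℂ) (x y : ℂ) (n : ℕ) : ℂ :=
  vwpCoeff ω δ c p n * (poch ω δ x n / poch ω δ (c - x + δ) n) *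
    (poch ω δ y n / poch ω δ (c - y + δ) n)

lemma vwpTerm_comm (ω δ c : ℂ) (p : Fin 5 → ℂ) (x y : ℂ) (n : ℕ) :
    vwpTerm ω δ c p x y n = vwpTerm ω δ c p y x n := by
  simp only [vwpTerm]; ring

lemma e109_eq (ω δ : ℂ) (u : Fin 8 → ℂ) : E109 ω δ u =
    ∑' n, vwpTerm ω δ (u 0) ![u 1, u 2, u 3, u 4, u 5] (u 6) (u 7) n := by
  refine tsum_congr fun n => ?_
  rw [Fin.prod_univ_eight, vwpTerm, vwpCoeff, Fin.prod_univ_five, Fin.prod_univ_five,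
    show u 0 - u 0 + δ = δ by ring]
  simp only [div_eq_mul_inv, mul_inv]
  simp
  ring

section

variable {ω δ c : ℂ} {p : Fin 5 → ℂ} {x y : ℂ}

/-- For a = u₆ - δ, b = u₇, z = nδ, the left side is the numerator of the ratio of the shifted to
the unshifted n-th term, minus 1. The relation turns this difference into a product. -/
lemma vwp_shift_identity (hω : 0 < ω.im) (a b c z : ℂ) :
    br ω a * br ω (c - a) * (br ω (b + z) * br ω (c - b + z)) -
      br ω b * br ω (c - b) * (br ω (a + z) * br ω (c - a + z)) =
    -(br ω (b - a) * br ω (c - a - b) * (br ω z * br ω (c + z))) := by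
  have T := br_three_term ω hω (c / 2) (a - c / 2) (b - c / 2) (z + c / 2)
  rw [show c / 2 + (a - c / 2) = a by ring, show c / 2 - (a - c / 2) = c - a by ring,
    show b - c / 2 + (z + c / 2) = b + z by ring,
    show b - c / 2 - (z + c / 2) = -(c - b + z) by ring,
    show a - c / 2 + (b - c / 2) = -(c - a - b) by ring,
    show a - c / 2 - (b - c / 2) = -(b - a) by ring,
    show c / 2 + (z + c / 2) = c + z by ring, show c / 2 - (z + c / 2) = -z by ring,
    show b - c / 2 + c / 2 = b by ring, show b - c / 2 - c / 2 = -(c - b) by ring,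
    show a - c / 2 + (z + c / 2) = a + z by ring,
    show a - c / 2 - (z + c / 2) = -(c - a + z) by ring] at T
  simp only [br_neg] at T
  linear_combination -T

/-- The first difference in the elliptic hypergeometric equation, term by term. -/
lemma vwpTerm_shift (hω : 0 < ω.im) (m : ℕ) (q : ℂ)
    (hx : ∀ n, poch ω δ (c - x + δ) n ≠ 0) (hy : ∀ n, poch ω δ (c - y + δ) n ≠ 0)
    (hy' : ∀ n, poch ω δ (c - (y + δ) + δ) n ≠ 0)
    (h₁ : br ω (y - x) ≠ 0) (h₂ : br ω (y - x + δ) ≠ 0) :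
    br ω y * br ω (c - y) * br ω (δ + c - y) * q / (br ω (y - x) * br ω (y - x + δ)) *
      (vwpTerm ω δ c p (x - δ) (y + δ) (m + 1) - vwpTerm ω δ c p x y (m + 1)) =
    -(br ω (c - y + δ) * q / br ω (y - x) * br ω (c - x - y + δ) *
      (vwpCoeff ω δ c p (m + 1) * (poch ω δ x m * poch ω δ y m /
        (poch ω δ (c - x + δ) (m + 1) * poch ω δ (c - y + δ) (m + 1)))) *
      br ω (y + m * δ) * (br ω ((m + 1) * δ) * br ω (c + (m + 1) * δ)) /
        br ω (c - x + (m + 2) * δ)) := by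
  have T := vwp_shift_identity hω (x - δ) y c ((m + 1) * δ)
  have e₁ : poch ω δ (x - δ) (m + 1) = br ω (x - δ) * poch ω δ x m := by
    rw [poch_succ', sub_add_cancel]
  have e₂ : br ω y * poch ω δ (y + δ) (m + 1) =
      poch ω δ y m * br ω (y + m * δ) * br ω (y + (m + 1) * δ) := by
    rw [← poch_succ', poch_succ, poch_succ]; push_cast; rfl
  have e₃ : br ω (c - x + δ) * poch ω δ (c - (x - δ) + δ) (m + 1) =
      poch ω δ (c - x + δ) (m + 1) * br ω (c - x + (m + 2) * δ) := by
    rw [show c - (x - δ) + δ = c - x + δ + δ by ring, ← poch_succ', poch_succ]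
    congr 2; push_cast; ring
  have e₄ : br ω (c - y) * poch ω δ (c - y + δ) (m + 1) =
      poch ω δ (c - (y + δ) + δ) (m + 1) * br ω (c - y + (m + 1) * δ) := by
    rw [← poch_succ', poch_succ, show c - (y + δ) + δ = c - y by ring]
    push_cast; rfl
  have n₁ : br ω (c - x + δ) ≠ 0 := by simpa [poch] using hx 1
  have n₂ : br ω (c - x + (m + 2) * δ) ≠ 0 := by
    have := hx (m + 2)
    rw [poch_succ, show c - x + δ + ((m + 1 : ℕ) : ℂ) * δ = c - x + (m + 2) * δ by
      push_cast; ring] at this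
    exact right_ne_zero_of_mul this
  have n₃ : br ω (c - y) ≠ 0 := by
    have := hy' 1
    rw [poch_succ', show c - (y + δ) + δ = c - y by ring] at this
    exact left_ne_zero_of_mul this
  have n₄ : br ω (c - y + (m + 1) * δ) ≠ 0 := by
    have := mul_ne_zero n₃ (hy (m + 1))
    rw [e₄] at this
    exact right_ne_zero_of_mul this
  have d₃ : poch ω δ (c - (x - δ) + δ) (m + 1) =
      poch ω δ (c - x + δ) (m + 1) * br ω (c - x + (m + 2) * δ) / br ω (c - x + δ) := by
    rw [← e₃, mul_div_cancel_left₀ _ n₁]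
  have d₄ : poch ω δ (c - (y + δ) + δ) (m + 1) =
      br ω (c - y) * poch ω δ (c - y + δ) (m + 1) / br ω (c - y + (m + 1) * δ) := by
    rw [e₄, mul_div_cancel_right₀ _ n₄]
  have n₅ := hx (m + 1)
  have n₆ := hy (m + 1)
  rw [show c - (x - δ) = c - x + δ by ring, show x - δ + (m + 1) * δ = x + m * δ by ring,
    show c - x + δ + (m + 1) * δ = c - x + (m + 2) * δ by ring,
    show y - (x - δ) = y - x + δ by ring, show c - x + δ - y = c - x - y + δ by ring] at T
  rw [vwpTerm, vwpTerm, e₁, d₃, d₄, poch_succ ω δ x m, poch_succ ω δ y m,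
    show δ + c - y = c - y + δ by ring]
  generalize vwpCoeff ω δ c p (m + 1) = Q
  generalize poch ω δ x m = X at *
  generalize poch ω δ y m = Y at *
  generalize poch ω δ (c - x + δ) (m + 1) = U at *
  generalize poch ω δ (c - y + δ) (m + 1) = V at *
  generalize poch ω δ (y + δ) (m + 1) = Yp at *
  clear d₃ d₄ e₁ e₃ e₄ hx hy hy'
  generalize br ω (y + m * δ) = y₁ at *
  generalize br ω (y + (m + 1) * δ) = y₂ at *
  generalize br ω (x + m * δ) = x₁ at *
  generalize br ω (c - x + (m + 2) * δ) = x₂ at *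
  generalize br ω (c - y + (m + 1) * δ) = y₃ at *
  generalize br ω ((m + 1) * δ) = z at *
  generalize br ω (c + (m + 1) * δ) = w at *
  field_simp
  linear_combination Q * X * q * br ω (c - y + δ) * br ω (x - δ) * br ω (c - x + δ) * y₃ * e₂ +
    Q * X * q * Y * y₁ * br ω (c - y + δ) * T

end

/-- The identity behind the telescoping of the elliptic hypergeometric equation. -/
lemma vwp_telescope_identity {ω : ℂ} (hω : 0 < ω.im) {a b c : ℂ} (p : Fin 5 → ℂ)
    (h : 3 * c = ∑ i, p i + a + b) (z : ℂ) :
    br ω (c + 2 * z) *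
      (-(br ω (c - b) * br ω (c - b + z) * (∏ i, br ω (c - p i - a)) * br ω (b + z) *
          (br ω z * br ω (c + z))) +
        br ω (c - a) * br ω (c - a + z) * (∏ i, br ω (c - p i - b)) * br ω (a + z) *
          (br ω z * br ω (c + z)) +
        br ω (b - a) * br ω (c - a + z) * br ω (c - b + z) * (∏ i, br ω (p i)) *
          (br ω (a + z) * br ω (b + z))) =
    br ω (b - a) * br ω (c - a) * br ω (c - b) *
      (br ω (c + z) * (∏ i, br ω (p i + z)) * (br ω (a + z) * br ω (b + z)) -
        br ω z * (br ω (c - a + z) * br ω (c - b + z)) * ∏ i, br ω (c - p i + z)) := by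
  rw [Fin.sum_univ_five] at h
  -- The points are centred so that z + c/2 and its negative give the two ends of a telescoping
  -- difference, and the other three points give the three coefficients of the equation. The sums
  -- balance exactly when 3c is the sum of all pᵢ, a and b.
  have T := br_pf_five hω (a - c / 2) (b - c / 2) (c / 2) (z + c / 2) (-(z + c / 2))
    (c / 2 - p 0) (c / 2 - p 1) (c / 2 - p 2) (c / 2 - p 3) (c / 2 - p 4)
    (by linear_combination -h)
  have w₁ : ∀ x, br ω (a - c / 2 - (c / 2 - x)) = -br ω (c - x - a) := fun x => by
    rw [← br_neg]; congr 1; ring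
  have w₂ : ∀ x, br ω (b - c / 2 - (c / 2 - x)) = -br ω (c - x - b) := fun x => by
    rw [← br_neg]; congr 1; ring
  have w₃ : ∀ x, br ω (c / 2 - (c / 2 - x)) = br ω x := fun x => by congr 1; ring
  have w₄ : ∀ x, br ω (z + c / 2 - (c / 2 - x)) = br ω (x + z) := fun x => by congr 1; ring
  have w₅ : ∀ x, br ω (-(z + c / 2) - (c / 2 - x)) = -br ω (c - x + z) := fun x => by
    rw [← br_neg]; congr 1; ring
  simp only [pfFive, w₁, w₂, w₃, w₄, w₅] at T
  rw [show a - c / 2 - (b - c / 2) = -(b - a) by ring,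
    show a - c / 2 - c / 2 = -(c - a) by ring,
    show a - c / 2 - (z + c / 2) = -(c - a + z) by ring,
    show a - c / 2 - -(z + c / 2) = a + z by ring,
    show b - c / 2 - c / 2 = -(c - b) by ring,
    show b - c / 2 - (z + c / 2) = -(c - b + z) by ring,
    show b - c / 2 - -(z + c / 2) = b + z by ring,
    show c / 2 - (z + c / 2) = -z by ring,
    show c / 2 - -(z + c / 2) = c + z by ring,
    show z + c / 2 - -(z + c / 2) = c + 2 * z by ring] at T
  simp only [br_neg] at T
  simp only [Fin.prod_univ_five]
  linear_combination -T

/-- The primitive of the terms of the elliptic hypergeometric equation for the series. -/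
def vwpTail (ω δ c : ℂ) (p : Fin 5 → ℂ) (x y : ℂ) : ℕ → ℂ
  | 0 => 0
  | m + 1 => poch ω δ c (m + 1) * (∏ i, poch ω δ (p i) (m + 1)) * (poch ω δ x m * poch ω δ y m) /
      (br ω c * poch ω δ δ m * (∏ i, poch ω δ (c - p i + δ) m) *
        (poch ω δ (c - x + δ) (m + 1) * poch ω δ (c - y + δ) (m + 1)))

/-- The coefficient of `Φ(6⁻7⁺) - Φ`. -/
def eheCoeff (ω δ c : ℂ) (p : Fin 5 → ℂ) (x y : ℂ) : ℂ :=
  br ω y * br ω (c - y) * br ω (δ + c - y) * (∏ i, br ω (δ + c - p i - x)) /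
    (br ω (y - x) * br ω (y - x + δ))

/-- The denominators that occur in the series and its two neighbours do not vanish. -/
structure VwpRegular (ω δ c : ℂ) (p : Fin 5 → ℂ) (x y : ℂ) : Prop where
  hc : br ω c ≠ 0
  hδ : ∀ n, poch ω δ δ n ≠ 0
  hp : ∀ i n, poch ω δ (c - p i + δ) n ≠ 0
  hx : ∀ n, poch ω δ (c - x + δ) n ≠ 0
  hy : ∀ n, poch ω δ (c - y + δ) n ≠ 0
  hx' : ∀ n, poch ω δ (c - (x + δ) + δ) n ≠ 0
  hy' : ∀ n, poch ω δ (c - (y + δ) + δ) n ≠ 0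
  hb : br ω (y - x) ≠ 0
  hb₁ : br ω (y - x + δ) ≠ 0
  hb₂ : br ω (x - y + δ) ≠ 0

section

variable {ω δ c : ℂ} {p : Fin 5 → ℂ} {x y : ℂ}

/-- The terms of index n = m + 1 ≥ 1 contribute a difference of consecutive tails. This is
`vwp_telescope_identity` at z = nδ, with a and b equal to x - δ and y - δ, which absorbs the 2δ of
the balancing condition. -/
lemma vwp_ehe_succ (hω : 0 < ω.im) (h : 2 * δ + 3 * c = ∑ i, p i + x + y)
    (hr : VwpRegular ω δ c p x y) (m : ℕ) :
    eheCoeff ω δ c p x y *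
        (vwpTerm ω δ c p (x - δ) (y + δ) (m + 1) - vwpTerm ω δ c p x y (m + 1)) +
      eheCoeff ω δ c p y x *
        (vwpTerm ω δ c p (x + δ) (y - δ) (m + 1) - vwpTerm ω δ c p x y (m + 1)) +
      br ω (c - x - y + δ) * (∏ i, br ω (p i)) * vwpTerm ω δ c p x y (m + 1) =
    br ω (c - x - y + δ) * br ω (c - x + δ) * br ω (c - y + δ) *
      (vwpTail ω δ c p x y (m + 2) - vwpTail ω δ c p x y (m + 1)) := by
  have hb' : br ω (x - y) ≠ 0 := br_ne_zero_comm hr.hb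
  have A := vwpTerm_shift (p := p) hω m (∏ i, br ω (δ + c - p i - x)) hr.hx hr.hy hr.hy' hr.hb hr.hb₁
  have B := vwpTerm_shift (p := p) hω m (∏ i, br ω (δ + c - p i - y)) hr.hy hr.hx hr.hx' hb' hr.hb₂
  rw [vwpTerm_comm ω δ c p (y - δ), vwpTerm_comm ω δ c p y, br_sub_comm ω x y,
    show c - y - x + δ = c - x - y + δ by ring] at B
  have T := vwp_telescope_identity hω (a := x - δ) (b := y - δ) (c := c) p
    (by linear_combination h) ((m + 1) * δ)
  rw [show c - (y - δ) + (m + 1) * δ = c - y + (m + 2) * δ by ring,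
    show c - (x - δ) + (m + 1) * δ = c - x + (m + 2) * δ by ring,
    show c - (x - δ) = c - x + δ by ring, show c - (y - δ) = c - y + δ by ring,
    show y - δ - (x - δ) = y - x by ring, show x - δ + (m + 1) * δ = x + m * δ by ring,
    show y - δ + (m + 1) * δ = y + m * δ by ring] at T
  have q₁ : ∀ i, c - p i - (x - δ) = δ + c - p i - x := fun i => by ring
  have q₂ : ∀ i, c - p i - (y - δ) = δ + c - p i - y := fun i => by ring
  simp only [q₁, q₂] at T
  have nx := hr.hx (m + 2)
  have ny := hr.hy (m + 2)
  have nδ := hr.hδ (m + 1)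
  have np : (∏ i, poch ω δ (c - p i + δ) (m + 1)) ≠ 0 :=
    Finset.prod_ne_zero_iff.mpr fun i _ => hr.hp i _
  have nc := hr.hc
  have nb := hr.hb
  rw [eheCoeff, eheCoeff, br_sub_comm ω x y, A, B]
  simp only [vwpTail, vwpTerm, vwpCoeff]
  have e₁ : ∏ i, poch ω δ (c - p i + δ) (m + 1) =
      (∏ i, poch ω δ (c - p i + δ) m) * ∏ i, br ω (c - p i + (m + 1) * δ) := by
    rw [← Finset.prod_mul_distrib]
    refine Finset.prod_congr rfl fun i _ => ?_
    rw [poch_succ]; congr 2; ring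
  have e₂ : ∏ i, poch ω δ (p i) (m + 1 + 1) =
      (∏ i, poch ω δ (p i) (m + 1)) * ∏ i, br ω (p i + (m + 1) * δ) := by
    rw [← Finset.prod_mul_distrib]
    refine Finset.prod_congr rfl fun i _ => ?_
    rw [poch_succ]; push_cast; rfl
  have e₃ : poch ω δ c (m + 1 + 1) = poch ω δ c (m + 1) * br ω (c + (m + 1) * δ) := by
    rw [poch_succ]; push_cast; rfl
  have e₄ : ∀ t, poch ω δ (c - t + δ) (m + 1 + 1) =
      poch ω δ (c - t + δ) (m + 1) * br ω (c - t + (m + 2) * δ) := fun t => by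
    rw [poch_succ]; congr 2; push_cast; ring
  have e₅ : poch ω δ δ (m + 1) = poch ω δ δ m * br ω ((m + 1) * δ) := by
    rw [poch_succ]; congr 2; ring
  rw [e₄] at nx ny
  rw [e₁] at np
  rw [e₅] at nδ
  rw [e₁, e₂, e₃, e₄, e₄, e₅, poch_succ ω δ x, poch_succ ω δ y,
    show c + 2 * ((m + 1 : ℕ) : ℂ) * δ = c + 2 * ((m + 1) * δ) by push_cast; ring]
  clear A B e₁ e₂ e₃ e₄ e₅ q₁ q₂ h hb' hr
  generalize br ω (c - x - y + δ) = D at *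
  generalize br ω (c - x + δ) = cx at *
  generalize br ω (c - y + δ) = cy at *
  generalize br ω (c - x + (m + 2) * δ) = x₂ at *
  generalize br ω (c - y + (m + 2) * δ) = y₂ at *
  generalize br ω (x + m * δ) = x₁ at *
  generalize br ω (y + m * δ) = y₁ at *
  generalize br ω ((m + 1) * δ) = z at *
  generalize br ω (c + (m + 1) * δ) = w at *
  generalize br ω (c + 2 * ((m + 1) * δ)) = v at *
  generalize (∏ i, br ω (δ + c - p i - x)) = P₁ at *
  generalize (∏ i, br ω (δ + c - p i - y)) = P₂ at *
  generalize (∏ i, br ω (p i)) = P₃ at *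
  generalize (∏ i, br ω (p i + (m + 1) * δ)) = P₄ at *
  generalize (∏ i, br ω (c - p i + (m + 1) * δ)) = P₅ at *
  generalize poch ω δ (c - x + δ) (m + 1) = U at *
  generalize poch ω δ (c - y + δ) (m + 1) = V at *
  generalize poch ω δ δ m = d at *
  generalize (∏ i, poch ω δ (c - p i + δ) m) = R at *
  generalize (∏ i, poch ω δ (p i) (m + 1)) = S at *
  generalize poch ω δ c (m + 1) = C at *
  generalize poch ω δ x m = X at *
  generalize poch ω δ y m = Y at *
  generalize br ω (y - x) = b at *
  generalize br ω c = c₀ at *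
  obtain ⟨nU, nx₂⟩ := mul_ne_zero_iff.mp nx
  obtain ⟨nV, ny₂⟩ := mul_ne_zero_iff.mp ny
  obtain ⟨nd, nz⟩ := mul_ne_zero_iff.mp nδ
  obtain ⟨nR, nP⟩ := mul_ne_zero_iff.mp np
  field_simp
  linear_combination D * C * S * X * Y * T

end

section

variable {ω δ c : ℂ} {p : Fin 5 → ℂ} {x y : ℂ}

lemma vwpTerm_zero (hc : br ω c ≠ 0) : vwpTerm ω δ c p x y 0 = 1 := by
  simp [vwpTerm, vwpCoeff, poch_zero, hc]

lemma vwp_ehe_partial (hω : 0 < ω.im) (h : 2 * δ + 3 * c = ∑ i, p i + x + y)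
    (hr : VwpRegular ω δ c p x y) (N : ℕ) :
    eheCoeff ω δ c p x y * (∑ n ∈ Finset.range N, vwpTerm ω δ c p (x - δ) (y + δ) n -
        ∑ n ∈ Finset.range N, vwpTerm ω δ c p x y n) +
      eheCoeff ω δ c p y x * (∑ n ∈ Finset.range N, vwpTerm ω δ c p (x + δ) (y - δ) n -
        ∑ n ∈ Finset.range N, vwpTerm ω δ c p x y n) +
      br ω (c - x - y + δ) * (∏ i, br ω (p i)) * ∑ n ∈ Finset.range N, vwpTerm ω δ c p x y n =
    br ω (c - x - y + δ) * br ω (c - x + δ) * br ω (c - y + δ) * vwpTail ω δ c p x y N := by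
  induction N with
  | zero => simp [vwpTail]
  | succ N ih =>
    simp only [Finset.sum_range_succ]
    rcases N with _ | m
    -- All three terms of index 0 equal 1, so both differences vanish and the remaining term is the
    -- first nonzero tail.
    · have nx : br ω (c - x + δ) ≠ 0 := by simpa [poch] using hr.hx 1
      have ny : br ω (c - y + δ) ≠ 0 := by simpa [poch] using hr.hy 1
      have nc := hr.hc
      simp only [vwpTerm_zero hr.hc, vwpTail, poch_succ, poch_zero]
      simp
      field_simp
    · linear_combination ih + vwp_ehe_succ hω h hr m

lemma vwpTerm_eq_zero {n : ℕ} (h : (∃ i, poch ω δ (p i) n = 0) ∨ poch ω δ x n = 0 ∨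
    poch ω δ y n = 0) : vwpTerm ω δ c p x y n = 0 := by
  rcases h with ⟨i, h⟩ | h | h
  · have : ∏ i, poch ω δ (p i) n = 0 := Finset.prod_eq_zero (Finset.mem_univ i) h
    simp [vwpTerm, vwpCoeff, this]
  · simp [vwpTerm, h]
  · simp [vwpTerm, h]

lemma vwpTail_eq_zero {n : ℕ} (h : (∃ i, poch ω δ (p i) (n + 1) = 0) ∨ poch ω δ x n = 0 ∨
    poch ω δ y n = 0) : vwpTail ω δ c p x y (n + 1) = 0 := by
  rcases h with ⟨i, h⟩ | h | h
  · have : ∏ i, poch ω δ (p i) (n + 1) = 0 := Finset.prod_eq_zero (Finset.mem_univ i) h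
    simp [vwpTail, this]
  · simp [vwpTail, h]
  · simp [vwpTail, h]

lemma tsum_vwpTerm {M : ℕ} (h : ∀ n, M ≤ n → (∃ i, poch ω δ (p i) n = 0) ∨ poch ω δ x n = 0 ∨
    poch ω δ y n = 0) :
    ∑' n, vwpTerm ω δ c p x y n = ∑ n ∈ Finset.range M, vwpTerm ω δ c p x y n :=
  tsum_eq_sum fun n hn => vwpTerm_eq_zero (h n (by simpa using hn))

/-- A sum that terminates after a shift of `x`, unless it is multiplied by zero. -/
lemma eheCoeff_mul_tsum {N : ℕ} (h : (∃ i, p i = -(N * δ)) ∨ x = -(N * δ) ∨ y = -(N * δ))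
    {x' : ℂ} (hx' : x' = x - δ) :
    eheCoeff ω δ c p x y * ∑' n, vwpTerm ω δ c p x' (y + δ) n =
      eheCoeff ω δ c p x y * ∑ n ∈ Finset.range (N + 2), vwpTerm ω δ c p x' (y + δ) n := by
  -- If y = 0 is what makes the series terminate, the shift to δ may destroy termination, but then
  -- the coefficient contains [y] = 0. If x = -Nδ, the shift delays termination by one term, hence
  -- the bound N + 2.
  by_cases hy : y = 0
  · simp [eheCoeff, hy, br_zero]
  · rw [tsum_vwpTerm]
    intro n hn
    rcases h with ⟨i, h⟩ | h | h
    · exact Or.inl ⟨i, poch_eq_zero ω δ h (by omega)⟩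
    · refine Or.inr (Or.inl (poch_eq_zero ω δ (N := N + 1) ?_ (by omega)))
      rw [hx', h]; push_cast; ring
    · rcases N with _ | N
      · simp [h] at hy
      · refine Or.inr (Or.inr (poch_eq_zero ω δ (N := N) ?_ (by omega)))
        rw [h]; push_cast; ring

lemma vwp_ehe (hω : 0 < ω.im) (h : 2 * δ + 3 * c = ∑ i, p i + x + y)
    (hr : VwpRegular ω δ c p x y) {N : ℕ}
    (hN : (∃ i, p i = -(N * δ)) ∨ x = -(N * δ) ∨ y = -(N * δ)) :
    eheCoeff ω δ c p x y * (∑' n, vwpTerm ω δ c p (x - δ) (y + δ) n -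
        ∑' n, vwpTerm ω δ c p x y n) +
      eheCoeff ω δ c p y x * (∑' n, vwpTerm ω δ c p (x + δ) (y - δ) n -
        ∑' n, vwpTerm ω δ c p x y n) +
      br ω (c - x - y + δ) * (∏ i, br ω (p i)) * ∑' n, vwpTerm ω δ c p x y n = 0 := by
  have S := vwp_ehe_partial hω h hr (N + 2)
  have z : ∀ n, N + 1 ≤ n → (∃ i, poch ω δ (p i) n = 0) ∨ poch ω δ x n = 0 ∨
      poch ω δ y n = 0 := fun n hn => by
    rcases hN with ⟨i, h⟩ | h | h
    · exact Or.inl ⟨i, poch_eq_zero ω δ h (by omega)⟩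
    · exact Or.inr (Or.inl (poch_eq_zero ω δ h (by omega)))
    · exact Or.inr (Or.inr (poch_eq_zero ω δ h (by omega)))
  -- The tail lags by one in x and y, so its numerator contains their factorials of length N + 1;
  -- these, or a factorial of some pᵢ of length N + 2, already vanish.
  have z' : vwpTail ω δ c p x y (N + 2) = 0 := vwpTail_eq_zero
    ((z (N + 1) le_rfl).imp_left fun ⟨i, hi⟩ => ⟨i, by rw [poch_succ, hi, zero_mul]⟩)
  rw [tsum_vwpTerm (M := N + 2) fun n hn => z n (by omega), mul_sub, mul_sub,
    eheCoeff_mul_tsum hN rfl]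
  have hN' : (∃ i, p i = -(N * δ)) ∨ y = -(N * δ) ∨ x = -(N * δ) := hN.imp_right Or.symm
  have B := eheCoeff_mul_tsum (ω := ω) (c := c) hN' (x' := y - δ) rfl
  simp only [vwpTerm_comm ω δ c p (y - δ)] at B
  rw [B]
  rw [z', mul_zero, mul_sub, mul_sub] at S
  exact S

end

lemma WellDefined.ne {ω δ : ℂ} {u : Fin 8 → ℂ} (h : WellDefined ω δ u) (r : Fin 8) {z : ℂ}
    (hz : z = u 0 - u r + δ) (n : ℕ) : poch ω δ z n ≠ 0 := hz ▸ h.2 r n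

/-- The terminating series `₁₀E₉` solves the elliptic hypergeometric equation. -/
lemma e109_ehe {ω δ : ℂ} (hω : 0 < ω.im) {u : Fin 8 → ℂ} (hb : Balanced δ u)
    (ht : Terminates δ u) (hw : WellDefined ω δ u) (hw₁ : WellDefined ω δ (shiftU δ 6 7 u))
    (hw₂ : WellDefined ω δ (shiftU δ 7 6 u)) (n : br ω (u 7 - u 6) ≠ 0)
    (n₁ : br ω (u 7 - u 6 + δ) ≠ 0) (n₂ : br ω (u 7 - u 6 - δ) ≠ 0) :
    EHE ω δ (E109 ω δ) u := by
  have s₀ : ∀ i j : Fin 8, i ≠ 0 → j ≠ 0 → shiftU δ i j u 0 = u 0 := fun i j hi hj => by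
    simp [shiftU, hi.symm, hj.symm]
  have hr : VwpRegular ω δ (u 0) ![u 1, u 2, u 3, u 4, u 5] (u 6) (u 7) := by
    -- The factor r = 0 of the series has denominator [δ]ₙ. The shifted denominators in u₆ and u₇
    -- come from the neighbour at which that parameter is raised.
    refine ⟨hw.1, hw.ne 0 (by ring), fun i => ?_, hw.2 6, hw.2 7, hw₂.ne 6 ?_, hw₁.ne 7 ?_, n, n₁,
      ?_⟩
    · fin_cases i
      exacts [hw.2 1, hw.2 2, hw.2 3, hw.2 4, hw.2 5]
    · simp [shiftU]
    · simp [shiftU]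
    · rw [show u 6 - u 7 + δ = -(u 7 - u 6 - δ) by ring, br_neg]
      exact neg_ne_zero.mpr n₂
  obtain ⟨i, hi, N, hN⟩ := ht
  have hN' : (∃ i, (![u 1, u 2, u 3, u 4, u 5] : Fin 5 → ℂ) i = -(N * δ)) ∨ u 6 = -(N * δ) ∨
      u 7 = -(N * δ) := by
    fin_cases i
    · exact absurd rfl hi
    · exact Or.inl ⟨0, hN⟩
    · exact Or.inl ⟨1, hN⟩
    · exact Or.inl ⟨2, hN⟩
    · exact Or.inl ⟨3, hN⟩
    · exact Or.inl ⟨4, hN⟩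
    · exact Or.inr (Or.inl hN)
    · exact Or.inr (Or.inr hN)
  rw [balanced_iff] at hb
  have T := vwp_ehe hω (by rw [hb, Fin.sum_univ_five]; simp) hr hN'
  have E₁ : E109 ω δ (shiftU δ 6 7 u) = ∑' n, vwpTerm ω δ (u 0) ![u 1, u 2, u 3, u 4, u 5]
      (u 6 - δ) (u 7 + δ) n := by
    rw [e109_eq]; simp [shiftU]
  have E₂ : E109 ω δ (shiftU δ 7 6 u) = ∑' n, vwpTerm ω δ (u 0) ![u 1, u 2, u 3, u 4, u 5]
      (u 6 + δ) (u 7 - δ) n := by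
    rw [e109_eq]; simp [shiftU]
  rw [← E₁, ← E₂, ← e109_eq] at T
  simp only [eheCoeff, Fin.prod_univ_five] at T
  rw [EHE, prod_one_five', prod_one_five', prod_one_five',
    show u 7 + u 6 - u 0 - δ = -(u 0 - u 6 - u 7 + δ) by ring,
    show u 7 - u 6 - δ = -(u 6 - u 7 + δ) by ring, br_neg, br_neg]
  rw [br_sub_comm ω (u 6) (u 7)] at T
  simp only [Matrix.cons_val_zero, Matrix.cons_val_one, Matrix.cons_val] at T
  rw [← sub_eq_zero]
  rw [← T]
  ring

section

variable {ω : ℂ} {e : ℤ → Param} {I : Set ℤ}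

/-- Along an orbit, `₁₀E₉` gives a solution of the linear equation for `Φ`. -/
lemma e109_eqPhi (hω : 0 < ω.im) (he : ∀ k, e (k + 1) = actParam tWord (e k))
    (h89 : ∀ k, e k 8 = e k 9)
    (hI : ∀ k ∈ I, GenericOff ω {(8, 9)} (e k) ∧ br2 ω (bar7 (e k)) 7 6 ≠ 0 ∧
      Terminates (del (e k)) (uOf (e k)) ∧ WellDefined ω (del (e k)) (uOf (e k))) {k : ℤ}
    (hk : k ∈ I) (hk₁ : k - 1 ∈ I) (hk₂ : k + 1 ∈ I) :
    EqPhi ω (e k) (E109 ω (del (e (k - 1))) (uOf (e (k - 1)))) (E109 ω (del (e k)) (uOf (e k)))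
      (E109 ω (del (e (k + 1))) (uOf (e (k + 1)))) := by
  obtain ⟨g, b, t, w⟩ := hI k hk
  obtain ⟨-, b', -, w₁⟩ := hI _ hk₁
  obtain ⟨-, -, -, w₂⟩ := hI _ hk₂
  have hp := he (k - 1)
  rw [sub_add_cancel] at hp
  have d₁ : del (e (k - 1)) = del (e k) := by rw [hp, del_tWord]
  have d₂ : del (e (k + 1)) = del (e k) := by rw [he k, del_tWord]
  have u₂ : uOf (e (k + 1)) = shiftU (del (e k)) 6 7 (uOf (e k)) := by rw [he k, uOf_tWord]
  have u₁ : uOf (e (k - 1)) = shiftU (del (e k)) 7 6 (uOf (e k)) := by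
    rw [hp, uOf_tWord, del_tWord, shiftU_shiftU]
  rw [d₁, u₁] at w₁ ⊢
  rw [d₂, u₂] at w₂ ⊢
  rw [eqPhi_iff_ehe ω (e k) (E109 ω (del (e k)))]
  refine e109_ehe hω (balanced_uOf (h89 k)) t w w₂ w₁ ?_ ?_ ?_
  · have := g.two 7 6 (by decide) (by decide) (by decide) (by simp) (by simp)
    rw [uOf_six, uOf_seven]
    convert this using 2
    ring
  · rw [br2, bar7_seven, bar7_apply _ (show (6 : Fin 10) ≠ 7 by decide)] at b
    rw [uOf_six, uOf_seven]
    convert b using 2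
    ring
  · rw [br2, bar7_seven, bar7_apply _ (show (6 : Fin 10) ≠ 7 by decide)] at b'
    rw [uOf_six, uOf_seven, hp, del_tWord]
    simp only [actParam_tWord_apply]
    simp only [Fin.isValue, Fin.reduceEq, if_true, if_false, one_mul]
    convert b' using 2
    ring

end

/-- The second step `g ↦ T(f)` of the elliptic Painlevé equation. -/
lemma tWord_explicit {ω : ℂ} (hω : 0 < ω.im) {x : TauPoint} (hx : Regular ω tWord x) {i : Fin 10}
    (hi : i ∈ ({1, 2, 3} : Finset (Fin 10))) :
    (actPoint ω tWord x).f i =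
        polyS ω x.eps i ((actPoint ω muWord x).f 1) ((actPoint ω muWord x).f 2)
          ((actPoint ω muWord x).f 3) /
        polyR ω x.eps i ((actPoint ω muWord x).f 1) ((actPoint ω muWord x).f 2)
          ((actPoint ω muWord x).f 3) ∧
      (actPoint ω tWord x).tau i * ((actPoint ω muWord x).tau 6 *
          (actPoint ω muWord x).tau (jIdx i)) =
        polyR ω x.eps i ((actPoint ω muWord x).f 1) ((actPoint ω muWord x).f 2)
          ((actPoint ω muWord x).f 3) *
        ((actPoint ω muWord x).tau 1 * (actPoint ω muWord x).tau 2 *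
          (actPoint ω muWord x).tau 3) := by
  have h := muWord_explicit hω (Regular.right (v := muWord) hx) i hi
  rw [actPoint_eps, polyP_muWord ω _ i hi, polyQ_muWord ω _ i hi] at h
  rw [tWord, actPoint_append]
  exact h

end EllipticPainleve

end

theorem mainTheorem1 (ω : ℂ) (hω : 0 < ω.im) :
    -- The elliptic Painlevé equation: `T = T_{α₆}` acts on the parameters as the translation by
    -- `α₆`, and the birational action of `μ` and `T = μ²` on `f` and `τ` is explicit.
    (∀ (e : Param) (i : Fin 10), actParam tWord e i =
      e i + (if i = 0 then 3 else 1) * (del e - (e 6 - e 7))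
        + (if i = 7 then del e else if i = 6 then -del e else 0)) ∧
    (∀ x : TauPoint, Regular ω tWord x → ∀ i ∈ ({1, 2, 3} : Finset (Fin 10)),
      let y := actPoint ω muWord x
      let z := actPoint ω tWord x
      y.f i = polyQ ω x.eps i (x.f 1) (x.f 2) (x.f 3) / polyP ω x.eps i (x.f 1) (x.f 2) (x.f 3) ∧
      z.f i = polyS ω x.eps i (y.f 1) (y.f 2) (y.f 3) / polyR ω x.eps i (y.f 1) (y.f 2) (y.f 3) ∧
      y.tau i * (x.tau 6 * x.tau (jIdx i)) =
        polyP ω x.eps i (x.f 1) (x.f 2) (x.f 3) * (x.tau 1 * x.tau 2 * x.tau 3) ∧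
      z.tau i * (y.tau 6 * y.tau (jIdx i)) =
        polyR ω x.eps i (y.f 1) (y.f 2) (y.f 3) * (y.tau 1 * y.tau 2 * y.tau 3)) ∧
    -- If `[ε₃ - ε₄] = 0`, one can consistently specialise to `τ₃ = 0` and `f₃ = g₃ = ∞`
    -- (`τ₃ = σ / f₃ → 0` with `s₀(τ₃) = f₃ τ₃ = σ` fixed).
    (∀ e : Param, br2 ω e 3 4 = 0 → GenericOff ω {(3, 4)} e →
      GenericOff ω {(3, 4)} (actParam tWord e) → ∀ f₁ f₂ : ℂ,
      (∃! h : ℂ × ℂ, SpecStep ω e f₁ f₂ h.1 h.2) ∧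
      (∀ σ : ℂ, Tendsto (fun z : ℂ => polyP ω e 3 f₁ f₂ z * (σ / z)) (Bornology.cobounded ℂ) (𝓝 0)) ∧
      (br2 ω e 2 3 * br3 ω e 2 3 4 * br3 ω e 2 3 6 * br3 ω e 1 4 6 * f₂ ≠
          br2 ω e 1 3 * br3 ω e 1 3 4 * br3 ω e 1 3 6 * br3 ω e 2 4 6 * f₁ →
        Tendsto (fun z : ℂ => (polyQ ω e 3 f₁ f₂ z / polyP ω e 3 f₁ f₂ z)⁻¹)
          (Bornology.cobounded ℂ) (𝓝 0)) ∧
      ∀ g₁ g₂ : ℂ, SpecG ω e 1 f₁ f₂ g₁ → SpecG ω e 2 f₁ f₂ g₂ →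
        (∀ σ : ℂ, Tendsto (fun z : ℂ => polyR ω e 3 g₁ g₂ z * (σ / z))
          (Bornology.cobounded ℂ) (𝓝 0)) ∧
        (br2 ω e 4 5 * br3 ω e 1 2 8 * br3 ω (bar7 e) 4 5 7 * br3 ω (bar7 e) 3 7 8 * g₂ ≠
            br2 ω e 4 8 * br3 ω e 1 2 5 * br3 ω (bar7 e) 4 7 8 * br3 ω (bar7 e) 3 5 7 * g₁ →
          Tendsto (fun z : ℂ => (polyS ω e 3 g₁ g₂ z / polyR ω e 3 g₁ g₂ z)⁻¹)
            (Bornology.cobounded ℂ) (𝓝 0))) ∧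
    -- The transformation `w = s₂₈₉ s₄₈ s₃₉`: it commutes with `T`, takes the condition
    -- `ε₃ = ε₄` to `ε₉ = ε₈`, and `F = w(f₁) = τ₈/τ₁`.
    (∀ e : Param, actParam wWord (actParam tWord e) = actParam tWord (actParam wWord e) ∧
      actParam wWord e 3 - actParam wWord e 4 = e 9 - e 8) ∧
    (∀ x : TauPoint, Regular ω wWord x → (actPoint ω wWord x).f 1 = x.tau 8 / x.tau 1) ∧
    -- Reduction to the linear equation for `Φ`, along any orbit of `T` with `ε₈ = ε₉`.
    (∀ (e : ℤ → Param) (I : Set ℤ), (∀ k, e (k + 1) = actParam tWord (e k)) →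
      (∀ k, e k 8 = e k 9) →
      (∀ k ∈ I, GenericOff ω {(8, 9)} (e k) ∧ br2 ω (bar7 (e k)) 7 6 ≠ 0) →
      (∃ g : ℤ → ℂ, IsGauge ω e I g) ∧
      ∀ g Φ : ℤ → ℂ, IsGauge ω e I g →
        ((∃ F₂ : ℤ → ℂ, ∀ k ∈ I, k + 1 ∈ I → SpecStep ω (actParam wWord (e k))
            (g k * Φ k) (F₂ k) (g (k + 1) * Φ (k + 1)) (F₂ (k + 1))) ↔
          ∀ k ∈ I, k - 1 ∈ I → k + 1 ∈ I → EqPhi ω (e k) (Φ (k - 1)) (Φ k) (Φ (k + 1)))) ∧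
    -- In the parameters `u` it is the elliptic hypergeometric equation.
    (∀ e₀ e₁ e₂ : Param, e₁ = actParam tWord e₀ → e₂ = actParam tWord e₁ → e₁ 8 = e₁ 9 →
      Balanced (del e₁) (uOf e₁) ∧ del e₂ = del e₁ ∧
      uOf e₂ = shiftU (del e₁) 6 7 (uOf e₁) ∧ uOf e₀ = shiftU (del e₁) 7 6 (uOf e₁) ∧
      ∀ Φ : (Fin 8 → ℂ) → ℂ,
        (EqPhi ω e₁ (Φ (uOf e₀)) (Φ (uOf e₁)) (Φ (uOf e₂)) ↔ EHE ω (del e₁) Φ (uOf e₁))) ∧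
    -- The terminating series `₁₀E₉` solves the elliptic hypergeometric equation.
    (∀ (δ : ℂ) (u : Fin 8 → ℂ), Balanced δ u → Terminates δ u →
      WellDefined ω δ u → WellDefined ω δ (shiftU δ 6 7 u) → WellDefined ω δ (shiftU δ 7 6 u) →
      br ω (u 7 - u 6) ≠ 0 → br ω (u 7 - u 6 + δ) ≠ 0 → br ω (u 7 - u 6 - δ) ≠ 0 →
      EHE ω δ (E109 ω δ) u) ∧
    -- Hence `F = g · ₁₀E₉` gives a particular solution of the elliptic Painlevé equation.
    (∀ (e : ℤ → Param) (I : Set ℤ), (∀ k, e (k + 1) = actParam tWord (e k)) →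
      (∀ k, e k 8 = e k 9) →
      (∀ k ∈ I, GenericOff ω {(8, 9)} (e k) ∧ br2 ω (bar7 (e k)) 7 6 ≠ 0 ∧
        Terminates (del (e k)) (uOf (e k)) ∧ WellDefined ω (del (e k)) (uOf (e k))) →
      ∀ g : ℤ → ℂ, IsGauge ω e I g →
        ∃ F₂ : ℤ → ℂ, ∀ k ∈ I, k + 1 ∈ I → SpecStep ω (actParam wWord (e k))
          (g k * E109 ω (del (e k)) (uOf (e k))) (F₂ k)
          (g (k + 1) * E109 ω (del (e (k + 1))) (uOf (e (k + 1)))) (F₂ (k + 1))) := by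
  refine ⟨actParam_tWord_apply, fun x hx i hi => ?_, fun e h34 hg hT f₁ f₂ =>
    specialisation h34 hg hT f₁ f₂, fun e => ⟨actParam_wWord_tWord e, ?_⟩,
    fun x hx => wWord_f_one hω hx, fun e I he h89 hI => ⟨exists_isGauge he h89 hI,
      fun g Φ hg => specStep_iff_eqPhi hω he h89 hI hg Φ⟩, ?_,
    fun δ u hb ht hw hw₁ hw₂ n n₁ n₂ => e109_ehe hω hb ht hw hw₁ hw₂ n n₁ n₂,
    fun e I he h89 hI g hg => ?_⟩
  · have h₁ := muWord_explicit hω (Regular.left (v := muWord) hx) i hi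
    have h₂ := tWord_explicit hω hx hi
    exact ⟨h₁.1, h₂.1, h₁.2, h₂.2⟩
  · rw [actParam_wWord]
    simp
  · rintro e₀ e₁ e₂ h₁ rfl h89
    have u₀ : uOf e₀ = shiftU (del e₁) 7 6 (uOf e₁) := by
      rw [h₁, uOf_tWord, del_tWord, shiftU_shiftU]
    refine ⟨balanced_uOf h89, del_tWord e₁, uOf_tWord e₁, u₀, fun Φ => ?_⟩
    rw [u₀, uOf_tWord]
    exact eqPhi_iff_ehe ω e₁ Φ
  · exact (specStep_iff_eqPhi hω he h89 (fun k hk => ⟨(hI k hk).1, (hI k hk).2.1⟩) hg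
      fun k => E109 ω (del (e k)) (uOf (e k))).2 fun k hk hk₁ hk₂ =>
        e109_eqPhi hω he h89 hI hk hk₁ hk₂
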